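/- Let $d\ge 2$, $N\in\mathbb N_0$, let $A\in\mathbb R^{d\times d}$ be non-singular, $\Lambda=A\mathbb Z^d$, and write $|\ell|_0:=|\ell|+2$. For $u:\Lambda\to\mathbb R^N$ put $D_\rho u(\ell)=u(\ell+\rho)-u(\ell)$ and $D_{(\rho_1,\dots,\rho_j)}=D_{\rho_1}\cdots D_{\rho_j}$. Let $\mathcal R\subset\Lambda\setminus\{0\}$ be finite with $\mathcal R=-\mathcal R$ and $\operatorname{span}_{\mathbb Z}\mathcal R=\Lambda$; let $Du(\ell)=(D_\rho u(\ell))_{\rho\in\mathcal R}$ and let $|D^ju(\ell)|$ be the Euclidean norm of $(D_{\boldsymbol\rho}u(\ell))_{\boldsymbol\rho\in\mathcal R^j}$. Let $V\in C^2(\mathbb R^{N\times\mathcal R};\mathbb R)$ satisfy $V(a)=V((-a_{-\rho})_{\rho\in\mathcal R})$, and let $$H[u](\ell)=\sum_{\rho\in\mathcal R}D_{-\rho}\big(\nabla^2V(0)[Du]\big)_{\cdot\rho}(\ell).$$ Assume lattice stability: there is $c_0>0$ with $\sum_{\ell}\nabla^2V(0)[Du(\ell),Du(\ell)]\ge c_0\|Du\|_{\ell^2}^2$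 for all $u$ such that $\operatorname{supp}(Du)$ is bounded. For $f:\Lambda\to[0,\infty)$, $f\lesssim|\ell|_0^a\log^\beta|\ell|_0$ means $f(\ell)\le C|\ell|_0^a\log^\beta|\ell|_0$ for all $\ell\in\Lambda$, with $C$ independent of $\ell$. A lattice Green's function is a $\mathcal G:\Lambda\to\mathbb R^{N\times N}$, with columns $\mathcal G_k=\mathcal Ge_k$, such that $H[\mathcal G_k](\ell)=e_k\delta_{\ell,0}$ for $1\le k\le N$ and $|D^j\mathcal G(\ell)|\lesssim|\ell|_0^{2-d-j}$ for all $j\ge1$. Theorem. A lattice Green's function exists. Moreover, let $\mathcal G$ be any lattice Green's function, $p,\alpha\in\mathbb N_0$, and let $u:\Lambda\to\mathbb R^N$ satisfy $Du\in\ell^2$ and $|H[u]|\lesssim|\ell|_0^{-d-p}\log^\alpha|\ell|_0$. Let $\mathcal S\subset\Lambda$ be linearly independent with $\operatorname{span}_{\mathbb Z}\mathcal S=\Lambda$. Then there are symmetric tensors $b^{(i,k)}\in(\mathbb R^{\mathcal S})^{\odot i}$, $0\le i\le p-1$, $1\le k\le N$, and $w:\Lambda\to\mathbb R^N$ such that $$u=\sum_{i=0}^{p-1}\sum_{k=1}^N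 b^{(i,k)}:D^i_{\mathcal S}\mathcal G_k+w,\qquad b^{(i,k)}:D^i_{\mathcal S}\mathcal G_k=\sum_{\boldsymbol\sigma\in\mathcal S^i}b^{(i,k)}_{\boldsymbol\sigma}D_{\boldsymbol\sigma}\mathcal G_k,$$ and $$|D^jw|\lesssim|\ell|_0^{2-d-p-j}\log^{\alpha+1}|\ell|_0\qquad(\ast)$$ for $j=1,2$. For the same $b^{(i,k)}$ and $w$, and for each $j\ge3$, $(\ast)$ also holds provided that $|D^mH[u]|\lesssim|\ell|_0^{-d-p-m}\log^\alpha|\ell|_0$ for all $m=1,\dots,j-2$. -/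

import Mathlib

noncomputable section

/-- The Bravais lattice `A ℤ^d ⊂ ℝ^d`, with the Euclidean norm inherited from `ℝ^d`. -/
def bravaisLattice {d : ℕ} (A : Matrix (Fin d) (Fin d) ℝ) :
    AddSubgroup (EuclideanSpace ℝ (Fin d)) where
  carrier := {x | ∃ n : Fin d → ℤ, x = WithLp.toLp 2 (A.mulVec (fun i => (n i : ℝ)))}
  zero_mem' := ⟨0, by ext i; simp [Matrix.mulVec, dotProduct]⟩
  add_mem' := by
    rintro _ _ ⟨m, rfl⟩ ⟨n, rfl⟩
    exact ⟨m + n, by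
      ext i; simp [Matrix.mulVec, dotProduct, mul_add, Finset.sum_add_distrib]⟩
  neg_mem' := by
    rintro _ ⟨m, rfl⟩
    exact ⟨-m, by ext i; simp [Matrix.mulVec, dotProduct]⟩

section Differences

variable {L E : Type*} [AddCommGroup L]

/-- The discrete difference `D_ρ u(ℓ) = u(ℓ + ρ) - u(ℓ)`. -/
def latticeDiff [AddCommGroup E] (ρ : L) (u : L → E) : L → E := fun l => u (l + ρ) - u l

/-- The higher discrete difference `D_ρ = D_{ρ₁} ⋯ D_{ρ_j}` for a tuple `ρ = (ρ₁, …, ρ_j)`. -/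
def iterDiff [AddCommGroup E] : (j : ℕ) → (Fin j → L) → (L → E) → L → E
  | 0, _, u => u
  | j + 1, ρ, u => latticeDiff (ρ 0) (iterDiff j (fun i => ρ i.succ) u)

/-- The stencil `Du(ℓ) = (D_ρ u(ℓ))_{ρ ∈ R}`. -/
def stencil [AddCommGroup E] (R : Finset L) (u : L → E) (l : L) : R → E :=
  fun ρ => latticeDiff (ρ : L) u l

/-- The Euclidean (Frobenius) norm `|D^j u(ℓ)|` of the tensor `(D_ρ u(ℓ))_{ρ ∈ R^j}`. -/
def normIterStencil [NormedAddCommGroup E] (R : Finset L) (j : ℕ) (u : L → E) (l : L) : ℝ :=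
  Real.sqrt (∑ ρ : Fin j → R, ‖iterDiff j (fun i => (ρ i : L)) u l‖ ^ 2)

/-- The contraction `b : D_S^i u(ℓ) = ∑_{σ ∈ S^i} b_σ D_σ u(ℓ)`. -/
def contractDiff [AddCommGroup E] [Module ℝ E] (S : Finset L) (i : ℕ)
    (b : (Fin i → S) → ℝ) (u : L → E) (l : L) : E :=
  ∑ σ : Fin i → S, b σ • iterDiff i (fun m => (σ m : L)) u l

/-- A tensor in `(ℝ^S)^{⊗ i}`, given by its entries, is symmetric, i.e. lies in `(ℝ^S)^{⊙ i}`. -/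
def IsSymmTensor {S : Type*} {i : ℕ} (b : (Fin i → S) → ℝ) : Prop :=
  ∀ (π : Equiv.Perm (Fin i)) (σ : Fin i → S), b (σ ∘ π) = b σ

end Differences

/-- `u ∈ 𝓗¹`, i.e. `Du ∈ ℓ²`. -/
def InEnergySpace {L E : Type*} [AddCommGroup L] [NormedAddCommGroup E] (R : Finset L)
    (u : L → E) : Prop :=
  Summable fun l => ∑ ρ : R, ‖stencil R u l ρ‖ ^ 2

/-- `‖u‖²_{𝓗¹} = ‖Du‖²_{ℓ²}`. -/
def energyNormSq {L E : Type*} [AddCommGroup L] [NormedAddCommGroup E] (R : Finset L)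
    (u : L → E) : ℝ :=
  ∑' l, ∑ ρ : R, ‖stencil R u l ρ‖ ^ 2

/-- `u ∈ 𝓗ᶜ`, i.e. `supp (Du)` is bounded. -/
def InCompactSpace {L E : Type*} [NormedAddCommGroup L] [NormedAddCommGroup E] (R : Finset L)
    (u : L → E) : Prop :=
  Bornology.IsBounded {l | stencil R u l ≠ 0}

section Hamiltonian

variable {L : Type*} [AddCommGroup L] {N : ℕ} (R : Finset L)
  (V : (R → EuclideanSpace ℝ (Fin N)) → ℝ)

/-- The bilinear form `∇²V(0)[a, b]`. -/
def siteHessian (a b : R → EuclideanSpace ℝ (Fin N)) : ℝ :=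
  fderiv ℝ (fderiv ℝ V) 0 a b

open Classical in
/-- `∇²V(0)[a]` as an element of `ℝ^{N × R}`: its `(k, ρ)` entry is `∇²V(0)[a, e_k ⊗ e_ρ]`. -/
def siteHessianVec (a : R → EuclideanSpace ℝ (Fin N)) : R → EuclideanSpace ℝ (Fin N) :=
  fun ρ => WithLp.toLp 2 fun k =>
    siteHessian R V a (Pi.single ρ (EuclideanSpace.single k 1))

/-- The discrete divergence `Div g = - ∑_{ρ ∈ R} D_{-ρ} g_{·ρ}`. -/
def latticeDiv (g : L → R → EuclideanSpace ℝ (Fin N)) (l : L) : EuclideanSpace ℝ (Fin N) :=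
  -∑ ρ : R, latticeDiff (-(ρ : L)) (fun l' => g l' ρ) l

/-- The pointwise Hamiltonian `H[u](ℓ) = -Div (∇²V(0)[Du])(ℓ)`. -/
def hamiltonian (u : L → EuclideanSpace ℝ (Fin N)) (l : L) : EuclideanSpace ℝ (Fin N) :=
  -latticeDiv R (fun l' => siteHessianVec R V (stencil R u l')) l

/-- The quadratic form `H[u, u] = ∑_ℓ ∇²V(0)[Du(ℓ), Du(ℓ)]`, used for `u ∈ 𝓗ᶜ` only, where the
sum is finite. -/
def hamiltonianForm (u : L → EuclideanSpace ℝ (Fin N)) : ℝ :=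
  ∑' l, siteHessian R V (stencil R u l) (stencil R u l)

end Hamiltonian

/-- Lattice stability: `H[u, u] ≥ c₀ ‖u‖²_{𝓗¹}` on `𝓗ᶜ` for some `c₀ > 0`. -/
def LatticeStable {L : Type*} [NormedAddCommGroup L] {N : ℕ} (R : Finset L)
    (V : (R → EuclideanSpace ℝ (Fin N)) → ℝ) : Prop :=
  ∃ c₀ : ℝ, 0 < c₀ ∧ ∀ u : L → EuclideanSpace ℝ (Fin N), InCompactSpace R u →
    c₀ * energyNormSq R u ≤ hamiltonianForm R V u

/-- `|ℓ|₀ = |ℓ| + 2`. -/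
def shiftedNorm {L : Type*} [NormedAddCommGroup L] (l : L) : ℝ := ‖l‖ + 2

/-- `f(ℓ) ≲ |ℓ|₀^a log^β |ℓ|₀`. -/
def DecaysLike {L : Type*} [NormedAddCommGroup L] (f : L → ℝ) (a : ℤ) (β : ℕ) : Prop :=
  ∃ C : ℝ, ∀ l, f l ≤ C * shiftedNorm l ^ a * Real.log (shiftedNorm l) ^ β

/-- The column `𝒢_k = 𝒢 e_k` of a matrix field. -/
def matrixColumn {L : Type*} {N : ℕ} (G : L → Matrix (Fin N) (Fin N) ℝ) (k : Fin N) :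
    L → EuclideanSpace ℝ (Fin N) :=
  fun l => WithLp.toLp 2 fun i => G l i k

open Classical in
/-- `𝒢` is a lattice Green's function in dimension `d`: `H[𝒢 e_k](ℓ) = e_k δ_{ℓ,0}` and
`|D^j 𝒢(ℓ)| ≲ |ℓ|₀^{2-d-j}` for all `j ≥ 1`. (The estimate is imposed on each of the finitely
many columns.) -/
structure IsLatticeGreensFunction {L : Type*} [NormedAddCommGroup L] {N : ℕ} (d : ℕ)
    (R : Finset L) (V : (R → EuclideanSpace ℝ (Fin N)) → ℝ)
    (G : L → Matrix (Fin N) (Fin N) ℝ) : Prop where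
  equation : ∀ (k : Fin N) (l : L), hamiltonian R V (matrixColumn G k) l =
    if l = 0 then EuclideanSpace.single k 1 else 0
  decay : ∀ j : ℕ, 1 ≤ j → ∀ k : Fin N,
    DecaysLike (normIterStencil R j (matrixColumn G k)) (2 - (d : ℤ) - j) 0

end

/-! The residual H[u] is treated as a charge density, and the theorem is its multipole expansion.
The proof is real-variable throughout: the Green's function and Liouville's theorem come from
interior regularity of harmonic fields, that is, solutions of H[u] = 0, and not from Fourier
analysis.

Regularity. Stability tested with a cut-off times a harmonic field gives a Caccioppoli inequality
(`caccioppoli`). Differences of harmonic fields are harmonic, so it iterates; with a Sobolev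
inequality on boxes (`sobolev_box`) it bounds a value by the mean square over a ball (`mean_value`).
This yields the gradient estimate |D_a u(x)| ≲ sup|u|/r on balls of radius r (`gradient_estimate`)
and Liouville's theorem (`latticeDiff_eq_zero_of_bounded`).

Existence. For the dipole source D_a(e_k δ₀), finite Dirichlet problems have energies bounded
independently of the domain. Duality and two applications of the mean value bound give |Dv(y)| ≲
|y|^{-d} (`dirichlet_dipole_decay`), and a limit exists on the whole lattice (`exists_dipole`).
Summing translated dipoles along a ray telescopes the sources to one point source. The sum decays
well on one side of a hyperplane; the sum along the opposite ray does so on the other side, and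
Liouville's theorem identifies their differences up to sign (`exists_fundamental_solution`). Higher
differences decay by the gradient estimate on balls of radius |y|/2.

Expansion. Newton polynomials are dual to differences as monomials are to derivatives. Taking as
coefficients the moments of H[u] against them, the combination of differences of the 𝒢_k has the
same moments of degree below p as u (`hasSum_moment_sub_multipole`), so g = H[w] has vanishing
moments below p. By Liouville, D_ρ w = Σ_k g_k * D_ρ 𝒢_k. In this convolution the discrete Taylor
polynomial of the kernel may be subtracted for free, which gains the factor |ℓ|₀^{-p}; the critical
sum of |m|₀^{-d} log^α|m|₀ over a ball costs one logarithm (`exists_convolution`). For j ≥ 2 two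
differences stay on 𝒢 and the other j-2 are moved onto g, where each raises the order of the
vanishing moments by one (`listDiff_decay_of_moments`). -/

open Filter Topology RealInnerProductSpace

/-! ### Iterated differences -/

section ListDiff

variable {L E : Type*} [AddCommGroup L] [AddCommGroup E]

theorem latticeDiff_apply (a : L) (u : L → E) (l : L) :
    latticeDiff a u l = u (l + a) - u l := rfl

theorem latticeDiff_comm (a b : L) (u : L → E) :
    latticeDiff a (latticeDiff b u) = latticeDiff b (latticeDiff a u) := by
  funext l
  simp only [latticeDiff]
  rw [add_right_comm l a b]
  abel

theorem latticeDiff_zero_left (u : L → E) : latticeDiff 0 u = 0 := by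
  funext l; simp [latticeDiff]

theorem latticeDiff_add_left (a b : L) (u : L → E) (l : L) :
    latticeDiff (a + b) u l = latticeDiff a u (l + b) + latticeDiff b u l := by
  simp only [latticeDiff, add_assoc, add_comm b a]
  abel

theorem latticeDiff_neg_left (a : L) (u : L → E) (l : L) :
    latticeDiff (-a) u l = -latticeDiff a u (l - a) := by
  simp [latticeDiff, sub_eq_add_neg]

/-- The difference along a list of directions. -/
def listDiff : List L → (L → E) → L → E
  | [], u => u
  | a :: s, u => latticeDiff a (listDiff s u)

@[simp] theorem listDiff_nil (u : L → E) : listDiff [] u = u := rfl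

@[simp] theorem listDiff_cons (a : L) (s : List L) (u : L → E) :
    listDiff (a :: s) u = latticeDiff a (listDiff s u) := rfl

theorem listDiff_latticeDiff (s : List L) (a : L) (u : L → E) :
    listDiff s (latticeDiff a u) = latticeDiff a (listDiff s u) := by
  induction s with
  | nil => rfl
  | cons b s ih => rw [listDiff_cons, ih, latticeDiff_comm, listDiff_cons]

theorem listDiff_append (s t : List L) (u : L → E) :
    listDiff (s ++ t) u = listDiff s (listDiff t u) := by
  induction s with
  | nil => rfl
  | cons b s ih => rw [List.cons_append, listDiff_cons, ih, listDiff_cons]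

theorem listDiff_perm {s t : List L} (h : s.Perm t) (u : L → E) :
    listDiff s u = listDiff t u := by
  induction h with
  | nil => rfl
  | cons a _ ih => rw [listDiff_cons, listDiff_cons, ih]
  | swap a b s => simp only [listDiff_cons]; rw [latticeDiff_comm]
  | trans _ _ ih1 ih2 => exact ih1.trans ih2

theorem iterDiff_eq_listDiff (j : ℕ) (ρ : Fin j → L) (u : L → E) :
    iterDiff j ρ u = listDiff (List.ofFn ρ) u := by
  induction j with
  | zero => simp [iterDiff]
  | succ j ih => rw [List.ofFn_succ, listDiff_cons, iterDiff, ih]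

theorem listDiff_add (s : List L) (u v : L → E) :
    listDiff s (u + v) = listDiff s u + listDiff s v := by
  induction s with
  | nil => rfl
  | cons b s ih => simp only [listDiff_cons, ih]; funext l; simp [latticeDiff]; abel

theorem listDiff_neg (s : List L) (u : L → E) : listDiff s (-u) = -listDiff s u := by
  induction s with
  | nil => rfl
  | cons b s ih => simp only [listDiff_cons, ih]; funext l; simp [latticeDiff]; abel

theorem listDiff_sub (s : List L) (u v : L → E) :
    listDiff s (u - v) = listDiff s u - listDiff s v := by
  rw [sub_eq_add_neg, listDiff_add, listDiff_neg, sub_eq_add_neg]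

theorem listDiff_zero (s : List L) : listDiff s (0 : L → E) = 0 := by
  simpa using listDiff_sub s (0 : L → E) 0

theorem listDiff_smul [Module ℝ E] (s : List L) (c : ℝ) (u : L → E) :
    listDiff s (c • u) = c • listDiff s u := by
  induction s with
  | nil => rfl
  | cons b s ih => simp only [listDiff_cons, ih]; funext l; simp [latticeDiff, smul_sub]

theorem listDiff_sum {ι : Type*} (s : List L) (I : Finset ι) (u : ι → L → E) :
    listDiff s (∑ i ∈ I, u i) = ∑ i ∈ I, listDiff s (u i) := by
  classical
  induction I using Finset.induction_on with
  | empty => simp [listDiff_zero]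
  | insert a I ha ih => rw [Finset.sum_insert ha, Finset.sum_insert ha, listDiff_add, ih]

theorem listDiff_shift (s : List L) (a : L) (u : L → E) (l : L) :
    listDiff s (fun l => u (l + a)) l = listDiff s u (l + a) := by
  induction s generalizing l with
  | nil => rfl
  | cons b s ih => simp only [listDiff_cons, latticeDiff, ih]; rw [add_right_comm]

/-- A property of families of functions stable under sums of translates passes from differences in
generating directions to differences in all directions. -/
theorem latticeDiff_induction {R : Set L} (hR : AddSubgroup.closure R = ⊤) {p : L → Prop}
    (mem : ∀ a ∈ R, p a) (zero : p 0) (add : ∀ a b, p a → p b → p (a + b))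
    (neg : ∀ a, p a → p (-a)) (a : L) : p a := by
  have ha : a ∈ AddSubgroup.closure R := hR ▸ AddSubgroup.mem_top a
  induction ha using AddSubgroup.closure_induction with
  | mem a ha => exact mem a ha
  | zero => exact zero
  | add a b _ _ iha ihb => exact add a b iha ihb
  | neg a _ iha => exact neg a iha

end ListDiff

/-! ### The Hamiltonian -/

section SiteHessian

variable {L : Type*} {N : ℕ} (R : Finset L)
  (V : (R → EuclideanSpace ℝ (Fin N)) → ℝ)

theorem siteHessian_add_left (a a' b : R → EuclideanSpace ℝ (Fin N)) :
    siteHessian R V (a + a') b = siteHessian R V a b + siteHessian R V a' b := by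
  simp [siteHessian]

theorem siteHessian_add_right (a b b' : R → EuclideanSpace ℝ (Fin N)) :
    siteHessian R V a (b + b') = siteHessian R V a b + siteHessian R V a b' := by
  simp [siteHessian]

theorem siteHessian_smul_left (c : ℝ) (a b : R → EuclideanSpace ℝ (Fin N)) :
    siteHessian R V (c • a) b = c * siteHessian R V a b := by
  simp [siteHessian]

theorem siteHessian_smul_right (c : ℝ) (a b : R → EuclideanSpace ℝ (Fin N)) :
    siteHessian R V a (c • b) = c * siteHessian R V a b := by
  simp [siteHessian]

theorem siteHessian_zero_left (b : R → EuclideanSpace ℝ (Fin N)) :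
    siteHessian R V 0 b = 0 := by simp [siteHessian]

theorem siteHessian_zero_right (a : R → EuclideanSpace ℝ (Fin N)) :
    siteHessian R V a 0 = 0 := by simp [siteHessian]

theorem abs_siteHessian_le (a b : R → EuclideanSpace ℝ (Fin N)) :
    |siteHessian R V a b| ≤ ‖fderiv ℝ (fderiv ℝ V) 0‖ * ‖a‖ * ‖b‖ :=
  ContinuousLinearMap.le_opNorm₂ (fderiv ℝ (fderiv ℝ V) 0) a b

theorem siteHessian_symm (hV : ContDiff ℝ 2 V) (a b : R → EuclideanSpace ℝ (Fin N)) :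
    siteHessian R V a b = siteHessian R V b a :=
  (hV.contDiffAt.isSymmSndFDerivAt (by simp)).eq a b

/-- Written as an inner product with `siteHessianVec`, the form is accessible to summation by parts.
-/
theorem siteHessian_eq_sum_inner (a b : R → EuclideanSpace ℝ (Fin N)) :
    siteHessian R V a b = ∑ ρ : R, ⟪siteHessianVec R V a ρ, b ρ⟫ := by
  classical
  have hb : b = ∑ ρ : R, ∑ k : Fin N, (b ρ k) • Pi.single (M := fun _ : R => EuclideanSpace ℝ (Fin N)) ρ
      (EuclideanSpace.single k (1 : ℝ)) := by
    funext σ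
    rw [Finset.sum_apply, Finset.sum_eq_single σ]
    · ext i
      simp [Finset.sum_apply, Pi.single_apply]
    · intro ρ _ h
      simp [h.symm]
    · simp
  conv_lhs => rw [hb]
  simp only [siteHessian, map_sum, map_smul, smul_eq_mul]
  refine Finset.sum_congr rfl fun ρ _ => ?_
  rw [PiLp.inner_apply]
  refine Finset.sum_congr rfl fun k _ => ?_
  simp only [siteHessianVec, siteHessian, RCLike.inner_apply, conj_trivial]

theorem continuous_siteHessianVec : Continuous (siteHessianVec R V) := by
  refine continuous_pi fun ρ => ?_
  unfold siteHessianVec siteHessian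
  fun_prop

theorem siteHessianVec_add (a b : R → EuclideanSpace ℝ (Fin N)) :
    siteHessianVec R V (a + b) = siteHessianVec R V a + siteHessianVec R V b := by
  funext ρ; ext k; simp [siteHessianVec, siteHessian]

theorem siteHessianVec_smul (c : ℝ) (a : R → EuclideanSpace ℝ (Fin N)) :
    siteHessianVec R V (c • a) = c • siteHessianVec R V a := by
  funext ρ; ext k; simp [siteHessianVec, siteHessian]

end SiteHessian

section Hamiltonian

variable {L : Type*} [AddCommGroup L] {N : ℕ} (R : Finset L)
  (V : (R → EuclideanSpace ℝ (Fin N)) → ℝ)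

theorem hamiltonian_apply (u : L → EuclideanSpace ℝ (Fin N)) (l : L) :
    hamiltonian R V u l = ∑ ρ : R, (siteHessianVec R V (stencil R u (l - ρ)) ρ -
      siteHessianVec R V (stencil R u l) ρ) := by
  simp [hamiltonian, latticeDiv, latticeDiff, sub_eq_add_neg]

theorem stencil_add (u v : L → EuclideanSpace ℝ (Fin N)) (l : L) :
    stencil R (u + v) l = stencil R u l + stencil R v l := by
  funext ρ; simp [stencil, latticeDiff]; abel

theorem stencil_smul (c : ℝ) (u : L → EuclideanSpace ℝ (Fin N)) (l : L) :
    stencil R (c • u) l = c • stencil R u l := by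
  funext ρ; simp [stencil, latticeDiff, smul_sub]

/-- The Hamiltonian at a fixed site, as a continuous linear map for the topology of pointwise
convergence. -/
noncomputable def hamiltonianCLM (l : L) :
    (L → EuclideanSpace ℝ (Fin N)) →L[ℝ] EuclideanSpace ℝ (Fin N) where
  toFun u := hamiltonian R V u l
  map_add' u v := by
    simp only [hamiltonian_apply, stencil_add, siteHessianVec_add, Pi.add_apply,
      ← Finset.sum_add_distrib]
    exact Finset.sum_congr rfl fun ρ _ => by abel
  map_smul' c u := by
    simp only [hamiltonian_apply, stencil_smul, siteHessianVec_smul, Pi.smul_apply,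
      Finset.smul_sum, smul_sub, RingHom.id_apply]
  -- Only finitely many sites enter, so the map is continuous for the product topology. This is what
  -- lets the Hamiltonian pass through pointwise limits and infinite sums.
  cont := by
    simp only [hamiltonian_apply]
    have h : ∀ m : L, Continuous fun u : L → EuclideanSpace ℝ (Fin N) => stencil R u m := by
      intro m
      refine continuous_pi fun ρ => ?_
      unfold stencil latticeDiff
      fun_prop
    have h' := continuous_siteHessianVec R V
    refine continuous_finsetSum _ fun ρ _ => ?_
    exact ((continuous_apply ρ).comp (h'.comp (h _))).sub
      ((continuous_apply ρ).comp (h'.comp (h _)))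

theorem hamiltonianCLM_apply (u : L → EuclideanSpace ℝ (Fin N)) (l : L) :
    hamiltonianCLM R V l u = hamiltonian R V u l := rfl

theorem hamiltonian_add (u v : L → EuclideanSpace ℝ (Fin N)) :
    hamiltonian R V (u + v) = hamiltonian R V u + hamiltonian R V v := by
  funext l; exact (hamiltonianCLM R V l).map_add u v

theorem hamiltonian_sub (u v : L → EuclideanSpace ℝ (Fin N)) :
    hamiltonian R V (u - v) = hamiltonian R V u - hamiltonian R V v := by
  funext l; exact (hamiltonianCLM R V l).map_sub u v

theorem hamiltonian_smul (c : ℝ) (u : L → EuclideanSpace ℝ (Fin N)) :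
    hamiltonian R V (c • u) = c • hamiltonian R V u := by
  funext l; exact (hamiltonianCLM R V l).map_smul c u

theorem hamiltonian_sum {ι : Type*} (I : Finset ι) (u : ι → L → EuclideanSpace ℝ (Fin N)) :
    hamiltonian R V (∑ i ∈ I, u i) = ∑ i ∈ I, hamiltonian R V (u i) := by
  funext l
  rw [Finset.sum_apply]
  exact map_sum (hamiltonianCLM R V l) u I

theorem stencil_shift (u : L → EuclideanSpace ℝ (Fin N)) (a l : L) :
    stencil R (fun l => u (l + a)) l = stencil R u (l + a) := by
  funext ρ; simp [stencil, latticeDiff, add_right_comm]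

theorem hamiltonian_shift (u : L → EuclideanSpace ℝ (Fin N)) (a l : L) :
    hamiltonian R V (fun l => u (l + a)) l = hamiltonian R V u (l + a) := by
  simp only [hamiltonian_apply, stencil_shift, sub_add_eq_add_sub]

theorem hamiltonian_shift_sub (u : L → EuclideanSpace ℝ (Fin N)) (a l : L) :
    hamiltonian R V (fun l => u (l - a)) l = hamiltonian R V u (l - a) := by
  simpa [sub_eq_add_neg] using hamiltonian_shift R V u (-a) l

theorem hamiltonian_const (c : EuclideanSpace ℝ (Fin N)) :
    hamiltonian R V (fun _ : L => c) = 0 := by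
  funext l
  have h : ∀ m, stencil R (fun _ : L => c) m = 0 := by
    intro m; funext ρ; simp [stencil, latticeDiff]
  simp [hamiltonian_apply, h]

theorem hamiltonian_latticeDiff (a : L) (u : L → EuclideanSpace ℝ (Fin N)) :
    hamiltonian R V (latticeDiff a u) = latticeDiff a (hamiltonian R V u) := by
  have h : latticeDiff a u = (fun l => u (l + a)) - u := rfl
  rw [h, hamiltonian_sub]
  funext l
  simp [hamiltonian_shift, latticeDiff]

theorem hamiltonian_listDiff (s : List L) (u : L → EuclideanSpace ℝ (Fin N)) :
    hamiltonian R V (listDiff s u) = listDiff s (hamiltonian R V u) := by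
  induction s with
  | nil => rfl
  | cons a s ih => rw [listDiff_cons, hamiltonian_latticeDiff, ih, listDiff_cons]

/-- Summation by parts against a finitely supported field. -/
theorem tsum_inner_stencil (g : L → R → EuclideanSpace ℝ (Fin N))
    (ψ : L → EuclideanSpace ℝ (Fin N)) (hψ : ψ.support.Finite) :
    ∑' l, ∑ ρ : R, ⟪g l ρ, stencil R ψ l ρ⟫ = ∑' l, ⟪-latticeDiv R g l, ψ l⟫ := by
  have hs : ∀ (F : L → EuclideanSpace ℝ (Fin N)), Summable fun l => ⟪F l, ψ l⟫ := fun F =>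
    summable_of_hasFiniteSupport (hψ.subset fun l hl => by
      simp only [Function.mem_support] at hl ⊢
      contrapose! hl
      simp [hl])
  have key : ∀ (a : L) (F : L → EuclideanSpace ℝ (Fin N)),
      HasSum (fun l => ⟪F l, ψ (l + a)⟫) (∑' l, ⟪F (l - a), ψ l⟫) := by
    intro a F
    have h := (hs fun l => F (l - a)).hasSum
    rw [← (Equiv.addRight a).hasSum_iff] at h
    convert h using 2
    simp
  have h1 : HasSum (fun l => ∑ ρ : R, ⟪g l ρ, stencil R ψ l ρ⟫)
      (∑ ρ : R, (∑' l, ⟪g (l - ρ) ρ, ψ l⟫ - ∑' l, ⟪g l ρ, ψ l⟫)) := by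
    refine hasSum_sum fun ρ _ => ?_
    have := (key ρ fun l => g l ρ).sub (hs fun l => g l ρ).hasSum
    refine this.congr_fun fun l => ?_
    simp [stencil, latticeDiff, inner_sub_right]
  rw [h1.tsum_eq]
  have h2 : HasSum (fun l => ⟪-latticeDiv R g l, ψ l⟫)
      (∑ ρ : R, (∑' l, ⟪g (l - ρ) ρ, ψ l⟫ - ∑' l, ⟪g l ρ, ψ l⟫)) := by
    have := hasSum_sum (s := Finset.univ) fun (ρ : R) _ =>
      (hs fun l => g (l - ρ) ρ).hasSum.sub (hs fun l => g l ρ).hasSum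
    refine this.congr_fun fun l => ?_
    simp [latticeDiv, latticeDiff, sum_inner, inner_add_left, inner_neg_left, sub_eq_add_neg]
  rw [h2.tsum_eq]

theorem tsum_siteHessian_stencil (u ψ : L → EuclideanSpace ℝ (Fin N)) (hψ : ψ.support.Finite) :
    ∑' l, siteHessian R V (stencil R u l) (stencil R ψ l) = ∑' l, ⟪hamiltonian R V u l, ψ l⟫ := by
  simp only [siteHessian_eq_sum_inner]
  exact tsum_inner_stencil R (fun l => siteHessianVec R V (stencil R u l)) ψ hψ

theorem finite_support_stencil (ψ : L → EuclideanSpace ℝ (Fin N)) (hψ : ψ.support.Finite) :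
    {l | stencil R ψ l ≠ 0}.Finite := by
  have : {l | stencil R ψ l ≠ 0} ⊆ ψ.support ∪ ⋃ ρ : R, (fun l => l - (ρ : L)) '' ψ.support := by
    intro l hl
    simp only [Set.mem_ofPred_eq, ne_eq, funext_iff, not_forall] at hl
    obtain ⟨ρ, hρ⟩ := hl
    by_cases h : ψ l = 0
    · right
      refine Set.mem_iUnion.2 ⟨ρ, l + ρ, ?_, by simp⟩
      simpa [stencil, latticeDiff, h] using hρ
    · left; exact h
  exact (hψ.union (Set.finite_iUnion fun ρ => hψ.image _)).subset this

end Hamiltonian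

/-! ### Balls and energies -/

/-- Balls of the normed group are finite. -/
class FiniteBalls (L : Type*) [NormedAddCommGroup L] : Prop where
  finite_ball : ∀ r : ℝ, {l : L | ‖l‖ ≤ r}.Finite

theorem exists_norm_bound {L : Type*} [NormedAddCommGroup L] (R : Finset L) : ∃ P : ℝ, 0 < P ∧ ∀ ρ ∈ R, ‖ρ‖ ≤ P :=
  ⟨1 + ∑ ρ ∈ R, ‖ρ‖, by positivity, fun ρ hρ => by
    have := Finset.single_le_sum (f := fun ρ : L => ‖ρ‖) (fun _ _ => norm_nonneg _) hρ
    linarith⟩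

section Balls

variable {L : Type*} [NormedAddCommGroup L] [FiniteBalls L]

theorem finite_closedBall (x : L) (r : ℝ) : {l : L | ‖l - x‖ ≤ r}.Finite :=
  ((FiniteBalls.finite_ball (L := L) r).image (· + x)).subset fun l hl => ⟨l - x, hl, by simp⟩

/-- The closed ball as a finset. -/
noncomputable def latticeBall (x : L) (r : ℝ) : Finset L := (finite_closedBall x r).toFinset

@[simp] theorem mem_latticeBall {x l : L} {r : ℝ} : l ∈ latticeBall x r ↔ ‖l - x‖ ≤ r := by
  simp [latticeBall]

/-- The sum of `‖u‖²` over a ball. -/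
noncomputable def ballEnergy {E : Type*} [NormedAddCommGroup E] (u : L → E) (x : L) (r : ℝ) : ℝ :=
  ∑ l ∈ latticeBall x r, ‖u l‖ ^ 2

variable {E : Type*} [NormedAddCommGroup E]

theorem ballEnergy_nonneg (u : L → E) (x : L) (r : ℝ) : 0 ≤ ballEnergy u x r :=
  Finset.sum_nonneg fun _ _ => sq_nonneg _

theorem latticeBall_subset {x y : L} {r s : ℝ} (h : r + ‖x - y‖ ≤ s) :
    latticeBall x r ⊆ latticeBall y s := by
  intro l hl
  rw [mem_latticeBall] at hl ⊢
  calc ‖l - y‖ = ‖(l - x) + (x - y)‖ := by congr 1; abel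
    _ ≤ _ := (norm_add_le _ _).trans (by linarith)

theorem ballEnergy_mono (u : L → E) {x y : L} {r s : ℝ} (h : r + ‖x - y‖ ≤ s) :
    ballEnergy u x r ≤ ballEnergy u y s :=
  Finset.sum_le_sum_of_subset_of_nonneg (latticeBall_subset h) fun _ _ _ => sq_nonneg _

theorem ballEnergy_mono_radius (u : L → E) {x : L} {r s : ℝ} (h : r ≤ s) :
    ballEnergy u x r ≤ ballEnergy u x s :=
  ballEnergy_mono u (by simpa using h)

theorem ballEnergy_shift (u : L → E) (a x : L) (r : ℝ) :
    ballEnergy (fun l => u (l + a)) x r = ballEnergy u (x + a) r := by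
  unfold ballEnergy
  refine Finset.sum_bij (fun l _ => l + a) ?_ ?_ ?_ ?_
  · intro l hl; simpa using hl
  · intro l _ m _ h; simpa using h
  · intro l hl
    refine ⟨l - a, ?_, by simp⟩
    rw [mem_latticeBall] at hl ⊢
    rwa [show l - a - x = l - (x + a) by abel]
  · intro l _; rfl

theorem ballEnergy_shift_le (u : L → E) (a x : L) (r : ℝ) :
    ballEnergy (fun l => u (l + a)) x r ≤ ballEnergy u x (r + ‖a‖) := by
  rw [ballEnergy_shift]
  exact ballEnergy_mono u (by simp)

theorem ballEnergy_add_le (u v : L → E) (x : L) (r : ℝ) :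
    ballEnergy (u + v) x r ≤ 2 * ballEnergy u x r + 2 * ballEnergy v x r := by
  unfold ballEnergy
  rw [Finset.mul_sum, Finset.mul_sum, ← Finset.sum_add_distrib]
  refine Finset.sum_le_sum fun l _ => ?_
  have := norm_add_le (u l) (v l)
  have h0 := norm_nonneg (u l + v l)
  simp only [Pi.add_apply]
  nlinarith [sq_nonneg (‖u l‖ - ‖v l‖)]

theorem norm_sq_le_ballEnergy (u : L → E) {x l : L} {r : ℝ} (h : ‖l - x‖ ≤ r) :
    ‖u l‖ ^ 2 ≤ ballEnergy u x r :=
  Finset.single_le_sum (f := fun l => ‖u l‖ ^ 2) (fun _ _ => sq_nonneg _) (mem_latticeBall.2 h)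

end Balls

/-! ### The Caccioppoli inequality -/

section Caccioppoli

variable {L : Type*} [NormedAddCommGroup L] [FiniteBalls L] {N : ℕ} (R : Finset L)
  (V : (R → EuclideanSpace ℝ (Fin N)) → ℝ)

/-- Stability tested on finitely supported fields, with constant `c₀`. -/
structure FiniteStable (c₀ : ℝ) : Prop where
  pos : 0 < c₀
  le : ∀ ψ : L → EuclideanSpace ℝ (Fin N), ψ.support.Finite →
    c₀ * energyNormSq R ψ ≤ hamiltonianForm R V ψ

omit [FiniteBalls L] in
theorem LatticeStable.exists_finiteStable (h : LatticeStable R V) : ∃ c₀, FiniteStable R V c₀ := by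
  obtain ⟨c₀, hc, hle⟩ := h
  exact ⟨c₀, hc, fun ψ hψ => hle ψ (finite_support_stencil R ψ hψ).isBounded⟩

/-- The sum of `‖u‖²` over a site and its neighbours. -/
noncomputable def stencilEnergy (u : L → EuclideanSpace ℝ (Fin N)) (l : L) : ℝ :=
  ‖u l‖ ^ 2 + ∑ ρ : R, ‖u (l + ρ)‖ ^ 2

variable {R} in
omit [FiniteBalls L] in
-- Write a for Du and r, r' for the terms containing Dη, so that D(ηu) = ηa + r and D(η²u) = η²a +
-- 2ηr + r'. By symmetry of the Hessian the terms of order zero and one in Dη agree on both sides.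
-- What remains is H(r,r) - H(a,r'), which is quadratic in δ: the factor 3 is 1 + 2.
theorem siteHessian_cutoff_le (hV : ContDiff ℝ 2 V) (η : L → ℝ)
    (u : L → EuclideanSpace ℝ (Fin N)) (l : L) {δ : ℝ} (hδ : 0 ≤ δ)
    (hη : ∀ ρ ∈ R, |η (l + ρ) - η l| ≤ δ) :
    siteHessian R V (stencil R (fun l => η l • u l) l) (stencil R (fun l => η l • u l) l) ≤
      siteHessian R V (stencil R u l) (stencil R (fun l => (η l) ^ 2 • u l) l) +
        3 * ‖fderiv ℝ (fderiv ℝ V) 0‖ * δ ^ 2 * stencilEnergy R u l := by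
  set a : R → EuclideanSpace ℝ (Fin N) := stencil R u l with ha
  set r : R → EuclideanSpace ℝ (Fin N) := fun ρ => (η (l + ρ) - η l) • u (l + ρ) with hr
  set r' : R → EuclideanSpace ℝ (Fin N) := fun ρ => (η (l + ρ) - η l) ^ 2 • u (l + ρ) with hr'
  have h1 : stencil R (fun l => η l • u l) l = η l • a + r := by
    funext ρ
    simp only [stencil, latticeDiff, ha, hr, Pi.add_apply, Pi.smul_apply]
    module
  have h2 : stencil R (fun l => (η l) ^ 2 • u l) l = (η l) ^ 2 • a + ((2 * η l) • r + r') := by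
    funext ρ
    simp only [stencil, latticeDiff, ha, hr, hr', Pi.add_apply, Pi.smul_apply]
    module
  set m := stencilEnergy R u l with hm
  have hm0 : 0 ≤ m := by rw [hm]; unfold stencilEnergy; positivity
  have hu0 : ‖u l‖ ≤ √m := by
    refine Real.le_sqrt_of_sq_le ?_
    rw [hm]; unfold stencilEnergy
    have : 0 ≤ ∑ ρ : R, ‖u (l + ρ)‖ ^ 2 := by positivity
    linarith
  have hu1 : ∀ ρ : R, ‖u (l + ρ)‖ ≤ √m := by
    intro ρ
    refine Real.le_sqrt_of_sq_le ?_
    rw [hm]; unfold stencilEnergy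
    have := Finset.single_le_sum (f := fun ρ : R => ‖u (l + ρ)‖ ^ 2)
      (fun _ _ => sq_nonneg _) (Finset.mem_univ ρ)
    have h0 := sq_nonneg ‖u l‖
    linarith
  have na : ‖a‖ ≤ 2 * √m := by
    refine (pi_norm_le_iff_of_nonneg (by positivity)).2 fun ρ => ?_
    refine (norm_sub_le _ _).trans ?_
    linarith [hu1 ρ]
  have nr : ‖r‖ ≤ δ * √m := by
    refine (pi_norm_le_iff_of_nonneg (by positivity)).2 fun ρ => ?_
    rw [hr, norm_smul, Real.norm_eq_abs]
    exact mul_le_mul (hη ρ ρ.2) (hu1 ρ) (norm_nonneg _) hδ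
  have nr' : ‖r'‖ ≤ δ ^ 2 * √m := by
    refine (pi_norm_le_iff_of_nonneg (by positivity)).2 fun ρ => ?_
    rw [hr', norm_smul, norm_pow, Real.norm_eq_abs]
    exact mul_le_mul (pow_le_pow_left₀ (abs_nonneg _) (hη ρ ρ.2) 2) (hu1 ρ) (norm_nonneg _)
      (by positivity)
  set K := ‖fderiv ℝ (fderiv ℝ V) 0‖ with hK
  have hK0 : 0 ≤ K := by rw [hK]; positivity
  have hsq : √m * √m = m := Real.mul_self_sqrt hm0
  have b1 : siteHessian R V r r ≤ K * δ ^ 2 * m := by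
    calc siteHessian R V r r ≤ K * ‖r‖ * ‖r‖ := (le_abs_self _).trans (abs_siteHessian_le R V r r)
      _ ≤ K * (δ * √m) * (δ * √m) := by gcongr
      _ = K * δ ^ 2 * (√m * √m) := by ring
      _ = _ := by rw [hsq]
  have b2 : -siteHessian R V a r' ≤ 2 * K * δ ^ 2 * m := by
    calc -siteHessian R V a r' ≤ K * ‖a‖ * ‖r'‖ :=
          (neg_le_abs _).trans (abs_siteHessian_le R V a r')
      _ ≤ K * (2 * √m) * (δ ^ 2 * √m) := by gcongr
      _ = 2 * K * δ ^ 2 * (√m * √m) := by ring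
      _ = _ := by rw [hsq]
  rw [h1, h2]
  simp only [siteHessian_add_left, siteHessian_add_right, siteHessian_smul_left,
    siteHessian_smul_right]
  rw [siteHessian_symm R V hV r a]
  nlinarith

theorem sum_stencilEnergy_le (u : L → EuclideanSpace ℝ (Fin N)) (x : L) {r s : ℝ}
    (hs : 0 ≤ s) (hR : ∀ ρ ∈ R, ‖ρ‖ ≤ s) :
    ∑ l ∈ latticeBall x r, stencilEnergy R u l ≤ (1 + R.card) * ballEnergy u x (r + s) := by
  unfold stencilEnergy
  rw [Finset.sum_add_distrib, Finset.sum_comm]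
  have h1 : ∑ l ∈ latticeBall x r, ‖u l‖ ^ 2 ≤ ballEnergy u x (r + s) :=
    ballEnergy_mono_radius u (by linarith)
  have h2 : ∀ ρ : R, ∑ l ∈ latticeBall x r, ‖u (l + ρ)‖ ^ 2 ≤ ballEnergy u x (r + s) := fun ρ =>
    (ballEnergy_shift_le u (ρ : L) x r).trans
      (ballEnergy_mono_radius u (by linarith [hR ρ ρ.2]))
  have h3 := Finset.sum_le_sum fun (ρ : R) (_ : ρ ∈ Finset.univ) => h2 ρ
  simp only [Finset.sum_const, Finset.card_univ, Fintype.card_coe, nsmul_eq_mul] at h3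
  linarith

/-- Stability is tested with ηu, where η is one up to radius r + s, vanishes beyond r + 2s and has
slope 1/s. The form of u against η²u is zero because u is harmonic on the support of η, so only the
cut-off error of order s⁻² is left. -/
theorem caccioppoli_stencil (hV : ContDiff ℝ 2 V) {c₀ : ℝ} (hst : FiniteStable R V c₀) :
    ∃ K : ℝ, 0 < K ∧ ∀ (u : L → EuclideanSpace ℝ (Fin N)) (x : L) (r s : ℝ), K ≤ s →
      (∀ l, ‖l - x‖ ≤ r + K * s → hamiltonian R V u l = 0) → ∀ ρ ∈ R,
      ballEnergy (latticeDiff ρ u) x r ≤ K / s ^ 2 * ballEnergy u x (r + K * s) := by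
  obtain ⟨P, hP, hPR⟩ := exists_norm_bound R
  set B := ‖fderiv ℝ (fderiv ℝ V) 0‖ with hB
  -- The 4 leaves room for the radius r + 3s of the summation ball and one more layer of neighbours,
  -- P makes the interaction range at most s, and the last term is the constant that the estimate
  -- produces.
  set K := 4 + P + 3 * B * P ^ 2 * (1 + R.card) / c₀ with hK
  have hc := hst.pos
  have hKaux : 0 ≤ 3 * B * P ^ 2 * (1 + R.card) / c₀ := by positivity
  refine ⟨K, by positivity, ?_⟩
  intro u x r s hs hu ρ hρ
  have hs0 : 0 < s := lt_of_lt_of_le (by positivity) hs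
  have hPs : P ≤ s := by linarith
  have hKs : r + 4 * s ≤ r + K * s := by nlinarith
  set η : L → ℝ := fun l => max 0 (min 1 ((r + 2 * s - ‖l - x‖) / s)) with hη
  have hη1 : ∀ l, ‖l - x‖ ≤ r + s → η l = 1 := by
    intro l hl
    have : 1 ≤ (r + 2 * s - ‖l - x‖) / s := by rw [le_div_iff₀ hs0]; linarith
    simp only [hη, min_eq_left this]
    simp
  have hη0 : ∀ l, r + 2 * s ≤ ‖l - x‖ → η l = 0 := by
    intro l hl
    have : (r + 2 * s - ‖l - x‖) / s ≤ 0 := div_nonpos_of_nonpos_of_nonneg (by linarith) hs0.le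
    simp only [hη]
    exact max_eq_left ((min_le_right _ _).trans this)
  have hηlip : ∀ l, ∀ σ ∈ R, |η (l + σ) - η l| ≤ P / s := by
    intro l σ hσ
    simp only [hη]
    refine (abs_max_sub_max_le_max _ _ _ _).trans ?_
    rw [sub_self, abs_zero]
    refine max_le (by positivity) ?_
    refine (abs_min_sub_min_le_max _ _ _ _).trans ?_
    rw [sub_self, abs_zero]
    refine max_le (by positivity) ?_
    rw [← sub_div, abs_div, abs_of_pos hs0]
    gcongr
    calc |r + 2 * s - ‖l + σ - x‖ - (r + 2 * s - ‖l - x‖)|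
        = |‖l - x‖ - ‖l + σ - x‖| := by congr 1; ring
      _ ≤ ‖(l - x) - (l + σ - x)‖ := abs_norm_sub_norm_le _ _
      _ = ‖σ‖ := by rw [show (l - x) - (l + σ - x) = -σ by abel, norm_neg]
      _ ≤ P := hPR σ hσ
  have hsupp : ∀ q : ℝ → ℝ, q 0 = 0 → (Function.support fun l => q (η l) • u l).Finite := by
    intro q hq
    refine (finite_closedBall x (r + 2 * s)).subset fun l hl => ?_
    by_contra h
    simp only [Set.mem_ofPred_eq, not_le] at h
    exact hl (by simp [hη0 l h.le, hq])
  have hfin1 := hsupp id rfl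
  have hfin2 := hsupp (fun t => t ^ 2) (by simp)
  simp only [id] at hfin1 hfin2
  set ψ : L → EuclideanSpace ℝ (Fin N) := fun l => η l • u l with hψ
  set φ : L → EuclideanSpace ℝ (Fin N) := fun l => (η l) ^ 2 • u l with hφ
  set S := latticeBall x (r + 3 * s) with hS
  have hout : ∀ (q : ℝ → ℝ), q 0 = 0 → ∀ l ∉ S, stencil R (fun l => q (η l) • u l) l = 0 := by
    intro q hq l hl
    rw [hS, mem_latticeBall, not_le] at hl
    funext σ
    have h1 : η l = 0 := hη0 l (by linarith)
    have h2 : η (l + σ) = 0 := by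
      refine hη0 _ ?_
      have h3 : ‖l - x‖ ≤ ‖l + σ - x‖ + ‖(σ : L)‖ := by
        calc ‖l - x‖ = ‖(l + σ - x) - σ‖ := by congr 1; abel
          _ ≤ _ := norm_sub_le _ _
      linarith [hPR σ σ.2]
    simp [stencil, latticeDiff, h1, h2, hq]
  have hform : hamiltonianForm R V ψ =
      ∑ l ∈ S, siteHessian R V (stencil R ψ l) (stencil R ψ l) := by
    refine tsum_eq_sum fun l hl => ?_
    have := hout id rfl l hl
    simp only [id] at this
    rw [hψ, this, siteHessian_zero_left]
  have hzero : ∑ l ∈ S, siteHessian R V (stencil R u l) (stencil R φ l) = 0 := by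
    have htsum : ∑' l, siteHessian R V (stencil R u l) (stencil R φ l) =
        ∑ l ∈ S, siteHessian R V (stencil R u l) (stencil R φ l) := by
      refine tsum_eq_sum fun l hl => ?_
      rw [hφ, hout (fun t => t ^ 2) (by simp) l hl, siteHessian_zero_right]
    have hpt : ∀ l, ⟪hamiltonian R V u l, φ l⟫ = 0 := by
      intro l
      by_cases h : ‖l - x‖ ≤ r + 2 * s
      · rw [hu l (by linarith), inner_zero_left]
      · rw [hφ]; simp [hη0 l (not_le.1 h).le]
    rw [← htsum, tsum_siteHessian_stencil R V u φ hfin2]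
    simp [hpt]
  have hle : hamiltonianForm R V ψ ≤
      3 * B * (P / s) ^ 2 * ((1 + R.card) * ballEnergy u x (r + K * s)) := by
    rw [hform]
    refine (Finset.sum_le_sum fun l _ =>
      siteHessian_cutoff_le V hV η u l (by positivity) (hηlip l)).trans ?_
    rw [Finset.sum_add_distrib, hzero, zero_add, ← Finset.mul_sum]
    gcongr
    refine (sum_stencilEnergy_le R u x hs0.le fun σ hσ => (hPR σ hσ).trans hPs).trans ?_
    gcongr
    exact ballEnergy_mono_radius u (by linarith)
  have hlow : ballEnergy (latticeDiff ρ u) x r ≤ energyNormSq R ψ := by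
    have h1 : energyNormSq R ψ = ∑ l ∈ S, ∑ σ : R, ‖stencil R ψ l σ‖ ^ 2 := by
      refine tsum_eq_sum fun l hl => ?_
      have := hout id rfl l hl
      simp only [id] at this
      rw [hψ, this]
      simp
    rw [h1]
    have hsub : latticeBall x r ⊆ S := latticeBall_subset (by simp; linarith)
    refine le_trans ?_ (Finset.sum_le_sum_of_subset_of_nonneg hsub
      fun _ _ _ => Finset.sum_nonneg fun _ _ => sq_nonneg _)
    refine Finset.sum_le_sum fun l hl => ?_
    rw [mem_latticeBall] at hl
    have h2 : latticeDiff ρ u l = stencil R ψ l ⟨ρ, hρ⟩ := by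
      have e1 : η l = 1 := hη1 l (by linarith)
      have e2 : η (l + ρ) = 1 := by
        refine hη1 _ ?_
        calc ‖l + ρ - x‖ = ‖(l - x) + ρ‖ := by congr 1; abel
          _ ≤ ‖l - x‖ + ‖ρ‖ := norm_add_le _ _
          _ ≤ _ := by linarith [hPR ρ hρ]
      simp [stencil, latticeDiff, hψ, e1, e2]
    rw [h2]
    exact Finset.single_le_sum (f := fun σ => ‖stencil R ψ l σ‖ ^ 2)
      (fun _ _ => sq_nonneg _) (Finset.mem_univ _)
  have hfinal := hst.le ψ hfin1
  have hE := ballEnergy_nonneg u x (r + K * s)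
  have h5 : ballEnergy (latticeDiff ρ u) x r ≤
      (3 * B * P ^ 2 * (1 + R.card) / c₀) / s ^ 2 * ballEnergy u x (r + K * s) := by
    have : c₀ * ballEnergy (latticeDiff ρ u) x r ≤
        3 * B * (P / s) ^ 2 * ((1 + R.card) * ballEnergy u x (r + K * s)) := by
      refine le_trans ?_ (hfinal.trans hle)
      gcongr
    rw [← le_div_iff₀' hc] at this
    refine this.trans (le_of_eq ?_)
    field_simp
  refine h5.trans ?_
  gcongr
  linarith

end Caccioppoli

/-! ### Interior estimates -/

section CaccioppoliDirections

variable {L : Type*} [NormedAddCommGroup L] [FiniteBalls L] {N : ℕ} (R : Finset L)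
  (V : (R → EuclideanSpace ℝ (Fin N)) → ℝ)

/-- A difference in any direction is a sum of translates of differences in generating directions,
and enlarging K absorbs the translations because s ≥ 1. -/
theorem caccioppoli (hR : AddSubgroup.closure (R : Set L) = ⊤) (hV : ContDiff ℝ 2 V) {c₀ : ℝ}
    (hst : FiniteStable R V c₀) (a : L) :
    ∃ K : ℝ, 0 < K ∧ ∀ (u : L → EuclideanSpace ℝ (Fin N)) (x : L) (r s : ℝ), K ≤ s →
      (∀ l, ‖l - x‖ ≤ r + K * s → hamiltonian R V u l = 0) →
      ballEnergy (latticeDiff a u) x r ≤ K / s ^ 2 * ballEnergy u x (r + K * s) := by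
  refine latticeDiff_induction hR (p := fun a => ∃ K : ℝ, 0 < K ∧
    ∀ (u : L → EuclideanSpace ℝ (Fin N)) (x : L) (r s : ℝ), K ≤ s →
      (∀ l, ‖l - x‖ ≤ r + K * s → hamiltonian R V u l = 0) →
      ballEnergy (latticeDiff a u) x r ≤ K / s ^ 2 * ballEnergy u x (r + K * s)) ?_ ?_ ?_ ?_ a
  · intro ρ hρ
    obtain ⟨K, hK, h⟩ := caccioppoli_stencil R V hV hst
    exact ⟨K, hK, fun u x r s hs hu => h u x r s hs hu ρ hρ⟩
  · refine ⟨1, one_pos, fun u x r s _ _ => ?_⟩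
    rw [latticeDiff_zero_left]
    have := ballEnergy_nonneg u x (r + 1 * s)
    have h0 : ballEnergy (0 : L → EuclideanSpace ℝ (Fin N)) x r = 0 := by simp [ballEnergy]
    rw [h0]
    positivity
  · rintro a b ⟨A, hA, hAu⟩ ⟨B, hB, hBu⟩
    have hb := norm_nonneg b
    refine ⟨2 * A + 2 * B + ‖b‖ + 1, by positivity, fun u x r s hs hu => ?_⟩
    have hs1 : 1 ≤ s := by linarith
    have h1 : r + ‖b‖ + A * s ≤ r + (2 * A + 2 * B + ‖b‖ + 1) * s := by nlinarith
    have h2 : r + B * s ≤ r + (2 * A + 2 * B + ‖b‖ + 1) * s := by nlinarith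
    set Q := ballEnergy u x (r + (2 * A + 2 * B + ‖b‖ + 1) * s) with hQ
    have hQ0 : 0 ≤ Q := ballEnergy_nonneg _ _ _
    have hsplit : latticeDiff (a + b) u = (fun l => latticeDiff a u (l + b)) + latticeDiff b u := by
      funext l; exact latticeDiff_add_left a b u l
    rw [hsplit]
    refine (ballEnergy_add_le _ _ x r).trans ?_
    have e1 : ballEnergy (fun l => latticeDiff a u (l + b)) x r ≤ A / s ^ 2 * Q := by
      refine (ballEnergy_shift_le (latticeDiff a u) b x r).trans ?_
      refine (hAu u x (r + ‖b‖) s (by linarith) fun l hl => hu l (hl.trans h1)).trans ?_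
      gcongr
      exact ballEnergy_mono_radius u h1
    have e2 : ballEnergy (latticeDiff b u) x r ≤ B / s ^ 2 * Q := by
      refine (hBu u x r s (by linarith) fun l hl => hu l (hl.trans h2)).trans ?_
      gcongr
      exact ballEnergy_mono_radius u h2
    calc _ ≤ 2 * (A / s ^ 2 * Q) + 2 * (B / s ^ 2 * Q) := by linarith
      _ = (2 * A + 2 * B) / s ^ 2 * Q := by ring
      _ ≤ _ := by
        refine mul_le_mul_of_nonneg_right ?_ hQ0
        exact div_le_div_of_nonneg_right (by linarith) (by positivity)
  · rintro a ⟨A, hA, hAu⟩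
    have ha := norm_nonneg a
    refine ⟨A + ‖a‖ + 1, by positivity, fun u x r s hs hu => ?_⟩
    have hs1 : 1 ≤ s := by linarith
    have h1 : r + ‖a‖ + A * s ≤ r + (A + ‖a‖ + 1) * s := by nlinarith
    have e : ballEnergy (latticeDiff (-a) u) x r =
        ballEnergy (fun l => latticeDiff a u (l + -a)) x r := by
      unfold ballEnergy
      refine Finset.sum_congr rfl fun l _ => ?_
      rw [latticeDiff_neg_left, norm_neg, sub_eq_add_neg]
    rw [e]
    refine (ballEnergy_shift_le (latticeDiff a u) (-a) x r).trans ?_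
    rw [norm_neg]
    refine (hAu u x (r + ‖a‖) s (by linarith) fun l hl => hu l (hl.trans h1)).trans ?_
    have := ballEnergy_mono_radius u (x := x) h1
    have h0 := ballEnergy_nonneg u x (r + ‖a‖ + A * s)
    gcongr
    linarith

variable {R V}

omit [FiniteBalls L] in
theorem hamiltonian_latticeDiff_eq_zero {u : L → EuclideanSpace ℝ (Fin N)} {x a : L} {r r' : ℝ}
    (hu : ∀ l, ‖l - x‖ ≤ r' → hamiltonian R V u l = 0) (h : r + ‖a‖ ≤ r') :
    ∀ l, ‖l - x‖ ≤ r → hamiltonian R V (latticeDiff a u) l = 0 := by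
  intro l hl
  rw [hamiltonian_latticeDiff, latticeDiff, hu, hu, sub_zero]
  · linarith [norm_nonneg a]
  · calc ‖l + a - x‖ = ‖(l - x) + a‖ := by congr 1; abel
      _ ≤ _ := (norm_add_le _ _).trans (by linarith)

/-- Differences of a harmonic field are harmonic on a slightly smaller ball, so each further
difference gains another factor s⁻². -/
theorem caccioppoli_list (hR : AddSubgroup.closure (R : Set L) = ⊤) (hV : ContDiff ℝ 2 V) {c₀ : ℝ}
    (hst : FiniteStable R V c₀) (t : List L) :
    ∃ K : ℝ, 0 < K ∧ ∀ (u : L → EuclideanSpace ℝ (Fin N)) (x : L) (r s : ℝ), K ≤ s →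
      (∀ l, ‖l - x‖ ≤ r + K * s → hamiltonian R V u l = 0) →
      ballEnergy (listDiff t u) x r ≤ K / s ^ (2 * t.length) * ballEnergy u x (r + K * s) := by
  induction t with
  | nil =>
    refine ⟨1, one_pos, fun u x r s hs _ => ?_⟩
    simpa using ballEnergy_mono_radius u (by linarith)
  | cons a t ih =>
    obtain ⟨A, hA, hAu⟩ := caccioppoli R V hR hV hst a
    obtain ⟨B, hB, hBu⟩ := ih
    have ha := norm_nonneg a
    refine ⟨A + B + A * B + ‖a‖ + 1, by positivity, fun u x r s hs hu => ?_⟩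
    have hAB : 0 < A * B := by positivity
    have hs1 : 1 ≤ s := by linarith
    set Kt := A + B + A * B + ‖a‖ + 1 with hKt
    have hr : r + B * s + A * s ≤ r + Kt * s := by nlinarith
    have hr2 : r + B * s + ‖a‖ ≤ r + Kt * s := by nlinarith
    rw [listDiff_cons, ← listDiff_latticeDiff]
    refine (hBu (latticeDiff a u) x r s (by linarith)
      (hamiltonian_latticeDiff_eq_zero hu hr2)).trans ?_
    have h1 := hAu u x (r + B * s) s (by linarith) fun l hl => hu l (hl.trans hr)
    have h2 := ballEnergy_mono_radius u (x := x) hr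
    have h3 := ballEnergy_nonneg u x (r + Kt * s)
    calc B / s ^ (2 * t.length) * ballEnergy (latticeDiff a u) x (r + B * s)
        ≤ B / s ^ (2 * t.length) * (A / s ^ 2 * ballEnergy u x (r + Kt * s)) := by
          gcongr
          exact h1.trans (by gcongr)
      _ = (A * B) / s ^ (2 * (a :: t).length) * ballEnergy u x (r + Kt * s) := by
          rw [List.length_cons, mul_add, pow_add, mul_one]
          field_simp
      _ ≤ _ := by gcongr; linarith

end CaccioppoliDirections

/-! ### Coordinates -/

/-- Coordinates on a lattice, comparable with the norm. -/
structure LatticeCoords (ι L : Type*) [Fintype ι] [NormedAddCommGroup L] where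
  /-- the coordinates -/
  equiv : L ≃+ (ι → ℤ)
  /-- the comparison constant -/
  lower : ℝ
  lower_pos : 0 < lower
  lower_le : ∀ l i, lower * |(equiv l i : ℝ)| ≤ ‖l‖

namespace LatticeCoords

variable {ι L : Type*} [Fintype ι] [NormedAddCommGroup L] (c : LatticeCoords ι L)

open Classical in
/-- The basis vectors. -/
noncomputable def vec (i : ι) : L := c.equiv.symm (Pi.single i 1)

open Classical in
theorem equiv_vec (i : ι) : c.equiv (c.vec i) = Pi.single i 1 := by simp [vec]

theorem eq_sum_vec (l : L) : l = ∑ i, c.equiv l i • c.vec i := by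
  classical
  apply c.equiv.injective
  rw [map_sum]
  funext j
  simp [equiv_vec, Finset.sum_apply, Pi.single_apply]

open Classical in
theorem equiv_image_subset (x : L) (r : ℝ) {l : L} (hl : ‖l - x‖ ≤ r) :
    c.equiv (l - x) ∈ Fintype.piFinset fun _ : ι => Finset.Icc (-⌊r / c.lower⌋) ⌊r / c.lower⌋ := by
  rw [Fintype.mem_piFinset]
  intro i
  have h := (c.lower_le (l - x) i).trans hl
  have h2 : |(c.equiv (l - x) i : ℝ)| ≤ r / c.lower := by
    rw [le_div_iff₀' c.lower_pos]; exact h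
  rw [abs_le] at h2
  rw [Finset.mem_Icc]
  constructor
  · rw [neg_le, Int.le_floor]; push_cast; linarith
  · rw [Int.le_floor]; exact h2.2

theorem finiteBalls (c : LatticeCoords ι L) : FiniteBalls L where
  finite_ball r := by
    classical
    refine Set.Finite.subset (Set.Finite.preimage c.equiv.injective.injOn
      (Fintype.piFinset fun _ : ι => Finset.Icc (-⌊r / c.lower⌋) ⌊r / c.lower⌋).finite_toSet) ?_
    intro l hl
    have h := c.equiv_image_subset 0 r (l := l) (by simpa using hl)
    rw [sub_zero] at h
    exact Finset.mem_coe.2 h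

theorem card_latticeBall_le (c : LatticeCoords ι L) [FiniteBalls L] :
    ∃ C : ℝ, 0 < C ∧ ∀ (x : L) (r : ℝ), 1 ≤ r →
      ((latticeBall x r).card : ℝ) ≤ C * r ^ Fintype.card ι := by
  refine ⟨(2 / c.lower + 1) ^ Fintype.card ι, by have := c.lower_pos; positivity,
    fun x r hr => ?_⟩
  classical
  have hl := c.lower_pos
  set m := ⌊r / c.lower⌋ with hm
  have hm0 : 0 ≤ m := by rw [hm]; positivity
  have h1 : (latticeBall x r).card ≤
      (Fintype.piFinset fun _ : ι => Finset.Icc (-m) m).card := by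
    refine Finset.card_le_card_of_injOn (fun l => c.equiv (l - x)) ?_ ?_
    · intro l hl
      exact c.equiv_image_subset x r (mem_latticeBall.1 hl)
    · intro l _ l' _ h
      simpa using c.equiv.injective h
  have h2 : ((Fintype.piFinset fun _ : ι => Finset.Icc (-m) m).card : ℝ) =
      (2 * (m : ℝ) + 1) ^ Fintype.card ι := by
    rw [Fintype.card_piFinset]
    simp only [Int.card_Icc, Finset.prod_const, Finset.card_univ]
    push_cast
    congr 1
    have : (((m + 1 - -m).toNat : ℤ) : ℝ) = ((m + 1 - -m : ℤ) : ℝ) := by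
      rw [Int.toNat_of_nonneg (by omega)]
    push_cast at this
    rw [this]
    ring
  have h3 : (m : ℝ) ≤ r / c.lower := Int.floor_le _
  calc ((latticeBall x r).card : ℝ) ≤ (2 * (m : ℝ) + 1) ^ Fintype.card ι := by
        rw [← h2]; exact_mod_cast h1
    _ ≤ ((2 / c.lower + 1) * r) ^ Fintype.card ι := by
        have : (0 : ℝ) ≤ m := by exact_mod_cast hm0
        gcongr
        have : 2 / c.lower * r = 2 * (r / c.lower) := by ring
        linarith
    _ = _ := mul_pow _ _ _

/-! #### Boxes -/

open Classical in
/-- The box spanned by the basis vectors of a list of indices. -/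
noncomputable def box (n : ℕ) : List ι → Finset L
  | [] => {0}
  | i :: s => ((Finset.range n) ×ˢ box n s).image fun p => p.1 • c.vec i + p.2

theorem equiv_box {n : ℕ} {s : List ι} {z : L} (hz : z ∈ c.box n s) {i : ι} (hi : i ∉ s) :
    c.equiv z i = 0 := by
  classical
  induction s generalizing z with
  | nil => simp only [box, Finset.mem_singleton] at hz; simp [hz]
  | cons j s ih =>
    simp only [box, Finset.mem_image, Finset.mem_product, Prod.exists] at hz
    obtain ⟨t, y, ⟨_, hy⟩, rfl⟩ := hz
    simp only [List.mem_cons, not_or] at hi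
    have h := ih hy hi.2
    rw [map_add, map_nsmul, equiv_vec]
    simp [h, hi.1]

theorem sum_box_cons {n : ℕ} {i : ι} {s : List ι} (hi : i ∉ s) (h : L → ℝ) :
    ∑ z ∈ c.box n (i :: s), h z = ∑ t ∈ Finset.range n, ∑ y ∈ c.box n s, h (t • c.vec i + y) := by
  classical
  rw [box, Finset.sum_image, Finset.sum_product]
  rintro ⟨t, y⟩ hp ⟨t', y'⟩ hp' heq
  simp only [Finset.coe_product, Set.mem_prod, Finset.mem_coe] at hp hp'
  simp only at heq
  have h1 := congrArg (fun z => c.equiv z i) heq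
  simp only [map_add, map_nsmul, equiv_vec, Pi.add_apply, Pi.smul_apply, Pi.single_eq_same,
    c.equiv_box hp.2 hi, c.equiv_box hp'.2 hi] at h1
  have h2 : t = t' := by simpa using h1
  subst h2
  simpa using heq

theorem norm_box_le {n : ℕ} {s : List ι} {z : L} (hz : z ∈ c.box n s) :
    ‖z‖ ≤ n * (s.map fun i => ‖c.vec i‖).sum := by
  induction s generalizing z with
  | nil => simp only [box, Finset.mem_singleton] at hz; simp [hz]
  | cons j s ih =>
    simp only [box, Finset.mem_image, Finset.mem_product, Prod.exists, Finset.mem_range] at hz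
    obtain ⟨t, y, ⟨ht, hy⟩, rfl⟩ := hz
    rw [List.map_cons, List.sum_cons, mul_add]
    refine (norm_add_le _ _).trans (add_le_add ?_ (ih hy))
    refine (norm_nsmul_le).trans ?_
    gcongr

end LatticeCoords

/-- The one-dimensional Sobolev inequality: a 0 differs from each a t by at most the total variation
D, and Cauchy–Schwarz bounds D² by n times the sum of squared increments. Averaging over t gives the
claim. -/
theorem norm_sq_le_average {E : Type*} [NormedAddCommGroup E] (a : ℕ → E) {n : ℕ} (hn : 0 < n) :
    (n : ℝ) * ‖a 0‖ ^ 2 ≤ 2 * ∑ t ∈ Finset.range n,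
      (‖a t‖ ^ 2 + (n : ℝ) ^ 2 * ‖a (t + 1) - a t‖ ^ 2) := by
  set D := ∑ t ∈ Finset.range n, ‖a (t + 1) - a t‖ with hD
  have hD2 : D ^ 2 ≤ n * ∑ t ∈ Finset.range n, ‖a (t + 1) - a t‖ ^ 2 := by
    have := sq_sum_le_card_mul_sum_sq (s := Finset.range n) (f := fun t => ‖a (t + 1) - a t‖)
    simpa using this
  have h1 : ∀ t ∈ Finset.range n, ‖a 0‖ ^ 2 ≤ 2 * ‖a t‖ ^ 2 + 2 * D ^ 2 := by
    intro t ht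
    have h2 : ‖a t - a 0‖ ≤ D := by
      rw [← Finset.sum_range_sub]
      refine (norm_sum_le _ _).trans ?_
      exact Finset.sum_le_sum_of_subset_of_nonneg
        (Finset.range_subset_range.2 (Finset.mem_range.1 ht).le) fun _ _ _ => norm_nonneg _
    have h3 : ‖a 0‖ ≤ ‖a t‖ + D := by
      calc ‖a 0‖ = ‖a t - (a t - a 0)‖ := by congr 1; abel
        _ ≤ _ := (norm_sub_le _ _).trans (by linarith)
    have h4 := norm_nonneg (a 0)
    nlinarith [sq_nonneg (‖a t‖ - D)]
  have h5 := Finset.sum_le_sum h1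
  rw [Finset.sum_const, Finset.card_range, nsmul_eq_mul, Finset.sum_add_distrib,
    Finset.sum_const, Finset.card_range, nsmul_eq_mul, ← Finset.mul_sum] at h5
  rw [Finset.sum_add_distrib, mul_add, ← Finset.mul_sum]
  have hn' : (0 : ℝ) < n := by exact_mod_cast hn
  nlinarith

namespace LatticeCoords

variable {ι L : Type*} [Fintype ι] [NormedAddCommGroup L] (c : LatticeCoords ι L)

/-- The one-dimensional inequality is applied in each direction in turn. Every direction is used
once, so only mixed differences without repetition occur; these are indexed by the sublists of s.
The weight n² per difference is the scaling that Caccioppoli compensates. -/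
theorem sobolev_box {E : Type*} [NormedAddCommGroup E] {n : ℕ} (hn : 0 < n) (s : List ι)
    (hs : s.Nodup) (u : L → E) (x : L) :
    (n : ℝ) ^ s.length * ‖u x‖ ^ 2 ≤ 2 ^ s.length * (s.sublists'.map fun t =>
      (n : ℝ) ^ (2 * t.length) *
        ∑ z ∈ c.box n s, ‖listDiff (t.map c.vec) u (x + z)‖ ^ 2).sum := by
  induction s generalizing u x with
  | nil => simp [box]
  | cons i s ih =>
    rw [List.nodup_cons] at hs
    have h1 := norm_sq_le_average (fun t : ℕ => u (x + t • c.vec i)) hn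
    simp only [zero_smul, add_zero] at h1
    have hstep : ∀ t : ℕ, u (x + (t + 1) • c.vec i) - u (x + t • c.vec i) =
        latticeDiff (c.vec i) u (x + t • c.vec i) := by
      intro t
      simp [latticeDiff, add_smul, add_assoc]
    simp only [hstep] at h1
    have h2 : ∀ t ∈ Finset.range n, (n : ℝ) ^ s.length * (‖u (x + t • c.vec i)‖ ^ 2 +
        (n : ℝ) ^ 2 * ‖latticeDiff (c.vec i) u (x + t • c.vec i)‖ ^ 2) ≤
        2 ^ s.length * ((s.sublists'.map fun q => (n : ℝ) ^ (2 * q.length) *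
        ∑ z ∈ c.box n s, ‖listDiff (q.map c.vec) u (x + t • c.vec i + z)‖ ^ 2).sum +
        (s.sublists'.map fun q => (n : ℝ) ^ (2 * (q.length + 1)) *
        ∑ z ∈ c.box n s, ‖listDiff ((i :: q).map c.vec) u (x + t • c.vec i + z)‖ ^ 2).sum) := by
      intro t _
      have e1 := ih hs.2 u (x + t • c.vec i)
      have e2 := ih hs.2 (latticeDiff (c.vec i) u) (x + t • c.vec i)
      have e3 : (s.sublists'.map fun q => (n : ℝ) ^ (2 * (q.length + 1)) *
        ∑ z ∈ c.box n s, ‖listDiff ((i :: q).map c.vec) u (x + t • c.vec i + z)‖ ^ 2).sum =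
        (n : ℝ) ^ 2 * (s.sublists'.map fun q => (n : ℝ) ^ (2 * q.length) *
        ∑ z ∈ c.box n s,
          ‖listDiff (q.map c.vec) (latticeDiff (c.vec i) u) (x + t • c.vec i + z)‖ ^ 2).sum := by
        rw [← List.sum_map_mul_left]
        congr 1
        refine List.map_congr_left fun q _ => ?_
        rw [List.map_cons, listDiff_cons, listDiff_latticeDiff]
        ring
      rw [e3]
      have hn2 : (0 : ℝ) ≤ (n : ℝ) ^ 2 := by positivity
      nlinarith [mul_le_mul_of_nonneg_left e2 hn2]
    have h3 := Finset.sum_le_sum h2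
    rw [← Finset.mul_sum, ← Finset.mul_sum] at h3
    rw [List.sublists'_cons, List.map_append, List.sum_append, List.map_map]
    have h4 : ∀ (m : List ι → ℕ) (f : List ι → L → ℝ) (P : List (List ι)),
        ∑ t ∈ Finset.range n, (P.map fun q => (n : ℝ) ^ (m q) *
          ∑ z ∈ c.box n s, f q (x + t • c.vec i + z)).sum =
        (P.map fun q => (n : ℝ) ^ (m q) * ∑ z ∈ c.box n (i :: s), f q (x + z)).sum := by
      intro m f P
      induction P with
      | nil => simp
      | cons q P ihP =>
        simp only [List.map_cons, List.sum_cons, Finset.sum_add_distrib, ihP, ← Finset.mul_sum]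
        rw [c.sum_box_cons hs.1]
        simp only [add_assoc]
    rw [Finset.sum_add_distrib] at h1
    rw [Finset.sum_add_distrib, Finset.sum_add_distrib] at h3
    have h5 := h4 (fun q => 2 * q.length) (fun q l => ‖listDiff (q.map c.vec) u l‖ ^ 2) s.sublists'
    have h6 := h4 (fun q => 2 * (q.length + 1))
      (fun q l => ‖listDiff ((i :: q).map c.vec) u l‖ ^ 2) s.sublists'
    rw [h5, h6] at h3
    have hn0 : (0 : ℝ) ≤ (n : ℝ) ^ s.length := by positivity
    have aux : ∀ {a X Y P Q : ℝ}, 0 ≤ P → n * a ≤ 2 * X → P * X ≤ Q * Y →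
        P * n * a ≤ Q * 2 * Y := by
      intro a X Y P Q hP h h'
      nlinarith [mul_le_mul_of_nonneg_left h hP]
    simp only [List.length_cons, pow_succ _ s.length, Function.comp_def]
    exact aux hn0 h1 h3

end LatticeCoords

/-! ### Mean value property, gradient estimate and Liouville's theorem. -/

section InteriorEstimates

variable {ι L : Type*} [Fintype ι] [NormedAddCommGroup L] [FiniteBalls L] {N : ℕ} {R : Finset L}
  {V : (R → EuclideanSpace ℝ (Fin N)) → ℝ}

/-- `sobolev_box` on a box of side n is combined with `caccioppoli_list` at scale s = n, so that the
powers n^{2|t|} cancel. In the constant, b accounts for the size of the box, Q for the Caccioppoli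
constants of all sublists, and the power of two comes from the Sobolev inequality. -/
theorem mean_value_nat (c : LatticeCoords ι L) (hR : AddSubgroup.closure (R : Set L) = ⊤)
    (hV : ContDiff ℝ 2 V) {c₀ : ℝ} (hst : FiniteStable R V c₀) :
    ∃ K : ℝ, 0 < K ∧ ∀ (u : L → EuclideanSpace ℝ (Fin N)) (x : L) (n : ℕ), K ≤ n →
      (∀ l, ‖l - x‖ ≤ K * n → hamiltonian R V u l = 0) →
      (n : ℝ) ^ Fintype.card ι * ‖u x‖ ^ 2 ≤ K * ballEnergy u x (K * n) := by
  classical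
  choose K hK hKu using fun t : List L => caccioppoli_list hR hV hst t
  set s : List ι := Finset.univ.toList with hs
  have hsn : s.Nodup := Finset.nodup_toList _
  have hsl : s.length = Fintype.card ι := by simp [hs, Finset.card_univ]
  set Q : ℝ := (s.sublists'.map fun t => K (t.map c.vec)).sum with hQ
  set b : ℝ := (s.map fun i => ‖c.vec i‖).sum with hb
  have hb0 : 0 ≤ b := List.sum_nonneg (by simp)
  have hQ0 : 0 ≤ Q := List.sum_nonneg (by
    intro y hy
    obtain ⟨t, -, rfl⟩ := List.mem_map.1 hy
    exact (hK _).le)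
  have hKQ : ∀ t ∈ s.sublists', K (t.map c.vec) ≤ Q := fun t ht =>
    List.single_le_sum (by
      intro y hy
      obtain ⟨t, -, rfl⟩ := List.mem_map.1 hy
      exact (hK _).le) _ (List.mem_map.2 ⟨t, ht, rfl⟩)
  refine ⟨1 + b + Q + 2 ^ s.length * Q, by positivity, fun u x n hn hu => ?_⟩
  set C := 1 + b + Q + 2 ^ s.length * Q with hC
  have hQ' : 0 ≤ 2 ^ s.length * Q := by positivity
  have hn1 : (1 : ℝ) ≤ n := by linarith
  have hn0 : 0 < n := by exact_mod_cast (lt_of_lt_of_le one_pos hn1)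
  have hC0 : n * b + Q * n ≤ C * n := by nlinarith
  rw [← hsl]
  refine (c.sobolev_box hn0 s hsn u x).trans ?_
  have hE := ballEnergy_nonneg u x (C * n)
  have hterm : ∀ t ∈ s.sublists', (n : ℝ) ^ (2 * t.length) *
      ∑ z ∈ c.box n s, ‖listDiff (t.map c.vec) u (x + z)‖ ^ 2 ≤
      K (t.map c.vec) * ballEnergy u x (C * n) := by
    intro t ht
    have h1 : ∑ z ∈ c.box n s, ‖listDiff (t.map c.vec) u (x + z)‖ ^ 2 ≤
        ballEnergy (listDiff (t.map c.vec) u) x (n * b) := by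
      have : ∑ z ∈ c.box n s, ‖listDiff (t.map c.vec) u (x + z)‖ ^ 2 =
          ∑ y ∈ (c.box n s).image (x + ·), ‖listDiff (t.map c.vec) u y‖ ^ 2 := by
        rw [Finset.sum_image fun y _ z _ h => add_left_cancel h]
      rw [this]
      refine Finset.sum_le_sum_of_subset_of_nonneg ?_ fun _ _ _ => sq_nonneg _
      intro y hy
      obtain ⟨z, hz, rfl⟩ := Finset.mem_image.1 hy
      rw [mem_latticeBall, add_sub_cancel_left]
      exact c.norm_box_le hz
    have hkt := hKQ t ht
    have hle : n * b + K (t.map c.vec) * n ≤ C * n := by nlinarith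
    have h2 := hKu (t.map c.vec) u x (n * b) n (by linarith)
      fun l hl => hu l (hl.trans hle)
    rw [List.length_map] at h2
    have hp : (0 : ℝ) < (n : ℝ) ^ (2 * t.length) := by positivity
    calc _ ≤ (n : ℝ) ^ (2 * t.length) * (K (t.map c.vec) / (n : ℝ) ^ (2 * t.length) *
          ballEnergy u x (n * b + K (t.map c.vec) * n)) := by
            gcongr
            exact h1.trans h2
      _ = K (t.map c.vec) * ballEnergy u x (n * b + K (t.map c.vec) * n) := by
          field_simp
      _ ≤ _ := by
          have := (hK (t.map c.vec)).le
          gcongr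
          exact ballEnergy_mono_radius u hle
  have hsum := List.sum_le_sum hterm
  rw [List.sum_map_mul_right] at hsum
  calc _ ≤ 2 ^ s.length * (Q * ballEnergy u x (C * n)) := by gcongr
    _ = (2 ^ s.length * Q) * ballEnergy u x (C * n) := by ring
    _ ≤ _ := by gcongr; linarith

theorem mean_value (c : LatticeCoords ι L) (hR : AddSubgroup.closure (R : Set L) = ⊤)
    (hV : ContDiff ℝ 2 V) {c₀ : ℝ} (hst : FiniteStable R V c₀) :
    ∃ C : ℝ, 1 ≤ C ∧ ∀ (u : L → EuclideanSpace ℝ (Fin N)) (x : L) (r : ℝ), C ≤ r →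
      (∀ l, ‖l - x‖ ≤ r → hamiltonian R V u l = 0) →
      r ^ Fintype.card ι * ‖u x‖ ^ 2 ≤ C * ballEnergy u x r := by
  obtain ⟨K, hK, h⟩ := mean_value_nat c hR hV hst
  -- The lower bound on r by 2K gives r ≤ 2Kn for n = ⌊r/K⌋; together with 2K² it also gives n ≥ K.
  refine ⟨1 + 2 * K + 2 * K ^ 2 + (2 * K) ^ Fintype.card ι * K, ?_, fun u x r hr hu => ?_⟩
  · have : 0 < (2 * K) ^ Fintype.card ι * K := by positivity
    nlinarith
  have hp : 0 < (2 * K) ^ Fintype.card ι * K := by positivity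
  set n := ⌊r / K⌋₊ with hn
  have hr0 : 0 ≤ r := by nlinarith
  have h1 : (n : ℝ) ≤ r / K := Nat.floor_le (by positivity)
  have h2 : r / K < n + 1 := Nat.lt_floor_add_one _
  have h3 : K * n ≤ r := by rw [le_div_iff₀' hK] at h1; exact h1
  rw [div_lt_iff₀' hK] at h2
  have h4 : r ≤ 2 * K * n := by nlinarith
  have h5 : K ≤ n := by
    by_contra hcon
    rw [not_le] at hcon
    nlinarith
  have h6 := h u x n h5 fun l hl => hu l (hl.trans h3)
  have hE := ballEnergy_nonneg u x r
  calc r ^ Fintype.card ι * ‖u x‖ ^ 2 ≤ (2 * K * n) ^ Fintype.card ι * ‖u x‖ ^ 2 := by gcongr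
    _ = (2 * K) ^ Fintype.card ι * ((n : ℝ) ^ Fintype.card ι * ‖u x‖ ^ 2) := by
        rw [mul_pow]; ring
    _ ≤ (2 * K) ^ Fintype.card ι * (K * ballEnergy u x (K * n)) := by gcongr
    _ ≤ (2 * K) ^ Fintype.card ι * (K * ballEnergy u x r) := by
        gcongr
        exact ballEnergy_mono_radius u h3
    _ = ((2 * K) ^ Fintype.card ι * K) * ballEnergy u x r := by ring
    _ ≤ _ := by gcongr; nlinarith

/-- The mean value bound is applied to the harmonic field D_a u on the ball of radius r/2, and
Caccioppoli with s = r/(2K) passes from radius r/2 to exactly r. This gains r⁻² over the mean value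
bound for u. -/
theorem gradient_estimate_energy (c : LatticeCoords ι L)
    (hR : AddSubgroup.closure (R : Set L) = ⊤)
    (hV : ContDiff ℝ 2 V) {c₀ : ℝ} (hst : FiniteStable R V c₀) (a : L) :
    ∃ C : ℝ, 1 ≤ C ∧ ∀ (u : L → EuclideanSpace ℝ (Fin N)) (x : L) (r : ℝ), C ≤ r →
      (∀ l, ‖l - x‖ ≤ r → hamiltonian R V u l = 0) →
      r ^ (Fintype.card ι + 2) * ‖latticeDiff a u x‖ ^ 2 ≤ C * ballEnergy u x r := by
  obtain ⟨A, hA, hAu⟩ := mean_value c hR hV hst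
  obtain ⟨K, hK, hKu⟩ := caccioppoli R V hR hV hst a
  set q := 2 ^ Fintype.card ι * A * (K * (2 * K) ^ 2) with hq
  have hq0 : 0 ≤ q := by positivity
  have ha := norm_nonneg a
  refine ⟨2 * A + 2 * K ^ 2 + 2 * ‖a‖ + q, by nlinarith, fun u x r hr hu => ?_⟩
  have hr0 : 0 < r := by nlinarith
  have h1 := hAu (latticeDiff a u) x (r / 2) (by nlinarith)
    (hamiltonian_latticeDiff_eq_zero hu (by nlinarith))
  have hrad : r / 2 + K * (r / (2 * K)) = r := by field_simp; norm_num
  have h2 := hKu u x (r / 2) (r / (2 * K)) (by rw [le_div_iff₀ (by positivity)]; nlinarith)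
    (by rw [hrad]; exact hu)
  rw [hrad] at h2
  have hE := ballEnergy_nonneg u x r
  calc r ^ (Fintype.card ι + 2) * ‖latticeDiff a u x‖ ^ 2
      = 2 ^ Fintype.card ι * r ^ 2 * ((r / 2) ^ Fintype.card ι * ‖latticeDiff a u x‖ ^ 2) := by
        rw [div_pow, pow_add]; field_simp
    _ ≤ 2 ^ Fintype.card ι * r ^ 2 * (A * (K / (r / (2 * K)) ^ 2 * ballEnergy u x r)) := by
        refine mul_le_mul_of_nonneg_left (h1.trans ?_) (by positivity)
        gcongr
    _ = q * ballEnergy u x r := by rw [hq]; field_simp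
    _ ≤ _ := by gcongr; nlinarith

theorem gradient_estimate (c : LatticeCoords ι L)
    (hR : AddSubgroup.closure (R : Set L) = ⊤)
    (hV : ContDiff ℝ 2 V) {c₀ : ℝ} (hst : FiniteStable R V c₀) (a : L) :
    ∃ C : ℝ, 1 ≤ C ∧ ∀ (u : L → EuclideanSpace ℝ (Fin N)) (x : L) (r M : ℝ), C ≤ r →
      (∀ l, ‖l - x‖ ≤ r → hamiltonian R V u l = 0) → (∀ l, ‖l - x‖ ≤ r → ‖u l‖ ≤ M) →
      ‖latticeDiff a u x‖ ≤ C * M / r := by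
  obtain ⟨A, hA, hAu⟩ := gradient_estimate_energy c hR hV hst a
  obtain ⟨B, hB, hBc⟩ := c.card_latticeBall_le
  refine ⟨A + A * B, by nlinarith, fun u x r M hr hu hM => ?_⟩
  have hAB : 0 < A * B := by positivity
  have hr0 : 0 < r := by linarith
  have hM0 : 0 ≤ M := (norm_nonneg _).trans (hM x (by simp [hr0.le]))
  have h1 := hAu u x r (by linarith) hu
  have h2 : ballEnergy u x r ≤ B * r ^ Fintype.card ι * M ^ 2 := by
    calc ballEnergy u x r ≤ ∑ l ∈ latticeBall x r, M ^ 2 :=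
          Finset.sum_le_sum fun l hl =>
            pow_le_pow_left₀ (norm_nonneg _) (hM l (mem_latticeBall.1 hl)) 2
      _ = (latticeBall x r).card * M ^ 2 := by simp
      _ ≤ _ := by gcongr; exact hBc x r (by linarith)
  have h3 : (r * ‖latticeDiff a u x‖) ^ 2 ≤ A * B * M ^ 2 := by
    have hp : 0 < r ^ Fintype.card ι := by positivity
    refine le_of_mul_le_mul_left ?_ hp
    calc r ^ Fintype.card ι * (r * ‖latticeDiff a u x‖) ^ 2
        = r ^ (Fintype.card ι + 2) * ‖latticeDiff a u x‖ ^ 2 := by ring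
      _ ≤ A * (B * r ^ Fintype.card ι * M ^ 2) := h1.trans (by gcongr)
      _ = _ := by ring
  rw [le_div_iff₀' hr0]
  refine abs_le_of_sq_le_sq' ?_ (by positivity) |>.2
  refine h3.trans ?_
  rw [mul_pow]
  gcongr
  nlinarith

/-- Bounded harmonic fields are constant. -/
theorem latticeDiff_eq_zero_of_bounded (c : LatticeCoords ι L)
    (hR : AddSubgroup.closure (R : Set L) = ⊤)
    (hV : ContDiff ℝ 2 V) {c₀ : ℝ} (hst : FiniteStable R V c₀)
    {u : L → EuclideanSpace ℝ (Fin N)} (hu : ∀ l, hamiltonian R V u l = 0) {M : ℝ}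
    (hM : ∀ l, ‖u l‖ ≤ M) (a x : L) : latticeDiff a u x = 0 := by
  obtain ⟨C, hC, h⟩ := gradient_estimate c hR hV hst a
  have h1 : Tendsto (fun r : ℝ => C * M / r) atTop (𝓝 0) := tendsto_const_nhds.div_atTop tendsto_id
  have h2 : ‖latticeDiff a u x‖ ≤ 0 := by
    refine ge_of_tendsto h1 ?_
    filter_upwards [eventually_ge_atTop C] with r hr
    exact h u x r M hr (fun l _ => hu l) fun l _ => hM l
  simpa using h2

end InteriorEstimates

/-! ### Decay rates -/

section Decay

variable {L : Type*} [NormedAddCommGroup L]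

theorem two_le_shiftedNorm (l : L) : 2 ≤ shiftedNorm l := by
  unfold shiftedNorm; linarith [norm_nonneg l]

theorem shiftedNorm_pos (l : L) : 0 < shiftedNorm l := by linarith [two_le_shiftedNorm l]

theorem log_shiftedNorm_pos (l : L) : 0 < Real.log (shiftedNorm l) :=
  Real.log_pos (by linarith [two_le_shiftedNorm l])

theorem shiftedNorm_neg (l : L) : shiftedNorm (-l) = shiftedNorm l := by simp [shiftedNorm]

theorem shiftedNorm_add_le (l b : L) : shiftedNorm (l + b) ≤ (1 + ‖b‖) * shiftedNorm l := by
  have h := norm_add_le l b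
  have h2 := two_le_shiftedNorm l
  have h3 := norm_nonneg b
  unfold shiftedNorm at *
  nlinarith

theorem le_shiftedNorm_add (l b : L) : shiftedNorm l ≤ (1 + ‖b‖) * shiftedNorm (l + b) := by
  simpa using shiftedNorm_add_le (l + b) (-b)

/-- The rate `|ℓ|₀^a log^β |ℓ|₀`. -/
noncomputable def decayRate (a : ℤ) (β : ℕ) (l : L) : ℝ :=
  shiftedNorm l ^ a * Real.log (shiftedNorm l) ^ β

theorem decayRate_pos (a : ℤ) (β : ℕ) (l : L) : 0 < decayRate a β l :=
  mul_pos (zpow_pos (shiftedNorm_pos l) a) (pow_pos (log_shiftedNorm_pos l) β)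

theorem decaysLike_iff {f : L → ℝ} {a : ℤ} {β : ℕ} :
    DecaysLike f a β ↔ ∃ C : ℝ, 0 < C ∧ ∀ l, f l ≤ C * decayRate a β l := by
  constructor
  · rintro ⟨C, hC⟩
    refine ⟨max C 1, by positivity, fun l => (hC l).trans ?_⟩
    rw [mul_assoc]
    exact mul_le_mul_of_nonneg_right (le_max_left _ _) (decayRate_pos a β l).le
  · rintro ⟨C, _, hC⟩
    exact ⟨C, fun l => (hC l).trans (le_of_eq (by rw [decayRate, mul_assoc]))⟩

theorem zpow_le_of_comparable {x y K : ℝ} (hx : 0 < x) (hy : 0 < y) (hK : 1 ≤ K)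
    (h1 : x ≤ K * y) (h2 : y ≤ K * x) (a : ℤ) : x ^ a ≤ K ^ a.natAbs * y ^ a := by
  have hK0 : 0 < K := by linarith
  rcases Int.natAbs_eq a with h | h
  · rw [h]
    simp only [zpow_natCast, Int.natAbs_natCast]
    rw [← mul_pow]
    exact pow_le_pow_left₀ hx.le h1 _
  · rw [h]
    simp only [zpow_neg, zpow_natCast, Int.natAbs_neg, Int.natAbs_natCast]
    have h3 : x⁻¹ ≤ K * y⁻¹ := by
      rw [← div_eq_mul_inv, le_div_iff₀ hy, inv_mul_le_iff₀ hx]; linarith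
    have h4 := pow_le_pow_left₀ (by positivity) h3 a.natAbs
    rwa [mul_pow, inv_pow, inv_pow] at h4

theorem log_le_of_comparable {x y K : ℝ} (hx : 0 < x) (hy : 2 ≤ y) (hK : 1 ≤ K)
    (h1 : x ≤ K * y) : Real.log x ≤ (1 + Real.log K / Real.log 2) * Real.log y := by
  have hl2 : 0 < Real.log 2 := Real.log_pos (by norm_num)
  have h3 : Real.log x ≤ Real.log K + Real.log y := by
    rw [← Real.log_mul (by linarith) (by linarith)]
    exact Real.log_le_log hx h1
  have h4 : Real.log 2 ≤ Real.log y := Real.log_le_log (by norm_num) hy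
  have h5 : 0 ≤ Real.log K / Real.log 2 := div_nonneg (Real.log_nonneg hK) hl2.le
  have h6 : Real.log K = Real.log K / Real.log 2 * Real.log 2 := by field_simp
  nlinarith

theorem decayRate_le_of_comparable (a : ℤ) (β : ℕ) {K : ℝ} (hK : 1 ≤ K) :
    ∃ C : ℝ, 0 < C ∧ ∀ l m : L, shiftedNorm l ≤ K * shiftedNorm m →
      shiftedNorm m ≤ K * shiftedNorm l → decayRate a β l ≤ C * decayRate a β m := by
  have hl2 : 0 < Real.log 2 := Real.log_pos (by norm_num)
  have hlK := Real.log_nonneg hK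
  refine ⟨K ^ a.natAbs * (1 + Real.log K / Real.log 2) ^ β, by positivity, fun l m h1 h2 => ?_⟩
  unfold decayRate
  have e1 := zpow_le_of_comparable (shiftedNorm_pos l) (shiftedNorm_pos m) hK h1 h2 a
  have e2 := pow_le_pow_left₀ (log_shiftedNorm_pos l).le
    (log_le_of_comparable (shiftedNorm_pos l) (two_le_shiftedNorm m) hK h1) β
  have e3 := (log_shiftedNorm_pos l).le
  have e4 := (shiftedNorm_pos m).le
  calc _ ≤ (K ^ a.natAbs * shiftedNorm m ^ a) *
        ((1 + Real.log K / Real.log 2) * Real.log (shiftedNorm m)) ^ β := by gcongr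
    _ = _ := by rw [mul_pow]; ring

namespace DecaysLike

variable {f g : L → ℝ} {a b : ℤ} {β γ : ℕ}

theorem of_le (hg : DecaysLike g a β) (h : ∀ l, f l ≤ g l) : DecaysLike f a β := by
  obtain ⟨C, hC⟩ := hg
  exact ⟨C, fun l => (h l).trans (hC l)⟩

theorem zero : DecaysLike (fun _ : L => (0 : ℝ)) a β := ⟨0, fun l => by simp⟩

theorem add (hf : DecaysLike f a β) (hg : DecaysLike g a β) :
    DecaysLike (fun l => f l + g l) a β := by
  obtain ⟨C, hC⟩ := hf
  obtain ⟨D, hD⟩ := hg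
  refine ⟨C + D, fun l => ?_⟩
  have := add_le_add (hC l) (hD l)
  linarith

theorem const_mul {c : ℝ} (hc : 0 ≤ c) (hf : DecaysLike f a β) :
    DecaysLike (fun l => c * f l) a β := by
  obtain ⟨C, hC⟩ := hf
  refine ⟨c * C, fun l => ?_⟩
  have := mul_le_mul_of_nonneg_left (hC l) hc
  linarith

theorem sum {ι : Type*} {I : Finset ι} {f : ι → L → ℝ} (h : ∀ i ∈ I, DecaysLike (f i) a β) :
    DecaysLike (fun l => ∑ i ∈ I, f i l) a β := by
  classical
  induction I using Finset.induction_on with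
  | empty => simpa using zero
  | insert i I hi ih =>
    simp only [Finset.sum_insert hi]
    exact (h i (Finset.mem_insert_self i I)).add (ih fun j hj => h j (Finset.mem_insert_of_mem hj))

theorem mono (hf : DecaysLike f a β) (hab : a ≤ b) (hβ : β ≤ γ) : DecaysLike f b γ := by
  rw [decaysLike_iff] at hf ⊢
  obtain ⟨C, hC0, hC⟩ := hf
  have hl2 : 0 < Real.log 2 := Real.log_pos (by norm_num)
  refine ⟨C * (1 / Real.log 2) ^ (γ - β), by positivity, fun l => (hC l).trans ?_⟩
  rw [mul_assoc]
  refine mul_le_mul_of_nonneg_left ?_ hC0.le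
  have h1 : shiftedNorm l ^ a ≤ shiftedNorm l ^ b :=
    zpow_le_zpow_right₀ (by linarith [two_le_shiftedNorm l]) hab
  have h2 : Real.log 2 ≤ Real.log (shiftedNorm l) :=
    Real.log_le_log (by norm_num) (two_le_shiftedNorm l)
  have h3 : Real.log (shiftedNorm l) ^ β ≤
      (1 / Real.log 2) ^ (γ - β) * Real.log (shiftedNorm l) ^ γ := by
    have h4 : (1 : ℝ) ≤ (1 / Real.log 2 * Real.log (shiftedNorm l)) ^ (γ - β) := by
      refine one_le_pow₀ ?_
      rw [one_div, le_inv_mul_iff₀ hl2]; simpa using h2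
    have h5 := (pow_pos (log_shiftedNorm_pos l) β).le
    calc _ = 1 * Real.log (shiftedNorm l) ^ β := (one_mul _).symm
      _ ≤ (1 / Real.log 2 * Real.log (shiftedNorm l)) ^ (γ - β) *
          Real.log (shiftedNorm l) ^ β := by gcongr
      _ = _ := by rw [mul_pow, mul_assoc, ← pow_add, Nat.sub_add_cancel hβ]
  have h6 := (zpow_pos (shiftedNorm_pos l) b).le
  have h7 := (pow_pos (log_shiftedNorm_pos l) β).le
  unfold decayRate
  calc _ ≤ shiftedNorm l ^ b * ((1 / Real.log 2) ^ (γ - β) * Real.log (shiftedNorm l) ^ γ) := by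
        gcongr
    _ = _ := by ring

theorem shift (hf : DecaysLike f a β) (b : L) : DecaysLike (fun l => f (l + b)) a β := by
  rw [decaysLike_iff] at hf ⊢
  obtain ⟨C, hC0, hC⟩ := hf
  obtain ⟨D, hD0, hD⟩ := decayRate_le_of_comparable (L := L) a β (K := 1 + ‖b‖)
    (by linarith [norm_nonneg b])
  refine ⟨C * D, by positivity, fun l => (hC _).trans ?_⟩
  rw [mul_assoc]
  exact mul_le_mul_of_nonneg_left (hD _ _ (shiftedNorm_add_le l b) (le_shiftedNorm_add l b)) hC0.le

theorem of_large [FiniteBalls L] {C r : ℝ}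
    (h : ∀ l, r ≤ ‖l‖ → f l ≤ C * decayRate a β l) : DecaysLike f a β := by
  rw [decaysLike_iff]
  refine ⟨1 + |C| + ∑ m ∈ latticeBall (0 : L) r, |f m| / decayRate a β m, ?_, fun l => ?_⟩
  · have : 0 ≤ ∑ m ∈ latticeBall (0 : L) r, |f m| / decayRate a β m :=
      Finset.sum_nonneg fun m _ => div_nonneg (abs_nonneg _) (decayRate_pos a β m).le
    positivity
  · have hp := decayRate_pos a β l
    have h0 : 0 ≤ ∑ m ∈ latticeBall (0 : L) r, |f m| / decayRate a β m :=
      Finset.sum_nonneg fun m _ => div_nonneg (abs_nonneg _) (decayRate_pos a β m).le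
    by_cases hl : r ≤ ‖l‖
    · refine (h l hl).trans (mul_le_mul_of_nonneg_right ?_ hp.le)
      linarith [le_abs_self C]
    · have h1 : |f l| / decayRate a β l ≤
          ∑ m ∈ latticeBall (0 : L) r, |f m| / decayRate a β m :=
        Finset.single_le_sum (f := fun m => |f m| / decayRate a β m)
          (fun m _ => div_nonneg (abs_nonneg _) (decayRate_pos a β m).le)
          (by simpa using (not_le.1 hl).le)
      rw [div_le_iff₀ hp] at h1
      refine (le_abs_self _).trans (h1.trans (mul_le_mul_of_nonneg_right ?_ hp.le))
      linarith [abs_nonneg C]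

variable {E : Type*} [NormedAddCommGroup E] {u : L → E}

theorem latticeDiff_of_closure {R : Finset L} (hR : AddSubgroup.closure (R : Set L) = ⊤)
    (hu : ∀ ρ ∈ R, DecaysLike (fun l => ‖_root_.latticeDiff ρ u l‖) a β) (b : L) :
    DecaysLike (fun l => ‖_root_.latticeDiff b u l‖) a β := by
  refine latticeDiff_induction hR
    (p := fun b => DecaysLike (fun l => ‖_root_.latticeDiff b u l‖) a β) ?_ ?_ ?_ ?_ b
  · exact hu
  · simp only [latticeDiff_zero_left, Pi.zero_apply, norm_zero]
    exact zero
  · intro b b' hb hb'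
    refine ((hb.shift b').add hb').of_le fun l => ?_
    rw [latticeDiff_add_left]
    exact norm_add_le _ _
  · intro b hb
    refine (hb.shift (-b)).of_le fun l => ?_
    rw [latticeDiff_neg_left, norm_neg, sub_eq_add_neg]

/-- Entries are freed one at a time: t is the arbitrary part of the list and s the part still in R.
As differences commute, the entry being freed can be moved outermost, where `latticeDiff_of_closure`
applies. -/
theorem listDiff_of_closure {R : Finset L} (hR : AddSubgroup.closure (R : Set L) = ⊤) {j : ℕ}
    (hu : ∀ t : List L, (∀ ρ ∈ t, ρ ∈ R) → t.length = j →
      DecaysLike (fun l => ‖listDiff t u l‖) a β) (t : List L) (ht : t.length = j) :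
    DecaysLike (fun l => ‖listDiff t u l‖) a β := by
  suffices h : ∀ (t s : List L), (∀ ρ ∈ s, ρ ∈ R) → (t ++ s).length = j →
      DecaysLike (fun l => ‖listDiff (t ++ s) u l‖) a β by
    simpa using h t [] (by simp) (by simpa using ht)
  intro t
  induction t with
  | nil => intro s hs hl; simpa using hu s hs (by simpa using hl)
  | cons b t ih =>
    intro s hs hl
    simp only [List.cons_append, listDiff_cons]
    refine latticeDiff_of_closure hR (fun ρ hρ => ?_) b
    have := ih (ρ :: s) (by simpa using ⟨hρ, hs⟩) (by simp at hl ⊢; omega)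
    rwa [listDiff_append, listDiff_cons, listDiff_latticeDiff, ← listDiff_append] at this

/-- Together with `listDiff_of_normIterStencil` this exchanges the stencil norm for differences
along arbitrary lists, the form in which all decay estimates are carried out. -/
theorem normIterStencil {R : Finset L} {j : ℕ}
    (hu : ∀ t : List L, t.length = j → DecaysLike (fun l => ‖listDiff t u l‖) a β) :
    DecaysLike (normIterStencil R j u) a β := by
  refine (DecaysLike.sum (I := (Finset.univ : Finset (Fin j → R))) fun ρ _ =>
    hu (List.ofFn fun i => (ρ i : L)) (by simp)).of_le fun l => ?_
  unfold _root_.normIterStencil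
  refine Real.sqrt_le_iff.2 ⟨Finset.sum_nonneg fun _ _ => norm_nonneg _, ?_⟩
  simp only [iterDiff_eq_listDiff]
  exact Finset.sum_sq_le_sq_sum_of_nonneg fun _ _ => norm_nonneg _

theorem listDiff_of_normIterStencil {R : Finset L} (hR : AddSubgroup.closure (R : Set L) = ⊤)
    {j : ℕ} (hu : DecaysLike (_root_.normIterStencil R j u) a β) (t : List L) (ht : t.length = j) :
    DecaysLike (fun l => ‖listDiff t u l‖) a β := by
  refine listDiff_of_closure hR (fun t htR ht => ?_) t ht
  refine hu.of_le fun l => ?_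
  subst ht
  have h1 : listDiff t u l = iterDiff t.length (fun i => t.get i) u l := by
    rw [iterDiff_eq_listDiff, List.ofFn_get]
  rw [h1]
  unfold _root_.normIterStencil
  refine Real.le_sqrt_of_sq_le ?_
  exact Finset.single_le_sum (f := fun ρ : Fin t.length → R =>
    ‖iterDiff t.length (fun i => (ρ i : L)) u l‖ ^ 2) (fun _ _ => sq_nonneg _)
    (Finset.mem_univ fun i => ⟨t.get i, htR _ (List.get_mem _ _)⟩)

end DecaysLike

end Decay

/-! ### The Dirichlet problem -/

theorem component_le_norm {N : ℕ} (x : EuclideanSpace ℝ (Fin N)) (k : Fin N) : x k ≤ ‖x‖ :=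
  (le_abs_self _).trans (PiLp.norm_apply_le x k)

theorem finite_support_of_forall_notMem {L E : Type*} [Zero E] {Ω : Finset L} {φ : L → E}
    (h : ∀ l ∉ Ω, φ l = 0) : φ.support.Finite :=
  Ω.finite_toSet.subset fun l hl => by
    by_contra hc
    exact hl (h l hc)

/-- The arithmetic of the duality argument: p is r^d, q the energy of v near y, x the size of the
dual difference at the origin, e its ball energy and w the energy of the dual solution. The chain
gives p q² ≤ (M A / c₀²) q, and one factor q cancels. -/
theorem mul_le_of_duality {p q x e w M A c₀ : ℝ} (hp : 0 ≤ p) (hq : 0 ≤ q) (hM : 0 < M)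
    (hA : 0 < A) (hc : 0 < c₀) (hqx : q ≤ x) (h1 : p * x ^ 2 ≤ M * e) (h2 : e ≤ A * w)
    (h3 : c₀ ^ 2 * w ≤ q) : p * q ≤ M * A / c₀ ^ 2 := by
  rcases hq.eq_or_lt with h | h
  · rw [← h]; simp; positivity
  · refine le_of_mul_le_mul_right ?_ h
    calc p * q * q = p * q ^ 2 := by ring
      _ ≤ p * x ^ 2 := by gcongr
      _ ≤ M * (A * w) := h1.trans (by gcongr)
      _ = M * A / c₀ ^ 2 * (c₀ ^ 2 * w) := by field_simp
      _ ≤ _ := by gcongr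

section Dirichlet

variable {L : Type*} [NormedAddCommGroup L] {N : ℕ} {R : Finset L}
  {V : (R → EuclideanSpace ℝ (Fin N)) → ℝ}

theorem summable_stencil_sq {φ : L → EuclideanSpace ℝ (Fin N)} (hφ : φ.support.Finite) :
    Summable fun l => ∑ ρ : R, ‖stencil R φ l ρ‖ ^ 2 :=
  summable_of_hasFiniteSupport ((finite_support_stencil R φ hφ).subset fun l hl => by
    simp only [Function.mem_support] at hl
    simp only [Set.mem_ofPred_eq]
    contrapose! hl
    simp [hl])

theorem sum_stencil_sq_le_energyNormSq {φ : L → EuclideanSpace ℝ (Fin N)}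
    (hφ : φ.support.Finite) (S : Finset L) :
    ∑ l ∈ S, ∑ ρ : R, ‖stencil R φ l ρ‖ ^ 2 ≤ energyNormSq R φ :=
  (summable_stencil_sq hφ).sum_le_tsum S fun _ _ => Finset.sum_nonneg fun _ _ => sq_nonneg _

theorem norm_latticeDiff_sq_le_stencil {ρ : L} (hρ : ρ ∈ R) (u : L → EuclideanSpace ℝ (Fin N))
    (l : L) : ‖latticeDiff ρ u l‖ ^ 2 ≤ ∑ ρ : R, ‖stencil R u l ρ‖ ^ 2 := by
  have h := Finset.single_le_sum (f := fun ρ : R => ‖stencil R u l ρ‖ ^ 2)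
    (fun _ _ => sq_nonneg _) (Finset.mem_univ ⟨ρ, hρ⟩)
  exact h

theorem energyNormSq_nonneg (φ : L → EuclideanSpace ℝ (Fin N)) : 0 ≤ energyNormSq R φ :=
  tsum_nonneg fun _ => Finset.sum_nonneg fun _ _ => sq_nonneg _

theorem hamiltonianForm_eq_tsum_inner {φ : L → EuclideanSpace ℝ (Fin N)}
    (hφ : φ.support.Finite) :
    hamiltonianForm R V φ = ∑' l, ⟪hamiltonian R V φ l, φ l⟫ :=
  tsum_siteHessian_stencil R V φ φ hφ

theorem tsum_inner_hamiltonian_comm (hV : ContDiff ℝ 2 V) {φ ψ : L → EuclideanSpace ℝ (Fin N)}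
    (hφ : φ.support.Finite) (hψ : ψ.support.Finite) :
    ∑' l, ⟪hamiltonian R V φ l, ψ l⟫ = ∑' l, ⟪hamiltonian R V ψ l, φ l⟫ := by
  rw [← tsum_siteHessian_stencil R V φ ψ hψ, ← tsum_siteHessian_stencil R V ψ φ hφ]
  exact tsum_congr fun l => siteHessian_symm R V hV _ _

theorem eq_zero_of_energyNormSq_le_zero [Infinite L] (hR : AddSubgroup.closure (R : Set L) = ⊤)
    {φ : L → EuclideanSpace ℝ (Fin N)} (hφ : φ.support.Finite) (h : energyNormSq R φ ≤ 0) :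
    φ = 0 := by
  have h1 : ∀ a l, latticeDiff a φ l = 0 := by
    refine latticeDiff_induction hR (p := fun a => ∀ l, latticeDiff a φ l = 0) ?_ ?_ ?_ ?_
    · intro ρ hρ l
      have h2 := (sum_stencil_sq_le_energyNormSq (R := R) hφ {l}).trans h
      rw [Finset.sum_singleton] at h2
      have h3 := Finset.single_le_sum (f := fun ρ : R => ‖stencil R φ l ρ‖ ^ 2)
        (fun _ _ => sq_nonneg _) (Finset.mem_univ ⟨ρ, hρ⟩)
      have h4 : ‖stencil R φ l ⟨ρ, hρ⟩‖ ^ 2 = 0 := le_antisymm (h3.trans h2) (sq_nonneg _)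
      simpa [stencil] using h4
    · intro l; simp [latticeDiff_zero_left]
    · intro a b ha hb l; simp [latticeDiff_add_left, ha, hb]
    · intro a ha l; simp [latticeDiff_neg_left, ha]
  obtain ⟨z, hz⟩ := hφ.exists_notMem
  have hz : φ z = 0 := by simpa using hz
  funext l
  have := h1 (l - z) z
  simpa [latticeDiff, hz] using this

open Classical in
/-- Extension by zero from a finite set. -/
noncomputable def extendZero (Ω : Finset L) :
    (Ω → EuclideanSpace ℝ (Fin N)) →ₗ[ℝ] L → EuclideanSpace ℝ (Fin N) where
  toFun x l := if h : l ∈ Ω then x ⟨l, h⟩ else 0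
  map_add' x y := by funext l; by_cases h : l ∈ Ω <;> simp [h]
  map_smul' c x := by funext l; by_cases h : l ∈ Ω <;> simp [h]

/-- Stability makes the restricted linear map injective, since a field of zero energy and finite
support on an infinite lattice vanishes; in finite dimension it is then surjective. -/
theorem exists_dirichlet_solution [Infinite L] (hR : AddSubgroup.closure (R : Set L) = ⊤)
    {c₀ : ℝ} (hst : FiniteStable R V c₀)
    (Ω : Finset L) (f : L → EuclideanSpace ℝ (Fin N)) :
    ∃ φ : L → EuclideanSpace ℝ (Fin N), (∀ l ∉ Ω, φ l = 0) ∧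
      ∀ l ∈ Ω, hamiltonian R V φ l = f l := by
  let T : (Ω → EuclideanSpace ℝ (Fin N)) →ₗ[ℝ] (Ω → EuclideanSpace ℝ (Fin N)) :=
    LinearMap.pi fun l => (hamiltonianCLM R V (l : L)).toLinearMap ∘ₗ extendZero Ω
  have hTa : ∀ x l, T x l = hamiltonian R V (extendZero Ω x) l := fun x l => rfl
  have hout : ∀ (x : Ω → EuclideanSpace ℝ (Fin N)), ∀ l ∉ Ω, extendZero Ω x l = 0 := by
    intro x l hl; simp [extendZero, hl]
  have hin : ∀ (x : Ω → EuclideanSpace ℝ (Fin N)) (l : Ω), extendZero Ω x l = x l := by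
    intro x l; simp [extendZero]
  have hinj : Function.Injective T := by
    rw [injective_iff_map_eq_zero]
    intro x hx
    have hfin := finite_support_of_forall_notMem (hout x)
    have hzero : hamiltonianForm R V (extendZero Ω x) = 0 := by
      rw [hamiltonianForm_eq_tsum_inner hfin]
      have : ∀ l, ⟪hamiltonian R V (extendZero Ω x) l, extendZero Ω x l⟫ = 0 := by
        intro l
        by_cases h : l ∈ Ω
        · rw [← hTa x ⟨l, h⟩, hx]; simp
        · rw [hout x l h]; simp
      simp [this]
    have hle := hst.le _ hfin
    rw [hzero] at hle
    have h0 := eq_zero_of_energyNormSq_le_zero hR hfin (by nlinarith [hst.pos])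
    funext l
    rw [← hin x l, h0]; rfl
  obtain ⟨x, hx⟩ := (LinearMap.injective_iff_surjective.1 hinj) fun l => f l
  refine ⟨extendZero Ω x, hout x, fun l hl => ?_⟩
  rw [← hTa x ⟨l, hl⟩, hx]

theorem ballEnergy_latticeDiff_le [FiniteBalls L] (hR : AddSubgroup.closure (R : Set L) = ⊤)
    (a : L) : ∃ C : ℝ, 0 < C ∧ ∀ φ : L → EuclideanSpace ℝ (Fin N), φ.support.Finite → ∀ x r,
      ballEnergy (latticeDiff a φ) x r ≤ C * energyNormSq R φ := by
  refine latticeDiff_induction hR (p := fun a => ∃ C : ℝ, 0 < C ∧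
    ∀ φ : L → EuclideanSpace ℝ (Fin N), φ.support.Finite → ∀ x r,
      ballEnergy (latticeDiff a φ) x r ≤ C * energyNormSq R φ) ?_ ?_ ?_ ?_ a
  · intro ρ hρ
    refine ⟨1, one_pos, fun φ hφ x r => ?_⟩
    rw [one_mul]
    refine le_trans ?_ (sum_stencil_sq_le_energyNormSq (R := R) hφ (latticeBall x r))
    exact Finset.sum_le_sum fun l _ => norm_latticeDiff_sq_le_stencil hρ φ l
  · refine ⟨1, one_pos, fun φ hφ x r => ?_⟩
    rw [latticeDiff_zero_left]
    have h0 : ballEnergy (0 : L → EuclideanSpace ℝ (Fin N)) x r = 0 := by simp [ballEnergy]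
    rw [h0, one_mul]
    exact energyNormSq_nonneg φ
  · rintro a b ⟨A, hA, hAu⟩ ⟨B, hB, hBu⟩
    refine ⟨2 * A + 2 * B, by positivity, fun φ hφ x r => ?_⟩
    have hsplit : latticeDiff (a + b) φ = (fun l => latticeDiff a φ (l + b)) + latticeDiff b φ := by
      funext l; exact latticeDiff_add_left a b φ l
    rw [hsplit]
    refine (ballEnergy_add_le _ _ x r).trans ?_
    rw [ballEnergy_shift]
    linarith [hAu φ hφ (x + b) r, hBu φ hφ x r]
  · rintro a ⟨A, hA, hAu⟩
    refine ⟨A, hA, fun φ hφ x r => ?_⟩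
    have e : ballEnergy (latticeDiff (-a) φ) x r =
        ballEnergy (fun l => latticeDiff a φ (l + -a)) x r := by
      unfold ballEnergy
      refine Finset.sum_congr rfl fun l _ => ?_
      rw [latticeDiff_neg_left, norm_neg, sub_eq_add_neg]
    rw [e, ballEnergy_shift]
    exact hAu φ hφ _ r

theorem norm_latticeDiff_sq_le [FiniteBalls L] (hR : AddSubgroup.closure (R : Set L) = ⊤)
    (a : L) : ∃ C : ℝ, 0 < C ∧ ∀ φ : L → EuclideanSpace ℝ (Fin N), φ.support.Finite → ∀ x,
      ‖latticeDiff a φ x‖ ^ 2 ≤ C * energyNormSq R φ := by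
  obtain ⟨C, hC, h⟩ := ballEnergy_latticeDiff_le (N := N) hR a
  exact ⟨C, hC, fun φ hφ x => (norm_sq_le_ballEnergy _ (by simp)).trans (h φ hφ x 0)⟩

open Classical in
/-- The field `e_k δ₀`. -/
noncomputable def pointSource (L : Type*) [Zero L] {N : ℕ} (k : Fin N) :
    L → EuclideanSpace ℝ (Fin N) :=
  fun l => if l = 0 then EuclideanSpace.single k 1 else 0

theorem pointSource_of_ne {k : Fin N} {l : L} (h : l ≠ 0) : pointSource L k l = 0 := by
  simp [pointSource, h]

/-- Pairing with a dipole produces a difference, which the energy controls uniformly in the domain.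
Point values lack such a bound when d = 2, which is why dipoles are constructed before the Green's
function. -/
theorem tsum_inner_dipole (a : L) (k : Fin N) (φ : L → EuclideanSpace ℝ (Fin N)) :
    ∑' l, ⟪latticeDiff a (pointSource L k) l, φ l⟫ = latticeDiff (-a) φ 0 k := by
  classical
  have h1 : HasSum (fun l => ⟪pointSource L k (l + a), φ l⟫) ⟪pointSource L k (-a + a), φ (-a)⟫ :=
    hasSum_single _ fun l hl => by
      rw [pointSource_of_ne, inner_zero_left]
      intro h
      exact hl (eq_neg_of_add_eq_zero_left h)
  have h2 : HasSum (fun l => ⟪pointSource L k l, φ l⟫) ⟪pointSource L k 0, φ 0⟫ :=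
    hasSum_single _ fun l hl => by
      rw [pointSource_of_ne hl, inner_zero_left]
  have h3 := (h1.sub h2).tsum_eq
  simp only [← inner_sub_left] at h3
  refine Eq.trans ?_ (h3.trans ?_)
  · rfl
  · simp [pointSource, latticeDiff, EuclideanSpace.inner_single_left]

/-- Testing the equation with its own solution gives c₀W ≤ |D_{-a}v(0)| ≤ √(AW) for the energy W,
with constants that do not depend on Ω. -/
theorem dirichlet_dipole_energy [FiniteBalls L]
    (hR : AddSubgroup.closure (R : Set L) = ⊤) {c₀ : ℝ}
    (hst : FiniteStable R V c₀) (a : L) (k : Fin N) :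
    ∃ C : ℝ, 0 < C ∧ ∀ (Ω : Finset L) (v : L → EuclideanSpace ℝ (Fin N)), (∀ l ∉ Ω, v l = 0) →
      (∀ l ∈ Ω, hamiltonian R V v l = latticeDiff a (pointSource L k) l) →
      energyNormSq R v ≤ C := by
  obtain ⟨A, hA, hAu⟩ := norm_latticeDiff_sq_le (N := N) hR (-a)
  have hc := hst.pos
  refine ⟨A / c₀ ^ 2, by positivity, fun Ω v hv hHv => ?_⟩
  have hfin := finite_support_of_forall_notMem hv
  set W := energyNormSq R v with hW
  have hW0 : 0 ≤ W := energyNormSq_nonneg v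
  have h1 : hamiltonianForm R V v = latticeDiff (-a) v 0 k := by
    rw [hamiltonianForm_eq_tsum_inner hfin, ← tsum_inner_dipole]
    refine tsum_congr fun l => ?_
    by_cases h : l ∈ Ω
    · rw [hHv l h]
    · rw [hv l h]; simp
  have h2 := hst.le v hfin
  rw [h1] at h2
  have h3 : (c₀ * W) ^ 2 ≤ A * W := by
    refine le_trans ?_ (hAu v hfin 0)
    refine pow_le_pow_left₀ (by positivity) (h2.trans ?_) 2
    exact component_le_norm _ k
  rw [le_div_iff₀ (by positivity)]
  rcases hW0.eq_or_lt with h | h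
  · rw [← h]; simp [hA.le]
  · refine le_of_mul_le_mul_right ?_ h
    nlinarith

set_option maxHeartbeats 1000000 in
/-- Decay of the gradient of the dipole solution of the Dirichlet problem, by duality. -/
theorem dirichlet_dipole_decay {ι : Type*} [Fintype ι] (c : LatticeCoords ι L) [FiniteBalls L]
    [Infinite L] (hR : AddSubgroup.closure (R : Set L) = ⊤) (hV : ContDiff ℝ 2 V) {c₀ : ℝ}
    (hst : FiniteStable R V c₀) (a : L) (k : Fin N) :
    ∃ C : ℝ, 1 ≤ C ∧ ∀ (Ω : Finset L) (v : L → EuclideanSpace ℝ (Fin N)), (∀ l ∉ Ω, v l = 0) →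
      (∀ l ∈ Ω, hamiltonian R V v l = latticeDiff a (pointSource L k) l) →
      ∀ (y : L) (r : ℝ), 4 * r = ‖y‖ → C ≤ r → latticeBall 0 (2 * ‖y‖) ⊆ Ω → ∀ ρ ∈ R,
      (r ^ Fintype.card ι * ‖latticeDiff ρ v y‖) ^ 2 ≤ C := by
  obtain ⟨P, hP, hPR⟩ := exists_norm_bound R
  obtain ⟨A, hA, hAu⟩ := ballEnergy_latticeDiff_le (N := N) hR (-a)
  obtain ⟨M, hM, hMu⟩ := mean_value c hR hV hst
  have hc := hst.pos
  have ha := norm_nonneg a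
  set D := M * A / c₀ ^ 2 with hD
  have hD0 : 0 < D := by positivity
  have hMD : 0 < M * D := by positivity
  refine ⟨1 + P + ‖a‖ + M + M * D, by linarith, fun Ω v hv hHv y r hr hCr hΩ ρ hρ => ?_⟩
  have hr0 : 0 < r := by linarith
  have hPr : P < r := by linarith
  have har : ‖a‖ < r := by linarith
  have hMr : M ≤ r := by linarith
  have hvfin := finite_support_of_forall_notMem hv
  set B := latticeBall y r with hB
  classical
  -- The dual problem has as source the divergence of Dv restricted to the ball around y. Testing it
  -- with v returns the local energy Q; by self-adjointness, testing the dipole equation with ψ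
  -- shows that Q is also a difference of ψ at the origin.
  set g : L → R → EuclideanSpace ℝ (Fin N) := fun l => if l ∈ B then stencil R v l else 0 with hg
  obtain ⟨ψ, hψ, hHψ⟩ := exists_dirichlet_solution hR hst Ω fun l => -latticeDiv R g l
  have hψfin := finite_support_of_forall_notMem hψ
  set Q := ∑ l ∈ B, ∑ ρ : R, ‖stencil R v l ρ‖ ^ 2 with hQ
  have hQ0 : 0 ≤ Q := Finset.sum_nonneg fun _ _ => Finset.sum_nonneg fun _ _ => sq_nonneg _
  have hpair : ∀ φ : L → EuclideanSpace ℝ (Fin N), (∀ l ∉ Ω, φ l = 0) →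
      ∑' l, ⟪hamiltonian R V ψ l, φ l⟫ =
        ∑ l ∈ B, ∑ ρ : R, ⟪stencil R v l ρ, stencil R φ l ρ⟫ := by
    intro φ hφ
    have h1 : ∑' l, ⟪hamiltonian R V ψ l, φ l⟫ = ∑' l, ⟪-latticeDiv R g l, φ l⟫ := by
      refine tsum_congr fun l => ?_
      by_cases h : l ∈ Ω
      · rw [hHψ l h]
      · rw [hφ l h]; simp
    rw [h1, ← tsum_inner_stencil R g φ (finite_support_of_forall_notMem hφ), tsum_eq_sum (s := B)]
    · refine Finset.sum_congr rfl fun l hl => ?_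
      simp only [hg, if_pos hl]
    · intro l hl
      simp [hg, if_neg hl]
  have hQv : Q = latticeDiff (-a) ψ 0 k := by
    have h1 : ∑' l, ⟪hamiltonian R V ψ l, v l⟫ = Q := by
      rw [hpair v hv]
      simp only [real_inner_self_eq_norm_sq, hQ]
    rw [← h1, tsum_inner_hamiltonian_comm hV hψfin hvfin, ← tsum_inner_dipole]
    refine tsum_congr fun l => ?_
    by_cases h : l ∈ Ω
    · rw [hHv l h]
    · rw [hψ l h]; simp
  set W := energyNormSq R ψ with hW
  have hW0 : 0 ≤ W := energyNormSq_nonneg ψ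
  -- Young's inequality 2c₀⟨x,y⟩ ≤ |x|² + c₀²|y|², summed over the ball, lets half of 2c₀²W be
  -- absorbed.
  have hWQ : c₀ ^ 2 * W ≤ Q := by
    have h1 : c₀ * W ≤ ∑ l ∈ B, ∑ ρ : R, ⟪stencil R v l ρ, stencil R ψ l ρ⟫ := by
      rw [← hpair ψ hψ, ← hamiltonianForm_eq_tsum_inner hψfin]
      exact hst.le ψ hψfin
    have h2 : ∀ x y : EuclideanSpace ℝ (Fin N),
        2 * c₀ * ⟪x, y⟫ ≤ ‖x‖ ^ 2 + c₀ ^ 2 * ‖y‖ ^ 2 := by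
      intro x y
      nlinarith [real_inner_le_norm x y, sq_nonneg (‖x‖ - c₀ * ‖y‖)]
    have h3 : 2 * c₀ * ∑ l ∈ B, ∑ ρ : R, ⟪stencil R v l ρ, stencil R ψ l ρ⟫ ≤
        Q + c₀ ^ 2 * ∑ l ∈ B, ∑ ρ : R, ‖stencil R ψ l ρ‖ ^ 2 := by
      rw [hQ]
      simp only [Finset.mul_sum]
      rw [← Finset.sum_add_distrib]
      refine Finset.sum_le_sum fun l _ => ?_
      rw [← Finset.sum_add_distrib]
      exact Finset.sum_le_sum fun ρ _ => h2 _ _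
    have h4 := sum_stencil_sq_le_energyNormSq (R := R) hψfin B
    have h5 : c₀ ^ 2 * ∑ l ∈ B, ∑ ρ : R, ‖stencil R ψ l ρ‖ ^ 2 ≤ c₀ ^ 2 * W := by gcongr
    nlinarith
  have hfar : ∀ l, ‖l - y‖ ≤ 2 * r → 2 * r ≤ ‖l‖ ∧ l ∈ Ω := by
    intro l hl
    constructor
    · have : ‖y‖ ≤ ‖l‖ + ‖l - y‖ := by
        calc ‖y‖ = ‖l - (l - y)‖ := by congr 1; abel
          _ ≤ _ := norm_sub_le _ _
      linarith
    · refine hΩ ?_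
      rw [mem_latticeBall, sub_zero]
      have : ‖l‖ ≤ ‖y‖ + ‖l - y‖ := by
        calc ‖l‖ = ‖y + (l - y)‖ := by congr 1; abel
          _ ≤ _ := norm_add_le _ _
      linarith
  -- The dual source sits near y with |y| = 4r, so ψ is harmonic near the origin and the mean value
  -- bound there makes its difference at 0 small in terms of its energy. This gives the first factor
  -- r^{-d}.
  have hψharm : ∀ l, ‖l - 0‖ ≤ 2 * r → hamiltonian R V ψ l = 0 := by
    intro l hl
    rw [sub_zero] at hl
    rw [hHψ l (hΩ (by rw [mem_latticeBall, sub_zero]; linarith))]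
    have hg0 : ∀ m, ‖m‖ < 3 * r → g m = 0 := by
      intro m hm
      have : m ∉ B := by
        rw [hB, mem_latticeBall, not_le]
        have : ‖y‖ ≤ ‖m‖ + ‖m - y‖ := by
          calc ‖y‖ = ‖m - (m - y)‖ := by congr 1; abel
            _ ≤ _ := norm_sub_le _ _
        linarith
      simp [hg, this]
    have h1 : g l = 0 := hg0 l (by linarith)
    have h2 : ∀ ρ : R, g (l + -(ρ : L)) = 0 := fun ρ => by
      refine hg0 _ ?_
      have := norm_add_le l (-(ρ : L))
      rw [norm_neg] at this
      linarith [hPR ρ ρ.2]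
    simp [latticeDiv, latticeDiff, h1, h2]
  have hdual : r ^ Fintype.card ι * Q ≤ D := by
    have h1 := hMu (latticeDiff (-a) ψ) 0 r hMr
      (hamiltonian_latticeDiff_eq_zero hψharm (by rw [norm_neg]; linarith))
    have h2 := hAu ψ hψfin 0 r
    have h3 : Q ≤ ‖latticeDiff (-a) ψ 0‖ := by
      rw [hQv]
      exact component_le_norm _ k
    exact mul_le_of_duality (by positivity) hQ0 (by linarith) hA hc h3 h1 h2 hWQ
  have hvharm : ∀ l, ‖l - y‖ ≤ 2 * r → hamiltonian R V v l = 0 := by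
    intro l hl
    obtain ⟨h1, h2⟩ := hfar l hl
    rw [hHv l h2, latticeDiff, pointSource_of_ne, pointSource_of_ne, sub_zero]
    · rintro rfl; simp at h1; linarith
    · intro h
      rw [eq_neg_of_add_eq_zero_left h, norm_neg] at h1
      linarith
  -- The field v is harmonic near y, so a second mean value bound, now around y, supplies the other
  -- factor r^{-d} for the squared difference.
  have h1 := hMu (latticeDiff ρ v) y r hMr
    (hamiltonian_latticeDiff_eq_zero hvharm (by linarith [hPR ρ hρ]))
  have h2 : ballEnergy (latticeDiff ρ v) y r ≤ Q := by
    exact Finset.sum_le_sum fun l _ => norm_latticeDiff_sq_le_stencil hρ v l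
  have hM0 : 0 < M := by linarith
  calc (r ^ Fintype.card ι * ‖latticeDiff ρ v y‖) ^ 2
      = r ^ Fintype.card ι * (r ^ Fintype.card ι * ‖latticeDiff ρ v y‖ ^ 2) := by ring
    _ ≤ r ^ Fintype.card ι * (M * Q) := by
        refine mul_le_mul_of_nonneg_left (h1.trans ?_) (by positivity)
        gcongr
    _ = M * (r ^ Fintype.card ι * Q) := by ring
    _ ≤ M * D := by gcongr
    _ ≤ _ := by linarith

end Dirichlet

/-! ### The dipole field on the whole lattice as a limit of Dirichlet solutions. -/

section Dipole

variable {L : Type*} [NormedAddCommGroup L] {N : ℕ} {R : Finset L}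
  {V : (R → EuclideanSpace ℝ (Fin N)) → ℝ}

/-- The dipole field on the whole lattice. -/
theorem exists_dipole {ι : Type*} [Fintype ι] (c : LatticeCoords ι L) [FiniteBalls L]
    [Infinite L] (hR : AddSubgroup.closure (R : Set L) = ⊤) (hV : ContDiff ℝ 2 V) {c₀ : ℝ}
    (hst : FiniteStable R V c₀) (a : L) (k : Fin N) :
    ∃ v : L → EuclideanSpace ℝ (Fin N),
      (∀ l, hamiltonian R V v l = latticeDiff a (pointSource L k) l) ∧
      ∀ b, DecaysLike (fun l => ‖latticeDiff b v l‖) (-(Fintype.card ι : ℤ)) 0 := by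
  choose v hv hHv using fun n : ℕ => exists_dirichlet_solution hR hst (latticeBall (0 : L) n)
    (latticeDiff a (pointSource L k))
  obtain ⟨W, hW, hWv⟩ := dirichlet_dipole_energy hR hst a k
  have hfin : ∀ n, (v n).support.Finite := fun n => finite_support_of_forall_notMem (hv n)
  have henergy : ∀ n, energyNormSq R (v n) ≤ W := fun n => hWv _ _ (hv n) (hHv n)
  have hbdd : ∀ b, ∃ M : ℝ, ∀ n x, ‖latticeDiff b (v n) x‖ ≤ M := by
    intro b
    obtain ⟨A, hA, hAu⟩ := norm_latticeDiff_sq_le (N := N) hR b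
    refine ⟨√(A * W), fun n x => Real.le_sqrt_of_sq_le ((hAu _ (hfin n) x).trans ?_)⟩
    exact mul_le_mul_of_nonneg_left (henergy n) hA.le
  -- Only differences of v n are bounded, so v n 0 is subtracted; the Hamiltonian does not see
  -- constants. A fixed ultrafilter makes all sites converge at once, in place of a diagonal
  -- subsequence.
  have hlim : ∀ l, ∃ z : EuclideanSpace ℝ (Fin N),
      Tendsto (fun n => v n l - v n 0) (hyperfilter ℕ) (𝓝 z) := by
    intro l
    obtain ⟨M, hM⟩ := hbdd l
    obtain ⟨z, -, hz⟩ := (isCompact_closedBall (0 : EuclideanSpace ℝ (Fin N)) M).ultrafilter_le_nhds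
      ((hyperfilter ℕ).map fun n => v n l - v n 0) (by
        rw [le_principal_iff, Ultrafilter.mem_coe, Ultrafilter.mem_map]
        refine univ_mem' fun n => ?_
        have := hM n 0
        simpa [latticeDiff] using this)
    exact ⟨z, hz⟩
  choose w hw using hlim
  have hw' : Tendsto (fun n => v n - fun _ => v n 0) (hyperfilter ℕ) (𝓝 w) :=
    tendsto_pi_nhds.2 hw
  have hle : (hyperfilter ℕ : Filter ℕ) ≤ atTop := Nat.hyperfilter_le_atTop
  have hdiff : ∀ b l, Tendsto (fun n => latticeDiff b (v n) l) (hyperfilter ℕ)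
      (𝓝 (latticeDiff b w l)) := by
    intro b l
    have := (hw (l + b)).sub (hw l)
    simpa only [latticeDiff, sub_sub_sub_cancel_right] using this
  refine ⟨w, fun l => ?_, ?_⟩
  · have h1 := ((hamiltonianCLM R V l).continuous.tendsto w).comp hw'
    refine tendsto_nhds_unique h1 ?_
    refine Tendsto.congr' ?_ tendsto_const_nhds
    have hev : ∀ᶠ n : ℕ in atTop, ‖l‖ ≤ n := eventually_atTop.2 ⟨⌈‖l‖⌉₊, fun n hn =>
      (Nat.le_ceil _).trans (by exact_mod_cast hn)⟩
    filter_upwards [hle hev] with n hn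
    rw [Function.comp_apply, map_sub, hamiltonianCLM_apply, hamiltonianCLM_apply,
      hamiltonian_const, hHv n l (by simpa using hn)]
    simp
  · intro b
    refine DecaysLike.latticeDiff_of_closure hR (fun ρ hρ => ?_) b
    obtain ⟨C, hC, hCv⟩ := dirichlet_dipole_decay c hR hV hst a k
    -- Here r = ‖l‖/4, and ‖l‖ ≥ 2 gives |l|₀ ≤ 2‖l‖ = 8r.
    refine DecaysLike.of_large (C := √C * 8 ^ Fintype.card ι) (r := max (4 * C) 2) fun l hl => ?_
    have hl1 : 4 * C ≤ ‖l‖ := (le_max_left _ _).trans hl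
    have hl2 : 2 ≤ ‖l‖ := (le_max_right _ _).trans hl
    refine le_of_tendsto (hdiff ρ l).norm ?_
    have hev : ∀ᶠ n : ℕ in atTop, 2 * ‖l‖ ≤ n := eventually_atTop.2 ⟨⌈2 * ‖l‖⌉₊, fun n hn =>
      (Nat.le_ceil _).trans (by exact_mod_cast hn)⟩
    filter_upwards [hle hev] with n hn
    have h1 := hCv _ (v n) (hv n) (hHv n) l (‖l‖ / 4) (by ring) (by linarith)
      (latticeBall_subset (by simpa using hn)) ρ hρ
    have h2 := Real.le_sqrt_of_sq_le h1
    have h3 : shiftedNorm l ≤ 8 * (‖l‖ / 4) := by unfold shiftedNorm; linarith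
    have h4 := shiftedNorm_pos l
    simp only [decayRate, pow_zero, mul_one, zpow_neg, zpow_natCast]
    rw [← div_eq_mul_inv, le_div_iff₀ (by positivity)]
    calc ‖latticeDiff ρ (v n) l‖ * shiftedNorm l ^ Fintype.card ι
        ≤ ‖latticeDiff ρ (v n) l‖ * (8 * (‖l‖ / 4)) ^ Fintype.card ι := by gcongr
      _ = ((‖l‖ / 4) ^ Fintype.card ι * ‖latticeDiff ρ (v n) l‖) * 8 ^ Fintype.card ι := by
          rw [mul_pow]; ring
      _ ≤ _ := by gcongr

end Dipole

/-! ### Sums along rays -/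

theorem sum_range_inv_sq_le {X : ℝ} (hX : 2 ≤ X) (n : ℕ) :
    ∑ t ∈ Finset.range n, ((X + t) ^ 2)⁻¹ ≤ 2 / X := by
  have h : ∀ n : ℕ, ∑ t ∈ Finset.range n, ((X + t) ^ 2)⁻¹ ≤ 1 / (X - 1) - 1 / (X - 1 + n) := by
    intro n
    induction n with
    | zero => simp
    | succ n ih =>
      rw [Finset.sum_range_succ]
      have hn : (0 : ℝ) ≤ n := n.cast_nonneg
      have h1 : ((X + n) ^ 2)⁻¹ ≤ 1 / (X - 1 + n) - 1 / (X - 1 + (n + 1 : ℕ)) := by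
        push_cast
        rw [div_sub_div _ _ (by linarith) (by linarith), inv_eq_one_div,
          div_le_div_iff₀ (by positivity) (by nlinarith)]
        nlinarith
      linarith
  refine (h n).trans ?_
  have h2 : (0 : ℝ) ≤ 1 / (X - 1 + n) := by
    have hn : (0 : ℝ) ≤ n := n.cast_nonneg
    exact div_nonneg zero_le_one (by linarith)
  have h3 : 1 / (X - 1) ≤ 2 / X := by
    rw [div_le_div_iff₀ (by linarith) (by linarith)]; linarith
  linarith

theorem sum_range_zpow_le {X : ℝ} (hX : 2 ≤ X) {d : ℕ} (hd : 2 ≤ d) (n : ℕ) :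
    ∑ t ∈ Finset.range n, (X + t) ^ (-(d : ℤ)) ≤ 2 * X ^ (1 - (d : ℤ)) := by
  have hX0 : 0 < X := by linarith
  have h1 : ∀ t : ℕ, (X + t) ^ (-(d : ℤ)) ≤ X ^ (2 - (d : ℤ)) * ((X + t) ^ 2)⁻¹ := by
    intro t
    have ht : (0 : ℝ) ≤ t := t.cast_nonneg
    have e : -(d : ℤ) = (2 - (d : ℤ)) + -2 := by ring
    rw [e, zpow_add₀ (by positivity), ← zpow_natCast (X + t) 2, ← zpow_neg]
    push_cast
    refine mul_le_mul_of_nonneg_right ?_ (by positivity)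
    obtain ⟨m, rfl⟩ := Nat.exists_eq_add_of_le hd
    rw [show (2 : ℤ) - ((2 + m : ℕ) : ℤ) = -(m : ℤ) by push_cast; ring, zpow_neg, zpow_neg,
      zpow_natCast, zpow_natCast]
    gcongr
    linarith
  refine (Finset.sum_le_sum fun t _ => h1 t).trans ?_
  rw [← Finset.mul_sum]
  refine (mul_le_mul_of_nonneg_left (sum_range_inv_sq_le hX n) (by positivity)).trans ?_
  rw [show (1 - (d : ℤ)) = (2 - (d : ℤ)) - 1 by ring, zpow_sub_one₀ hX0.ne']
  apply le_of_eq
  field_simp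

namespace LatticeCoords

variable {ι L : Type*} [Fintype ι] [NormedAddCommGroup L] (c : LatticeCoords ι L)

/-- The coordinates with respect to the opposite basis. -/
def neg : LatticeCoords ι L where
  equiv := c.equiv.trans (AddEquiv.neg (ι → ℤ))
  lower := c.lower
  lower_pos := c.lower_pos
  lower_le l i := by simpa using c.lower_le l i

theorem neg_equiv (l : L) (i : ι) : c.neg.equiv l i = -c.equiv l i := rfl

theorem neg_vec (i : ι) : c.neg.vec i = -c.vec i := by
  classical
  apply c.equiv.injective
  have h : ∀ j, -c.equiv (c.neg.vec i) j = c.neg.equiv (c.neg.vec i) j := fun j => rfl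
  funext j
  have := h j
  rw [equiv_vec] at this
  rw [map_neg, equiv_vec, Pi.neg_apply, ← this, neg_neg]

theorem norm_le (l : L) : ‖l‖ ≤ ∑ i, |(c.equiv l i : ℝ)| * ‖c.vec i‖ := by
  conv_lhs => rw [c.eq_sum_vec l]
  refine (norm_sum_le _ _).trans (Finset.sum_le_sum fun i _ => ?_)
  refine (norm_zsmul_le _ _).trans (le_of_eq ?_)
  rw [Int.norm_eq_abs]

/-- If the i-th coordinate of l is not positive, subtracting multiples of the i-th basis vector only
increases its absolute value. Hence l and the step along the ray cannot cancel, and the norm grows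
at least linearly in t. -/
theorem exists_ray_bound (i : ι) : ∃ κ : ℝ, 0 < κ ∧ ∀ (l : L) (t : ℕ), c.equiv l i ≤ 0 →
    κ * (shiftedNorm l + t) ≤ shiftedNorm (l - t • c.vec i) := by
  classical
  set B := ∑ j, ‖c.vec j‖ with hB
  have hB0 : 0 ≤ B := Finset.sum_nonneg fun _ _ => norm_nonneg _
  have hc := c.lower_pos
  set Q := (B + 1) / c.lower + 1 with hQ
  have hQ0 : 0 < Q := by positivity
  refine ⟨1 / Q, by positivity, fun l t hl => ?_⟩
  set Y := ‖l - t • c.vec i‖ with hY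
  have hcoord : ∀ j, c.equiv (l - t • c.vec i) j = c.equiv l j - t * (if i = j then 1 else 0) := by
    intro j
    rw [map_sub, map_nsmul, equiv_vec]
    by_cases h : i = j
    · subst h; simp
    · simp [h, Ne.symm h]
  have h1 : ∀ j, c.lower * |(c.equiv l j : ℝ)| ≤ Y := by
    intro j
    refine le_trans (mul_le_mul_of_nonneg_left ?_ hc.le) (c.lower_le (l - t • c.vec i) j)
    rw [hcoord]
    by_cases h : i = j
    · subst h
      have h0 : (c.equiv l i : ℝ) ≤ 0 := by exact_mod_cast hl
      have ht : (0 : ℝ) ≤ t := t.cast_nonneg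
      push_cast
      simp only [if_true, mul_one]
      rw [abs_of_nonpos h0, abs_of_nonpos (by linarith)]
      linarith
    · simp [h]
  have h2 : c.lower * t ≤ Y := by
    refine le_trans (mul_le_mul_of_nonneg_left ?_ hc.le) (c.lower_le (l - t • c.vec i) i)
    rw [hcoord]
    have h0 : (c.equiv l i : ℝ) ≤ 0 := by exact_mod_cast hl
    have ht : (0 : ℝ) ≤ t := t.cast_nonneg
    push_cast
    simp only [if_true, mul_one]
    rw [abs_of_nonpos (by linarith)]
    linarith
  have h3 : c.lower * ‖l‖ ≤ B * Y := by
    refine (mul_le_mul_of_nonneg_left (c.norm_le l) hc.le).trans ?_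
    rw [hB, Finset.mul_sum, Finset.sum_mul]
    refine Finset.sum_le_sum fun j _ => ?_
    rw [← mul_assoc, mul_comm ‖c.vec j‖]
    exact mul_le_mul_of_nonneg_right (h1 j) (norm_nonneg _)
  have hY0 : 0 ≤ Y := norm_nonneg _
  rw [one_div, inv_mul_le_iff₀ hQ0]
  unfold shiftedNorm
  rw [← hY]
  have h4 : (B + 1) / c.lower * Y ≥ ‖l‖ + t := by
    rw [ge_iff_le, div_mul_eq_mul_div, le_div_iff₀ hc]
    linarith
  have h5 : 0 ≤ (B + 1) / c.lower := by positivity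
  rw [hQ]
  nlinarith

theorem exists_ray_sum_bound (hd : 2 ≤ Fintype.card ι) (i : ι) {h : L → ℝ}
    (hh : DecaysLike h (-(Fintype.card ι : ℤ)) 0) :
    ∃ C : ℝ, 0 < C ∧ ∀ (l : L), c.equiv l i ≤ 0 → ∀ n,
      ∑ t ∈ Finset.range n, h (l - t • c.vec i) ≤ C * shiftedNorm l ^ (1 - (Fintype.card ι : ℤ)) := by
  obtain ⟨κ, hκ, hray⟩ := c.exists_ray_bound i
  obtain ⟨C, hC, hCh⟩ := decaysLike_iff.1 hh
  refine ⟨C * κ ^ (-(Fintype.card ι : ℤ)) * 2, by positivity, fun l hl n => ?_⟩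
  have h1 : ∀ t ∈ Finset.range n, h (l - t • c.vec i) ≤
      C * κ ^ (-(Fintype.card ι : ℤ)) * (shiftedNorm l + t) ^ (-(Fintype.card ι : ℤ)) := by
    intro t _
    refine (hCh _).trans ?_
    rw [mul_assoc, ← mul_zpow, decayRate, pow_zero, mul_one]
    refine mul_le_mul_of_nonneg_left ?_ hC.le
    have hp := shiftedNorm_pos l
    have h2 : 0 < κ * (shiftedNorm l + t) := by positivity
    simp only [zpow_neg, zpow_natCast]
    exact inv_anti₀ (by positivity) (pow_le_pow_left₀ h2.le (hray l t hl) _)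
  refine (Finset.sum_le_sum h1).trans ?_
  rw [← Finset.mul_sum, mul_assoc _ 2]
  exact mul_le_mul_of_nonneg_left (sum_range_zpow_le (two_le_shiftedNorm l) hd n) (by positivity)

end LatticeCoords

section RayPotential

variable {ι L E : Type*} [Fintype ι] [NormedAddCommGroup L] [NormedAddCommGroup E]

/-- The renormalized sum of the translates of `v` along a ray. -/
noncomputable def rayPotential (e : L) (v : L → E) (l : L) : E :=
  ∑' t : ℕ, (v (l - t • e) - v (-(t • e)))

variable [CompleteSpace E] (c : LatticeCoords ι L) (hd : 2 ≤ Fintype.card ι) (i : ι) {v : L → E}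
  (hv : ∀ b, DecaysLike (fun l => ‖latticeDiff b v l‖) (-(Fintype.card ι : ℤ)) 0)

include hd hv

omit [CompleteSpace E] in
-- After finitely many steps any ray enters the half-space in which `exists_ray_sum_bound` applies.
theorem summable_ray (b l : L) : Summable fun t : ℕ => ‖latticeDiff b v (l - t • c.vec i)‖ := by
  obtain ⟨C, hC, h⟩ := c.exists_ray_sum_bound hd i (hv b)
  obtain ⟨m, hm⟩ : ∃ m : ℕ, c.equiv l i ≤ m := ⟨_, Int.self_le_toNat _⟩
  rw [← summable_nat_add_iff m]
  have hl : c.equiv (l - m • c.vec i) i ≤ 0 := by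
    classical
    rw [map_sub, map_nsmul, c.equiv_vec]
    simpa using hm
  refine summable_of_sum_range_le (c := C * shiftedNorm (l - m • c.vec i) ^ (1 - (Fintype.card ι : ℤ)))
    (fun _ => norm_nonneg _) fun n => ?_
  refine le_trans (le_of_eq ?_) (h (l - m • c.vec i) hl n)
  refine Finset.sum_congr rfl fun t _ => ?_
  rw [add_smul, add_comm, sub_sub]

/-- The subtracted term turns the summand into the difference D_l v at -te, which is of order t^{-d}
and thus summable as d ≥ 2. Differences of the potential are unaffected by this normalization. -/
theorem hasSum_rayPotential (l : L) :
    HasSum (fun t : ℕ => v (l - t • c.vec i) - v (-(t • c.vec i))) (rayPotential (c.vec i) v l) := by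
  have h := (summable_ray c hd i hv l 0).of_norm
  have e : (fun t : ℕ => latticeDiff l v (0 - t • c.vec i)) =
      fun t : ℕ => v (l - t • c.vec i) - v (-(t • c.vec i)) := by
    funext t
    rw [latticeDiff_apply, zero_sub, neg_add_eq_sub]
  rw [e] at h
  exact h.hasSum

theorem hasSum_latticeDiff_rayPotential (b l : L) :
    HasSum (fun t : ℕ => latticeDiff b v (l - t • c.vec i))
      (latticeDiff b (rayPotential (c.vec i) v) l) := by
  have h := (hasSum_rayPotential c hd i hv (l + b)).sub (hasSum_rayPotential c hd i hv l)
  refine h.congr_fun fun t => ?_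
  rw [latticeDiff_apply, sub_sub_sub_cancel_right, sub_add_eq_add_sub]

theorem rayPotential_halfspace_bound (b : L) : ∃ C : ℝ, 0 < C ∧ ∀ l, c.equiv l i ≤ 0 →
    ‖latticeDiff b (rayPotential (c.vec i) v) l‖ ≤
      C * shiftedNorm l ^ (1 - (Fintype.card ι : ℤ)) := by
  obtain ⟨C, hC, h⟩ := c.exists_ray_sum_bound hd i (hv b)
  refine ⟨C, hC, fun l hl => ?_⟩
  rw [← (hasSum_latticeDiff_rayPotential c hd i hv b l).tsum_eq]
  refine (norm_tsum_le_tsum_norm (summable_ray c hd i hv b l)).trans ?_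
  exact (summable_ray c hd i hv b l).tsum_le_of_sum_range_le (h l hl)

theorem latticeDiff_rayPotential_step (b l : L) :
    latticeDiff b (rayPotential (c.vec i) v) (l + c.vec i) =
      latticeDiff b v (l + c.vec i) + latticeDiff b (rayPotential (c.vec i) v) l := by
  have h1 := hasSum_latticeDiff_rayPotential c hd i hv b (l + c.vec i)
  have h2 := hasSum_latticeDiff_rayPotential c hd i hv b l
  rw [← h1.tsum_eq, ← h2.tsum_eq, h1.summable.tsum_eq_zero_add]
  simp only [zero_smul, sub_zero]
  congr 2
  funext t
  rw [add_smul, one_smul]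
  congr 1
  abel

/-- On the bad side of the hyperplane one walks from the hyperplane to l. The terms collected on the
way form a ray sum for the opposite basis vector, which is bounded. No decay results on that side,
but boundedness is all that Liouville's theorem requires. -/
theorem rayPotential_bounded (b : L) : ∃ M : ℝ, ∀ l,
    ‖latticeDiff b (rayPotential (c.vec i) v) l‖ ≤ M := by
  classical
  obtain ⟨C, hC, h⟩ := rayPotential_halfspace_bound c hd i hv b
  obtain ⟨D, hD, h'⟩ := c.neg.exists_ray_sum_bound hd i (hv b)
  have hone : ∀ l : L, shiftedNorm l ^ (1 - (Fintype.card ι : ℤ)) ≤ 1 := fun l =>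
    zpow_le_one_of_nonpos₀ (by linarith [two_le_shiftedNorm l]) (by omega)
  refine ⟨C + D, fun l => ?_⟩
  rcases le_or_gt (c.equiv l i) 0 with hl | hl
  · refine (h l hl).trans ?_
    have := mul_le_mul_of_nonneg_left (hone l) hC.le
    linarith
  · obtain ⟨m, hm⟩ : ∃ m : ℕ, c.equiv l i = m := ⟨_, (Int.toNat_of_nonneg hl.le).symm⟩
    set l₀ := l - m • c.vec i with hl₀
    have hl₀0 : c.equiv l₀ i = 0 := by
      rw [hl₀, map_sub, map_nsmul, c.equiv_vec]
      simp [hm]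
    have hstep : ∀ n : ℕ, ‖latticeDiff b (rayPotential (c.vec i) v) (l₀ + n • c.vec i)‖ ≤
        ‖latticeDiff b (rayPotential (c.vec i) v) l₀‖ +
          ∑ t ∈ Finset.range n, ‖latticeDiff b v (l₀ + (t + 1) • c.vec i)‖ := by
      intro n
      induction n with
      | zero => simp
      | succ n ih =>
        rw [Finset.sum_range_succ, add_smul, one_smul, ← add_assoc,
          latticeDiff_rayPotential_step c hd i hv]
        refine (norm_add_le _ _).trans ?_
        linarith
    have h1 := hstep m
    rw [hl₀, sub_add_cancel, ← hl₀] at h1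
    have h2 : ∑ t ∈ Finset.range m, ‖latticeDiff b v (l₀ + (t + 1) • c.vec i)‖ ≤
        ∑ t ∈ Finset.range (m + 1), ‖latticeDiff b v (l₀ - t • c.neg.vec i)‖ := by
      rw [Finset.sum_range_succ']
      simp only [c.neg_vec, smul_neg, sub_neg_eq_add]
      linarith [norm_nonneg (latticeDiff b v (l₀ + 0 • c.vec i))]
    have h3 := h' l₀ (by rw [c.neg_equiv, hl₀0, neg_zero]) (m + 1)
    have h4 := h l₀ hl₀0.le
    have h5 := mul_le_mul_of_nonneg_left (hone l₀) hC.le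
    have h6 := mul_le_mul_of_nonneg_left (hone l₀) hD.le
    linarith

end RayPotential

theorem hasSum_hamiltonian_rayPotential {ι L : Type*} [Fintype ι] [NormedAddCommGroup L] {N : ℕ}
    (R : Finset L) (V : (R → EuclideanSpace ℝ (Fin N)) → ℝ) (c : LatticeCoords ι L)
    (hd : 2 ≤ Fintype.card ι) (i : ι) {v : L → EuclideanSpace ℝ (Fin N)}
    (hv : ∀ b, DecaysLike (fun l => ‖latticeDiff b v l‖) (-(Fintype.card ι : ℤ)) 0) (l : L) :
    HasSum (fun t : ℕ => hamiltonian R V v (l - t • c.vec i))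
      (hamiltonian R V (rayPotential (c.vec i) v) l) := by
  have h : HasSum (fun (t : ℕ) (l : L) => v (l - t • c.vec i) - v (-(t • c.vec i)))
      (rayPotential (c.vec i) v) :=
    Pi.hasSum.2 fun l => hasSum_rayPotential c hd i hv l
  have h2 := (hamiltonianCLM R V l).hasSum h
  refine h2.congr_fun fun t => ?_
  have e : (fun l : L => v (l - t • c.vec i) - v (-(t • c.vec i))) =
      (fun l : L => v (l - t • c.vec i)) - fun _ => v (-(t • c.vec i)) := rfl
  rw [e, map_sub, hamiltonianCLM_apply, hamiltonianCLM_apply, hamiltonian_const,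
    hamiltonian_shift_sub]
  simp

/-! ### Decay of differences of fields that are harmonic away from the origin. -/

section HarmonicDecay

variable {ι L : Type*} [Fintype ι] [NormedAddCommGroup L] [FiniteBalls L] {N : ℕ} {R : Finset L}
  {V : (R → EuclideanSpace ℝ (Fin N)) → ℝ}

/-- On the ball of radius ‖y‖/2 around a distant y the field is harmonic and of size |y|₀^a, so the
gradient estimate gains one power of ‖y‖. The sign of a ensures that the rate at half the distance
bounds the rate on the whole ball. -/
theorem latticeDiff_decay_of_harmonic (c : LatticeCoords ι L)
    (hR : AddSubgroup.closure (R : Set L) = ⊤) (hV : ContDiff ℝ 2 V) {c₀ : ℝ}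
    (hst : FiniteStable R V c₀) {u : L → EuclideanSpace ℝ (Fin N)} {r₀ : ℝ}
    (hu : ∀ l, r₀ ≤ ‖l‖ → hamiltonian R V u l = 0) {a : ℤ} (ha : a ≤ 0)
    (hdec : DecaysLike (fun l => ‖u l‖) a 0) (b : L) :
    DecaysLike (fun l => ‖latticeDiff b u l‖) (a - 1) 0 := by
  obtain ⟨C, hC, hCu⟩ := decaysLike_iff.1 hdec
  obtain ⟨D, hD, hDu⟩ := gradient_estimate c hR hV hst b
  refine DecaysLike.of_large (C := D * (C * (1 / 2) ^ a) * 4)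
    (r := max (max (2 * r₀) (2 * D)) 2) fun y hy => ?_
  have hy1 : 2 * r₀ ≤ ‖y‖ := ((le_max_left _ _).trans (le_max_left _ _)).trans hy
  have hy2 : 2 * D ≤ ‖y‖ := ((le_max_right _ _).trans (le_max_left _ _)).trans hy
  have hy3 : 2 ≤ ‖y‖ := (le_max_right _ _).trans hy
  have hs := shiftedNorm_pos y
  have hfar : ∀ l, ‖l - y‖ ≤ ‖y‖ / 2 → ‖y‖ / 2 ≤ ‖l‖ := by
    intro l hl
    have : ‖y‖ ≤ ‖l‖ + ‖l - y‖ := by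
      calc ‖y‖ = ‖l - (l - y)‖ := by congr 1; abel
        _ ≤ _ := norm_sub_le _ _
    linarith
  have h1 := hDu u y (‖y‖ / 2) (C * (1 / 2 * shiftedNorm y) ^ a) (by linarith)
    (fun l hl => hu l (by linarith [hfar l hl])) (fun l hl => by
      refine (hCu l).trans ?_
      rw [decayRate, pow_zero, mul_one]
      refine mul_le_mul_of_nonneg_left ?_ hC.le
      have h2 : 1 / 2 * shiftedNorm y ≤ shiftedNorm l := by
        have := hfar l hl
        unfold shiftedNorm
        linarith
      obtain ⟨m, rfl⟩ : ∃ m : ℕ, a = -(m : ℤ) := ⟨a.natAbs, by omega⟩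
      simp only [zpow_neg, zpow_natCast]
      exact inv_anti₀ (by positivity) (pow_le_pow_left₀ (by positivity) h2 m))
  refine h1.trans ?_
  rw [decayRate, pow_zero, mul_one, zpow_sub_one₀ hs.ne', mul_zpow,
    div_le_iff₀ (by linarith)]
  have h3 : shiftedNorm y ≤ 2 * ‖y‖ := by unfold shiftedNorm; linarith
  have hX : 0 ≤ D * (C * (1 / 2 : ℝ) ^ a) * shiftedNorm y ^ a := by positivity
  calc D * (C * ((1 / 2) ^ a * shiftedNorm y ^ a))
      = D * (C * (1 / 2) ^ a) * shiftedNorm y ^ a * 1 := by ring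
    _ ≤ D * (C * (1 / 2) ^ a) * shiftedNorm y ^ a * (2 * ‖y‖ * (shiftedNorm y)⁻¹) := by
        refine mul_le_mul_of_nonneg_left ?_ hX
        rw [← div_eq_mul_inv, le_div_iff₀ hs]
        linarith
    _ = _ := by ring

omit [FiniteBalls L] in
theorem listDiff_pointSource_of_large (t : List L) (k : Fin N) :
    ∃ r₀ : ℝ, ∀ l, r₀ ≤ ‖l‖ → listDiff t (pointSource L k) l = 0 := by
  induction t with
  | nil =>
    refine ⟨1, fun l hl => pointSource_of_ne ?_⟩
    rintro rfl
    norm_num at hl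
  | cons b t ih =>
    obtain ⟨r₀, h⟩ := ih
    refine ⟨r₀ + ‖b‖, fun l hl => ?_⟩
    rw [listDiff_cons, latticeDiff, h, h, sub_zero]
    · linarith [norm_nonneg b]
    · have : ‖l‖ ≤ ‖l + b‖ + ‖b‖ := by
        calc ‖l‖ = ‖(l + b) - b‖ := by congr 1; abel
          _ ≤ _ := norm_sub_le _ _
      linarith

theorem listDiff_decay_of_fundamental (c : LatticeCoords ι L)
    (hR : AddSubgroup.closure (R : Set L) = ⊤) (hV : ContDiff ℝ 2 V) {c₀ : ℝ}
    (hst : FiniteStable R V c₀) (hd : 1 ≤ Fintype.card ι) {k : Fin N}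
    {u : L → EuclideanSpace ℝ (Fin N)} (hu : hamiltonian R V u = pointSource L k)
    (hdec : ∀ b, DecaysLike (fun l => ‖latticeDiff b u l‖) (1 - (Fintype.card ι : ℤ)) 0)
    (t : List L) (ht : 1 ≤ t.length) :
    DecaysLike (fun l => ‖listDiff t u l‖) (2 - (Fintype.card ι : ℤ) - t.length) 0 := by
  induction t with
  | nil => simp at ht
  | cons b t ih =>
    cases t with
    | nil =>
      have := hdec b
      simp only [listDiff_cons, listDiff_nil, List.length_singleton]
      convert this using 1
      push_cast
      ring
    | cons b' t =>
      have h1 := ih (by simp)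
      obtain ⟨r₀, hr₀⟩ := listDiff_pointSource_of_large (b' :: t) k
      rw [listDiff_cons]
      have := latticeDiff_decay_of_harmonic c hR hV hst (u := listDiff (b' :: t) u) (r₀ := r₀)
        (fun l hl => by rw [hamiltonian_listDiff, hu, hr₀ l hl]) (by simp; omega) h1 b
      convert this using 1
      simp only [List.length_cons]
      push_cast
      ring

end HarmonicDecay

/-! ### The Green's function as a telescoping sum of dipoles. -/

theorem eq_of_hasSum_telescope {E : Type*} [NormedAddCommGroup E] {f b : ℕ → E} {s : E}
    (hf : HasSum f s) (h : ∀ t, f t = b t - b (t + 1)) {m : ℕ} (hb : ∀ t, m ≤ t → b t = 0) :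
    s = b 0 := by
  refine tendsto_nhds_unique hf.tendsto_sum_nat ?_
  refine Tendsto.congr' ?_ tendsto_const_nhds
  filter_upwards [eventually_ge_atTop m] with n hn
  simp only [h]
  rw [Finset.sum_range_sub', hb n hn, sub_zero]

section Green

variable {ι L : Type*} [Fintype ι] [NormedAddCommGroup L] [FiniteBalls L] {N : ℕ} {R : Finset L}
  {V : (R → EuclideanSpace ℝ (Fin N)) → ℝ}

omit [FiniteBalls L] in
theorem LatticeCoords.exists_pointSource_ray_eq_zero (c : LatticeCoords ι L) (i : ι) (k : Fin N)
    (l : L) : ∃ m : ℕ, ∀ t : ℕ, m ≤ t → pointSource L k (l - t • c.vec i) = 0 := by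
  classical
  refine ⟨(c.equiv l i).toNat + 1, fun t ht => pointSource_of_ne fun h => ?_⟩
  have h1 : c.equiv (l - t • c.vec i) i = 0 := by rw [h, map_zero]; rfl
  rw [map_sub, map_nsmul, c.equiv_vec] at h1
  simp at h1
  omega

/-- Two candidates are built from the same dipole: u from one ray, M from the opposite one, with
H[u] = -H[M] the point source. D_b(u + M) is harmonic and bounded, hence constant; both terms decay
along the separating hyperplane, which is unbounded because d ≥ 2, so the constant is zero. Each
half-space then uses the candidate that decays there. -/
theorem exists_fundamental_solution (c : LatticeCoords ι L) (hd : 2 ≤ Fintype.card ι)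
    (hR : AddSubgroup.closure (R : Set L) = ⊤) (hV : ContDiff ℝ 2 V) {c₀ : ℝ}
    (hst : FiniteStable R V c₀) (k : Fin N) :
    ∃ u : L → EuclideanSpace ℝ (Fin N), hamiltonian R V u = pointSource L k ∧
      ∀ b, DecaysLike (fun l => ‖latticeDiff b u l‖) (1 - (Fintype.card ι : ℤ)) 0 := by
  classical
  obtain ⟨i, i', hii⟩ := Fintype.exists_pair_of_one_lt_card (α := ι) (by omega)
  have : Nonempty ι := ⟨i⟩
  have : Infinite L := c.equiv.toEquiv.infinite_iff.2 inferInstance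
  set e := c.vec i with he
  obtain ⟨v, hHv, hv⟩ := exists_dipole c hR hV hst e k
  set P := rayPotential e v with hP
  set M := rayPotential (c.neg.vec i) v with hM
  -- The sources of P telescope to the point source evaluated at l + e, so the shift by e recentres
  -- it at the origin. The opposite ray needs no shift.
  set u : L → EuclideanSpace ℝ (Fin N) := fun l => P (l - e) with hu
  have hHu : hamiltonian R V u = pointSource L k := by
    funext l
    rw [hu, hamiltonian_shift_sub]
    have h1 := hasSum_hamiltonian_rayPotential R V c hd i hv (l - e)
    obtain ⟨m, hm⟩ := c.exists_pointSource_ray_eq_zero i k l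
    have h2 := eq_of_hasSum_telescope h1 (b := fun t => pointSource L k (l - t • e)) (fun t => by
      rw [hHv, latticeDiff_apply]
      congr 2
      · abel
      · rw [add_smul, one_smul]; abel) hm
    simpa using h2
  have hHM : hamiltonian R V M = -pointSource L k := by
    funext l
    have h1 := hasSum_hamiltonian_rayPotential R V c.neg hd i hv l
    obtain ⟨m, hm⟩ := c.neg.exists_pointSource_ray_eq_zero i k l
    have h2 := eq_of_hasSum_telescope h1
      (b := fun t => -pointSource L k (l - t • c.neg.vec i)) (fun t => by
      rw [hHv, latticeDiff_apply, sub_neg_eq_add, neg_add_eq_sub, c.neg_vec]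
      congr 2
      rw [add_smul, one_smul, he]; simp only [smul_neg]; abel) (fun t ht => by rw [hm t ht, neg_zero])
    simpa using h2
  obtain ⟨BP, hBP⟩ : ∃ B : L → ℝ, ∀ b l, ‖latticeDiff b P l‖ ≤ B b := by
    choose B hB using fun b => rayPotential_bounded c hd i hv b
    exact ⟨B, hB⟩
  obtain ⟨BM, hBM⟩ : ∃ B : L → ℝ, ∀ b l, ‖latticeDiff b M l‖ ≤ B b := by
    choose B hB using fun b => rayPotential_bounded c.neg hd i hv b
    exact ⟨B, hB⟩
  have hDu : ∀ b l, latticeDiff b u l = latticeDiff b P (l - e) := by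
    intro b l
    simp only [hu, latticeDiff, sub_add_eq_add_sub]
  refine ⟨u, hHu, fun b => ?_⟩
  obtain ⟨CP, hCP, hPb⟩ := rayPotential_halfspace_bound c hd i hv b
  obtain ⟨CM, hCM, hMb⟩ := rayPotential_halfspace_bound c.neg hd i hv b
  obtain ⟨K, hK, hKb⟩ := decayRate_le_of_comparable (L := L) (1 - (Fintype.card ι : ℤ)) 0
    (K := 1 + ‖e‖) (by linarith [norm_nonneg e])
  simp only [decayRate, pow_zero, mul_one] at hKb
  have hub : ∀ l, c.equiv l i ≤ 1 → ‖latticeDiff b u l‖ ≤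
      CP * K * shiftedNorm l ^ (1 - (Fintype.card ι : ℤ)) := by
    intro l hl
    rw [hDu]
    refine (hPb (l - e) ?_).trans ?_
    · rw [map_sub, he, c.equiv_vec]; simpa using hl
    · rw [mul_assoc]
      refine mul_le_mul_of_nonneg_left (hKb _ _ ?_ ?_) hCP.le
      · simpa [sub_eq_add_neg] using shiftedNorm_add_le l (-e)
      · simpa [sub_eq_add_neg] using le_shiftedNorm_add l (-e)
  have hMb' : ∀ l, 0 ≤ c.equiv l i → ‖latticeDiff b M l‖ ≤
      CM * shiftedNorm l ^ (1 - (Fintype.card ι : ℤ)) := fun l hl =>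
    hMb l (by rw [c.neg_equiv]; omega)
  set w := latticeDiff b (u + M) with hw
  have hwapp : ∀ l, w l = latticeDiff b u l + latticeDiff b M l := by
    intro l; simp only [hw, latticeDiff, Pi.add_apply]; abel
  have hwconst : ∀ l, w l = w 0 := by
    intro l
    have := latticeDiff_eq_zero_of_bounded c hR hV hst (u := w) (M := BP b + BM b) (fun l => by
      rw [hw, hamiltonian_latticeDiff, hamiltonian_add, hHu, hHM]
      simp [latticeDiff]) (fun l => by
      rw [hwapp, hDu]
      exact (norm_add_le _ _).trans (add_le_add (hBP _ _) (hBM _ _))) l 0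
    rw [latticeDiff, zero_add] at this
    exact sub_eq_zero.1 this
  -- The constant is evaluated at multiples of a second basis vector: their i-th coordinate is zero,
  -- so both half-space bounds hold there and tend to zero.
  have hw0 : w 0 = 0 := by
    have hc := c.lower_pos
    have h1 : ∀ s : ℕ, ‖w 0‖ ≤ (CP * K + CM) / (2 + c.lower * s) := by
      intro s
      have hi : c.equiv (s • c.vec i') i = 0 := by
        rw [map_nsmul, c.equiv_vec]; simp [hii]
      have h2 : c.lower * s ≤ ‖s • c.vec i'‖ := by
        have := c.lower_le (s • c.vec i') i'
        rw [map_nsmul, c.equiv_vec] at this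
        simpa using this
      have h3 : shiftedNorm (s • c.vec i') ^ (1 - (Fintype.card ι : ℤ)) ≤
          1 / (2 + c.lower * s) := by
        have hX := two_le_shiftedNorm (s • c.vec i')
        refine (zpow_le_zpow_right₀ (by linarith) (show (1 - (Fintype.card ι : ℤ)) ≤ -1 by omega)).trans ?_
        rw [zpow_neg_one, ← one_div]
        have hs : (0 : ℝ) ≤ s := s.cast_nonneg
        refine one_div_le_one_div_of_le (by positivity) ?_
        unfold shiftedNorm
        linarith
      rw [← hwconst (s • c.vec i'), hwapp]
      refine (norm_add_le _ _).trans ((add_le_add (hub _ (by omega)) (hMb' _ hi.ge)).trans ?_)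
      rw [← add_mul, div_eq_mul_one_div]
      exact mul_le_mul_of_nonneg_left h3 (by positivity)
    have h2 : Tendsto (fun s : ℕ => (CP * K + CM) / (2 + c.lower * s)) atTop (𝓝 0) := by
      refine tendsto_const_nhds.div_atTop (tendsto_atTop_add_const_left _ _ ?_)
      exact tendsto_natCast_atTop_atTop.const_mul_atTop hc
    have h3 := ge_of_tendsto' h2 h1
    simpa using h3
  rw [decaysLike_iff]
  refine ⟨CP * K + CM, by positivity, fun l => ?_⟩
  simp only [decayRate, pow_zero, mul_one]
  have hp := zpow_pos (shiftedNorm_pos l) (1 - (Fintype.card ι : ℤ))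
  have hp1 : 0 ≤ CP * K * shiftedNorm l ^ (1 - (Fintype.card ι : ℤ)) := by positivity
  have hp2 : 0 ≤ CM * shiftedNorm l ^ (1 - (Fintype.card ι : ℤ)) := by positivity
  rcases le_total (c.equiv l i) 0 with hl | hl
  · linarith [hub l (by omega)]
  · have h1 : latticeDiff b u l = -latticeDiff b M l := by
      rw [eq_neg_iff_add_eq_zero, ← hwapp, hwconst, hw0]
    rw [h1, norm_neg]
    linarith [hMb' l hl]

theorem exists_latticeGreensFunction (c : LatticeCoords ι L) (hd : 2 ≤ Fintype.card ι)
    (hR : AddSubgroup.closure (R : Set L) = ⊤) (hV : ContDiff ℝ 2 V) {c₀ : ℝ}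
    (hst : FiniteStable R V c₀) :
    ∃ G : L → Matrix (Fin N) (Fin N) ℝ, IsLatticeGreensFunction (Fintype.card ι) R V G := by
  choose u hu hdec using fun k => exists_fundamental_solution c hd hR hV hst k
  have hcol : ∀ k, matrixColumn (fun l => Matrix.of fun i k => u k l i) k = u k := fun k => rfl
  refine ⟨fun l => Matrix.of fun i k => u k l i, ?_, ?_⟩
  · intro k l
    rw [hcol, hu]
    rfl
  · intro j hj k
    rw [hcol]
    refine DecaysLike.normIterStencil fun t ht => ?_
    subst ht
    exact listDiff_decay_of_fundamental c hR hV hst (by omega) (hu k) (hdec k) t hj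

end Green

/-! ### Radial sums -/

section RadialSums

variable {ι L : Type*} [Fintype ι] [NormedAddCommGroup L]

/-- The dyadic scale of a lattice point. -/
noncomputable def dyadicScale (m : L) : ℕ := Nat.log 2 ⌊shiftedNorm m⌋₊

theorem two_pow_dyadicScale_le (m : L) : (2 : ℝ) ^ dyadicScale m ≤ shiftedNorm m := by
  have h1 : 2 ≤ ⌊shiftedNorm m⌋₊ := Nat.le_floor (by simpa using two_le_shiftedNorm m)
  have h2 := Nat.pow_log_le_self 2 (show ⌊shiftedNorm m⌋₊ ≠ 0 by omega)
  calc (2 : ℝ) ^ dyadicScale m ≤ ⌊shiftedNorm m⌋₊ := by exact_mod_cast h2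
    _ ≤ _ := Nat.floor_le (shiftedNorm_pos m).le

theorem lt_two_pow_dyadicScale (m : L) : shiftedNorm m < (2 : ℝ) ^ (dyadicScale m + 1) := by
  have h2 := Nat.lt_pow_succ_log_self (b := 2) (by norm_num) ⌊shiftedNorm m⌋₊
  have h3 : ⌊shiftedNorm m⌋₊ + 1 ≤ 2 ^ (dyadicScale m + 1) := h2
  calc shiftedNorm m < ⌊shiftedNorm m⌋₊ + 1 := Nat.lt_floor_add_one _
    _ ≤ _ := by exact_mod_cast h3

theorem log_shiftedNorm_le (m : L) : Real.log (shiftedNorm m) ≤ dyadicScale m + 1 := by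
  have h1 := Real.log_le_log (shiftedNorm_pos m) (lt_two_pow_dyadicScale m).le
  rw [Real.log_pow] at h1
  have h2 : Real.log 2 ≤ 1 := by
    have := Real.log_le_sub_one_of_pos (show (0 : ℝ) < 2 by norm_num)
    linarith
  refine h1.trans ?_
  push_cast
  have : (0 : ℝ) ≤ (dyadicScale m : ℝ) + 1 := by positivity
  nlinarith

/-- The shell of scale k has at most C·2^{kd} points, so lattice sums reduce to sums over scales.
Bounding finite sums uniformly postpones every question of summability. -/
theorem sum_le_sum_dyadic (c : LatticeCoords ι L) [FiniteBalls L] :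
    ∃ C : ℝ, 0 < C ∧ ∀ (h : L → ℝ) (φ : ℕ → ℝ) (T : Finset L) (I : Finset ℕ),
      (∀ k, 0 ≤ φ k) → (∀ m ∈ T, dyadicScale m ∈ I) → (∀ m ∈ T, h m ≤ φ (dyadicScale m)) →
      ∑ m ∈ T, h m ≤ C * ∑ k ∈ I, (2 : ℝ) ^ (k * Fintype.card ι) * φ k := by
  classical
  obtain ⟨C, hC, hcard⟩ := c.card_latticeBall_le
  refine ⟨C * 2 ^ Fintype.card ι, by positivity, fun h φ T I hφ hI hh => ?_⟩
  rw [← Finset.sum_fiberwise_of_maps_to hI, Finset.mul_sum]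
  refine Finset.sum_le_sum fun k _ => ?_
  have h1 : ∑ m ∈ T with dyadicScale m = k, h m ≤ ∑ m ∈ T with dyadicScale m = k, φ k := by
    refine Finset.sum_le_sum fun m hm => ?_
    rw [Finset.mem_filter] at hm
    exact (hh m hm.1).trans (by rw [hm.2])
  refine h1.trans ?_
  rw [Finset.sum_const, nsmul_eq_mul, ← mul_assoc]
  refine mul_le_mul_of_nonneg_right ?_ (hφ k)
  have h2 : (T.filter fun m => dyadicScale m = k) ⊆ latticeBall 0 (2 ^ (k + 1)) := by
    intro m hm
    rw [Finset.mem_filter] at hm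
    rw [mem_latticeBall, sub_zero]
    have := lt_two_pow_dyadicScale m
    rw [hm.2] at this
    unfold shiftedNorm at this
    linarith
  calc (((T.filter fun m => dyadicScale m = k).card : ℕ) : ℝ)
      ≤ (latticeBall (0 : L) (2 ^ (k + 1))).card := by exact_mod_cast Finset.card_le_card h2
    _ ≤ C * (2 ^ (k + 1)) ^ Fintype.card ι := hcard 0 _ (one_le_pow₀ (by norm_num))
    _ = _ := by rw [← pow_mul, add_mul, pow_add, one_mul]; ring

/-- The dyadic size of a rate with non-positive exponent. -/
theorem decayRate_le_dyadic (n α : ℕ) (m : L) :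
    decayRate (-(n : ℤ)) α m ≤ ((2 : ℝ) ^ (dyadicScale m * n))⁻¹ * (dyadicScale m + 1) ^ α := by
  unfold decayRate
  have h1 := log_shiftedNorm_le m
  have h2 := (log_shiftedNorm_pos m).le
  have h3 := two_pow_dyadicScale_le m
  rw [zpow_neg, zpow_natCast, pow_mul]
  gcongr

/-- At the critical exponent -d all shells contribute about equally, up to the logarithm in the
density. There are about log r of them, whence the additional power of the logarithm. -/
theorem sum_ball_decayRate_le (c : LatticeCoords ι L) [FiniteBalls L] (α : ℕ) :
    ∃ C : ℝ, 0 < C ∧ ∀ (r : ℝ) (T : Finset L), 2 ≤ r → (∀ m ∈ T, shiftedNorm m ≤ r) →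
      ∑ m ∈ T, decayRate (-(Fintype.card ι : ℤ)) α m ≤ C * Real.log r ^ (α + 1) := by
  obtain ⟨C, hC, h⟩ := sum_le_sum_dyadic c
  have hl2 : 0 < Real.log 2 := Real.log_pos (by norm_num)
  refine ⟨C * (2 / Real.log 2) ^ (α + 1), by positivity, fun r T hr hT => ?_⟩
  set K := ⌊Real.log r / Real.log 2⌋₊ with hK
  have hlr : Real.log 2 ≤ Real.log r := Real.log_le_log (by norm_num) hr
  have hKle : (K : ℝ) ≤ Real.log r / Real.log 2 := Nat.floor_le (div_nonneg (hl2.le.trans hlr) hl2.le)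
  refine (h _ (fun k => ((2 : ℝ) ^ (k * Fintype.card ι))⁻¹ * (k + 1) ^ α) T (Finset.range (K + 1))
    (fun k => by positivity) (fun m hm => ?_) fun m _ => decayRate_le_dyadic _ _ m).trans ?_
  · rw [Finset.mem_range, Nat.lt_succ_iff, hK]
    refine Nat.le_floor ?_
    rw [le_div_iff₀ hl2, ← Real.log_pow]
    exact Real.log_le_log (by positivity) ((two_pow_dyadicScale_le m).trans (hT m hm))
  · rw [mul_assoc]
    refine mul_le_mul_of_nonneg_left ?_ hC.le
    have h1 : ∀ k ∈ Finset.range (K + 1), (2 : ℝ) ^ (k * Fintype.card ι) *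
        (((2 : ℝ) ^ (k * Fintype.card ι))⁻¹ * (k + 1) ^ α) ≤ ((K : ℝ) + 1) ^ α := by
      intro k hk
      rw [mul_inv_cancel_left₀ (by positivity)]
      have : (k : ℝ) ≤ K := by exact_mod_cast Nat.lt_succ_iff.1 (Finset.mem_range.1 hk)
      gcongr
    refine (Finset.sum_le_sum h1).trans ?_
    rw [Finset.sum_const, Finset.card_range, nsmul_eq_mul]
    push_cast
    rw [← pow_succ', ← mul_pow]
    refine pow_le_pow_left₀ (by positivity) ?_ _
    have : 1 ≤ Real.log r / Real.log 2 := by rw [le_div_iff₀ hl2]; linarith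
    have e : 2 / Real.log 2 * Real.log r = 2 * (Real.log r / Real.log 2) := by ring
    linarith

/-- At exponent 1 - d the shell of scale k contributes about 2^k; the geometric sum is comparable
with its largest term and no logarithm appears. -/
theorem sum_ball_decayRate_one_sub_le (c : LatticeCoords ι L) [FiniteBalls L]
    (hd : 1 ≤ Fintype.card ι) :
    ∃ C : ℝ, 0 < C ∧ ∀ (r : ℝ) (T : Finset L), 2 ≤ r → (∀ m ∈ T, shiftedNorm m ≤ r) →
      ∑ m ∈ T, decayRate (1 - (Fintype.card ι : ℤ)) 0 m ≤ C * r := by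
  obtain ⟨C, hC, h⟩ := sum_le_sum_dyadic c
  have hl2 : 0 < Real.log 2 := Real.log_pos (by norm_num)
  refine ⟨C * 2, by positivity, fun r T hr hT => ?_⟩
  set K := ⌊Real.log r / Real.log 2⌋₊ with hK
  have hlr : Real.log 2 ≤ Real.log r := Real.log_le_log (by norm_num) hr
  have hKle : (K : ℝ) ≤ Real.log r / Real.log 2 := Nat.floor_le (div_nonneg (hl2.le.trans hlr) hl2.le)
  have hKr : (2 : ℝ) ^ K ≤ r := by
    rw [le_div_iff₀ hl2, ← Real.log_pow] at hKle
    exact (Real.log_le_log_iff (by positivity) (by linarith)).1 hKle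
  obtain ⟨n, hn⟩ := Nat.exists_eq_add_of_le hd
  have he : (1 - (Fintype.card ι : ℤ)) = -(n : ℤ) := by rw [hn]; push_cast; ring
  rw [he]
  refine (h _ (fun k => ((2 : ℝ) ^ (k * n))⁻¹) T (Finset.range (K + 1))
    (fun k => by positivity) (fun m hm => ?_) fun m _ => by
      simpa using decayRate_le_dyadic n 0 m).trans ?_
  · rw [Finset.mem_range, Nat.lt_succ_iff, hK]
    refine Nat.le_floor ?_
    rw [le_div_iff₀ hl2, ← Real.log_pow]
    exact Real.log_le_log (by positivity) ((two_pow_dyadicScale_le m).trans (hT m hm))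
  · rw [mul_assoc]
    refine mul_le_mul_of_nonneg_left ?_ hC.le
    have h1 : ∀ k ∈ Finset.range (K + 1), (2 : ℝ) ^ (k * Fintype.card ι) *
        ((2 : ℝ) ^ (k * n))⁻¹ = 2 ^ k := by
      intro k _
      rw [hn, mul_add, pow_add, mul_one, mul_assoc, mul_inv_cancel₀ (by positivity), mul_one]
    rw [Finset.sum_congr rfl h1, geom_sum_eq (by norm_num), pow_succ]
    linarith

/-- Writing k = K + i, one has k + 1 ≤ (K + 1)(i + 1), while the extra factor 2^{-is} is at most
2^{-i}. The tail is therefore its first term times a convergent series independent of s. -/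
theorem exists_sum_tail_bound (α : ℕ) : ∃ C : ℝ, 0 < C ∧ ∀ s : ℕ, 1 ≤ s → ∀ (I : Finset ℕ) (K : ℕ),
    (∀ k ∈ I, K ≤ k) → ∑ k ∈ I, ((2 : ℝ) ^ (k * s))⁻¹ * ((k : ℝ) + 1) ^ α ≤
      C * (((2 : ℝ) ^ (K * s))⁻¹ * ((K : ℝ) + 1) ^ α) := by
  have hs0 : Summable fun k : ℕ => ((k : ℝ) + 1) ^ α * (1 / 2 : ℝ) ^ k := by
    have h1 := summable_pow_mul_geometric_of_norm_lt_one α (r := (1 / 2 : ℝ)) (by norm_num)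
    have h2 := ((summable_nat_add_iff 1).2 h1).mul_left 2
    refine h2.congr fun k => ?_
    push_cast
    rw [pow_succ]
    ring
  refine ⟨1 + ∑' k : ℕ, ((k : ℝ) + 1) ^ α * (1 / 2 : ℝ) ^ k, by
    have : 0 ≤ ∑' k : ℕ, ((k : ℝ) + 1) ^ α * (1 / 2 : ℝ) ^ k := tsum_nonneg fun k => by positivity
    positivity, fun s hs I K hI => ?_⟩
  have hpt : ∀ k ∈ I, ((2 : ℝ) ^ (k * s))⁻¹ * ((k : ℝ) + 1) ^ α ≤
      (((2 : ℝ) ^ (K * s))⁻¹ * ((K : ℝ) + 1) ^ α) *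
        ((((k - K : ℕ) : ℝ) + 1) ^ α * (1 / 2 : ℝ) ^ (k - K)) := by
    intro k hk
    obtain ⟨i, rfl⟩ := Nat.exists_eq_add_of_le (hI k hk)
    rw [Nat.add_sub_cancel_left, add_mul, pow_add, mul_inv]
    have h1 : (((2 : ℝ) ^ (i * s))⁻¹) ≤ (1 / 2 : ℝ) ^ i := by
      rw [one_div, inv_pow]
      exact inv_anti₀ (by positivity) (pow_le_pow_right₀ (by norm_num) (by nlinarith))
    have h2 : (((K + i : ℕ) : ℝ) + 1) ^ α ≤ ((K : ℝ) + 1) ^ α * ((i : ℝ) + 1) ^ α := by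
      rw [← mul_pow]
      refine pow_le_pow_left₀ (by positivity) ?_ _
      push_cast
      have hK : (0 : ℝ) ≤ K := K.cast_nonneg
      have hi : (0 : ℝ) ≤ i := i.cast_nonneg
      nlinarith
    calc _ ≤ ((2 : ℝ) ^ (K * s))⁻¹ * (1 / 2 : ℝ) ^ i * (((K : ℝ) + 1) ^ α * ((i : ℝ) + 1) ^ α) := by
          gcongr
      _ = _ := by ring
  refine (Finset.sum_le_sum hpt).trans ?_
  rw [← Finset.mul_sum, mul_comm]
  refine mul_le_mul_of_nonneg_right ?_ (by positivity)
  have h3 : ∑ k ∈ I, (((k - K : ℕ) : ℝ) + 1) ^ α * (1 / 2 : ℝ) ^ (k - K) =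
      ∑ i ∈ I.image (· - K), ((i : ℝ) + 1) ^ α * (1 / 2 : ℝ) ^ i := by
    rw [Finset.sum_image]
    intro k hk k' hk' h
    have h1 := hI k hk
    have h2 := hI k' hk'
    simp only at h
    omega
  rw [h3]
  have := hs0.sum_le_tsum (I.image (· - K)) fun k _ => by positivity
  linarith

theorem sum_tail_decayRate_le (c : LatticeCoords ι L) [FiniteBalls L] (α s : ℕ) (hs : 1 ≤ s) :
    ∃ C : ℝ, 0 < C ∧ ∀ (r : ℝ) (T : Finset L), 2 ≤ r → (∀ m ∈ T, r ≤ shiftedNorm m) →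
      ∑ m ∈ T, decayRate (-(Fintype.card ι : ℤ) - s) α m ≤
        C * (r ^ (-(s : ℤ)) * Real.log r ^ α) := by
  classical
  obtain ⟨C, hC, h⟩ := sum_le_sum_dyadic c
  obtain ⟨D, hD, h'⟩ := exists_sum_tail_bound α
  have hl2 : 0 < Real.log 2 := Real.log_pos (by norm_num)
  refine ⟨C * (D * (2 ^ s * (2 / Real.log 2) ^ α)), by positivity, fun r T hr hT => ?_⟩
  set K := ⌊Real.log r / Real.log 2⌋₊ with hK
  have hr0 : 0 < r := by linarith
  have hlr : Real.log 2 ≤ Real.log r := Real.log_le_log (by norm_num) hr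
  have hKle : (K : ℝ) ≤ Real.log r / Real.log 2 := Nat.floor_le (div_nonneg (hl2.le.trans hlr) hl2.le)
  have hKlt : Real.log r / Real.log 2 < K + 1 := Nat.lt_floor_add_one _
  have hKr : r ≤ (2 : ℝ) ^ (K + 1) := by
    rw [div_lt_iff₀ hl2] at hKlt
    have h1 : Real.log r ≤ Real.log ((2 : ℝ) ^ (K + 1)) := by
      rw [Real.log_pow]; push_cast; exact hKlt.le
    exact (Real.log_le_log_iff hr0 (by positivity)).1 h1
  have he : (-(Fintype.card ι : ℤ) - s) = -((Fintype.card ι + s : ℕ) : ℤ) := by push_cast; ring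
  rw [he]
  have hKI : ∀ k ∈ T.image dyadicScale, K ≤ k := by
    intro k hk
    obtain ⟨m, hm, rfl⟩ := Finset.mem_image.1 hk
    rw [← Nat.lt_succ_iff]
    have h1 : Real.log r < (dyadicScale m + 1 : ℕ) * Real.log 2 := by
      rw [← Real.log_pow]
      exact Real.log_lt_log hr0 ((hT m hm).trans_lt (lt_two_pow_dyadicScale m))
    rw [← div_lt_iff₀ hl2] at h1
    exact_mod_cast hKle.trans_lt h1
  refine (h _ (fun k => ((2 : ℝ) ^ (k * (Fintype.card ι + s)))⁻¹ * ((k : ℝ) + 1) ^ α) T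
    (T.image dyadicScale) (fun k => by positivity) (fun m hm => Finset.mem_image_of_mem _ hm)
    fun m _ => decayRate_le_dyadic _ _ m).trans ?_
  rw [mul_assoc]
  refine mul_le_mul_of_nonneg_left ?_ hC.le
  have h1 : ∀ k ∈ T.image (dyadicScale (L := L)), (2 : ℝ) ^ (k * Fintype.card ι) *
      (((2 : ℝ) ^ (k * (Fintype.card ι + s)))⁻¹ * ((k : ℝ) + 1) ^ α) =
      ((2 : ℝ) ^ (k * s))⁻¹ * ((k : ℝ) + 1) ^ α := by
    intro k _
    rw [mul_add, pow_add, mul_inv, mul_assoc, mul_inv_cancel_left₀ (by positivity)]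
  rw [Finset.sum_congr rfl h1]
  refine (h' s hs _ K hKI).trans ?_
  rw [mul_assoc D]
  refine mul_le_mul_of_nonneg_left ?_ hD.le
  have h2 : ((2 : ℝ) ^ (K * s))⁻¹ ≤ 2 ^ s * r ^ (-(s : ℤ)) := by
    rw [zpow_neg, zpow_natCast, ← div_eq_mul_inv, le_div_iff₀ (by positivity),
      inv_mul_le_iff₀ (by positivity), ← pow_add]
    calc r ^ s ≤ (2 ^ (K + 1)) ^ s := by gcongr
      _ = _ := by rw [← pow_mul]; ring
  have h3 : (K : ℝ) + 1 ≤ 2 / Real.log 2 * Real.log r := by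
    have : 1 ≤ Real.log r / Real.log 2 := by rw [le_div_iff₀ hl2]; linarith
    have e : 2 / Real.log 2 * Real.log r = 2 * (Real.log r / Real.log 2) := by ring
    linarith
  calc _ ≤ 2 ^ s * r ^ (-(s : ℤ)) * (2 / Real.log 2 * Real.log r) ^ α := by gcongr
    _ = _ := by rw [mul_pow]; ring

end RadialSums

/-! ### Newton polynomials and the discrete Taylor formula -/

namespace LatticeCoords

variable {ι L : Type*} [Fintype ι] [NormedAddCommGroup L] (c : LatticeCoords ι L)

section MultiDiff

variable {E : Type*} [AddCommGroup E]

/-- The difference along a multiset of basis directions. -/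
noncomputable def multiDiff (M : Multiset ι) (F : L → E) : L → E :=
  listDiff (M.toList.map c.vec) F

theorem multiDiff_coe (t : List ι) (F : L → E) :
    c.multiDiff (t : Multiset ι) F = listDiff (t.map c.vec) F :=
  listDiff_perm ((Multiset.coe_eq_coe.1 (Multiset.coe_toList (t : Multiset ι))).map c.vec) F

theorem multiDiff_zero (F : L → E) : c.multiDiff 0 F = F := by simp [multiDiff]

theorem multiDiff_cons (i : ι) (M : Multiset ι) (F : L → E) :
    c.multiDiff (i ::ₘ M) F = c.multiDiff M (latticeDiff (c.vec i) F) := by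
  induction M using Quotient.inductionOn with
  | h t =>
    rw [Multiset.quot_mk_to_coe, Multiset.cons_coe, multiDiff_coe, multiDiff_coe, List.map_cons,
      listDiff_cons, listDiff_latticeDiff]

end MultiDiff

variable [DecidableEq ι]

/-- The Newton polynomial `∏ᵢ (nᵢ choose Mᵢ)`. -/
noncomputable def newton (M : Multiset ι) (l : L) : ℝ :=
  ∏ i, ((Ring.choose (c.equiv l i) (M.count i) : ℤ) : ℝ)

omit [DecidableEq ι] in
theorem equiv_add_vec_self (l : L) (j : ι) : c.equiv (l + c.vec j) j = c.equiv l j + 1 := by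
  rw [map_add, equiv_vec]; simp

omit [DecidableEq ι] in
theorem equiv_add_vec_of_ne (l : L) {i j : ι} (h : i ≠ j) :
    c.equiv (l + c.vec j) i = c.equiv l i := by
  rw [map_add, equiv_vec]; simp [h]

theorem latticeDiff_newton_eq (M : Multiset ι) (j : ι) (l : L) :
    latticeDiff (c.vec j) (c.newton M) l =
      ((Ring.choose (c.equiv l j + 1) (M.count j) - Ring.choose (c.equiv l j) (M.count j) : ℤ) : ℝ) *
      ∏ i ∈ Finset.univ.erase j, ((Ring.choose (c.equiv l i) (M.count i) : ℤ) : ℝ) := by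
  rw [latticeDiff_apply, newton, newton,
    ← Finset.mul_prod_erase _ _ (Finset.mem_univ j), ← Finset.mul_prod_erase _ _ (Finset.mem_univ j),
    equiv_add_vec_self]
  have : ∏ i ∈ Finset.univ.erase j, ((Ring.choose (c.equiv (l + c.vec j) i) (M.count i) : ℤ) : ℝ) =
      ∏ i ∈ Finset.univ.erase j, ((Ring.choose (c.equiv l i) (M.count i) : ℤ) : ℝ) :=
    Finset.prod_congr rfl fun i hi => by
      rw [c.equiv_add_vec_of_ne l (Finset.ne_of_mem_erase hi)]
  rw [this]
  push_cast
  ring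

/-- Pascal's rule. A difference lowers a Newton polynomial as a derivative lowers a divided power.
-/
theorem latticeDiff_newton_cons (M : Multiset ι) (j : ι) :
    latticeDiff (c.vec j) (c.newton (j ::ₘ M)) = c.newton M := by
  funext l
  rw [latticeDiff_newton_eq, Multiset.count_cons_self, Ring.choose_succ_succ, add_sub_cancel_right,
    newton, ← Finset.mul_prod_erase _ _ (Finset.mem_univ j)]
  congr 1
  refine Finset.prod_congr rfl fun i hi => ?_
  rw [Multiset.count_cons_of_ne (Finset.ne_of_mem_erase hi)]

theorem latticeDiff_newton_of_notMem {M : Multiset ι} {j : ι} (h : j ∉ M) :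
    latticeDiff (c.vec j) (c.newton M) = 0 := by
  funext l
  rw [latticeDiff_newton_eq, Multiset.count_eq_zero_of_notMem h]
  simp

theorem newton_zero (l : L) : c.newton 0 l = 1 := by simp [newton]

theorem newton_apply_zero {M : Multiset ι} (h : M ≠ 0) : c.newton M 0 = 0 := by
  obtain ⟨j, hj⟩ := Multiset.exists_mem_of_ne_zero h
  refine Finset.prod_eq_zero (Finset.mem_univ j) ?_
  have := Multiset.count_pos.2 hj
  rw [map_zero, Pi.zero_apply, Ring.choose_zero_pos _ (by omega)]
  simp

/-- Lattice polynomials of degree less than `p`. -/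
def IsPoly (p : ℕ) (q : L → ℝ) : Prop :=
  ∀ t : List ι, t.length = p → listDiff (t.map c.vec) q = 0

omit [DecidableEq ι] in
theorem closure_range_vec : AddSubgroup.closure (Set.range c.vec) = ⊤ := by
  rw [eq_top_iff]
  intro l _
  rw [c.eq_sum_vec l]
  exact sum_mem fun i _ => zsmul_mem (AddSubgroup.subset_closure (Set.mem_range_self i)) _

namespace IsPoly

variable {c} {p : ℕ} {q : L → ℝ}

omit [DecidableEq ι] in
theorem shift (hq : c.IsPoly p q) (b : L) : c.IsPoly p fun l => q (l + b) := by
  intro t ht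
  funext l
  rw [listDiff_shift, hq t ht]; rfl

omit [DecidableEq ι] in
theorem latticeDiff (hq : c.IsPoly (p + 1) q) (b : L) : c.IsPoly p (latticeDiff b q) := by
  intro t ht
  rw [listDiff_latticeDiff]
  refine latticeDiff_induction c.closure_range_vec
    (p := fun b => _root_.latticeDiff b (listDiff (t.map c.vec) q) = 0) ?_ ?_ ?_ ?_ b
  · rintro _ ⟨i, rfl⟩
    have := hq (i :: t) (by simp [ht])
    rwa [List.map_cons, listDiff_cons] at this
  · exact latticeDiff_zero_left _
  · intro a b ha hb
    funext l
    rw [latticeDiff_add_left, ha, hb]; simp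
  · intro a ha
    funext l
    rw [latticeDiff_neg_left, ha]; simp

theorem newton {M : Multiset ι} (h : Multiset.card M < p) : c.IsPoly p (c.newton M) := by
  induction p generalizing M with
  | zero => simp at h
  | succ p ih =>
    intro t ht
    cases t with
    | nil => simp at ht
    | cons j t =>
      rw [List.map_cons, listDiff_cons, ← listDiff_latticeDiff]
      by_cases hj : j ∈ M
      · obtain ⟨M₁, rfl⟩ := Multiset.exists_cons_of_mem hj
        rw [latticeDiff_newton_cons]
        exact ih (by simpa using h) t (by simpa using ht)
      · rw [c.latticeDiff_newton_of_notMem hj, listDiff_zero]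

end IsPoly

/-- The `ℓ¹` norm of the coordinates. -/
def normOne (l : L) : ℕ := ∑ i, (c.equiv l i).natAbs

/-- Every coordinate of `m` is at most the corresponding one of `l` in absolute value. -/
def Dominated (m l : L) : Prop := ∀ i, (c.equiv m i).natAbs ≤ (c.equiv l i).natAbs

omit [DecidableEq ι] in
theorem Dominated.trans {c : LatticeCoords ι L} {k m l : L} (h : c.Dominated k m)
    (h' : c.Dominated m l) : c.Dominated k l := fun i => (h i).trans (h' i)

omit [DecidableEq ι] in
theorem normOne_mono {m l : L} (h : c.Dominated m l) : c.normOne m ≤ c.normOne l :=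
  Finset.sum_le_sum fun i _ => h i

omit [DecidableEq ι] in
theorem exists_normOne_le : ∃ C : ℝ, 0 < C ∧ ∀ l : L, (c.normOne l : ℝ) ≤ C * ‖l‖ := by
  have hc := c.lower_pos
  refine ⟨(Fintype.card ι + 1) / c.lower, by positivity, fun l => ?_⟩
  have h : ∀ i ∈ Finset.univ, ((c.equiv l i).natAbs : ℝ) ≤ ‖l‖ / c.lower := by
    intro i _
    rw [le_div_iff₀' hc, Nat.cast_natAbs, Int.cast_abs]
    exact c.lower_le l i
  have h2 := Finset.sum_le_sum h
  rw [Finset.sum_const, Finset.card_univ, nsmul_eq_mul] at h2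
  unfold normOne
  push_cast
  refine h2.trans ?_
  rw [div_mul_eq_mul_div, ← mul_div_assoc]
  gcongr
  linarith

omit [DecidableEq ι] in
theorem exists_dominated_norm_le :
    ∃ C : ℝ, 1 ≤ C ∧ ∀ m l : L, c.Dominated m l → ‖m‖ ≤ C * ‖l‖ := by
  have hc := c.lower_pos
  refine ⟨1 + (∑ i, ‖c.vec i‖) / c.lower, ?_, fun m l h => ?_⟩
  · have : 0 ≤ (∑ i, ‖c.vec i‖) / c.lower := by positivity
    linarith
  have h1 : ‖m‖ ≤ ∑ i, ‖l‖ / c.lower * ‖c.vec i‖ := by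
    refine (c.norm_le m).trans (Finset.sum_le_sum fun i _ => ?_)
    refine mul_le_mul_of_nonneg_right ?_ (norm_nonneg _)
    rw [le_div_iff₀' hc]
    refine le_trans ?_ (c.lower_le l i)
    refine mul_le_mul_of_nonneg_left ?_ hc.le
    have := h i
    rw [← Int.cast_abs, ← Int.cast_abs, ← Nat.cast_natAbs, ← Nat.cast_natAbs]
    exact_mod_cast this
  refine h1.trans ?_
  rw [← Finset.mul_sum, add_mul, one_mul]
  have := norm_nonneg l
  have e : ‖l‖ / c.lower * ∑ i, ‖c.vec i‖ = (∑ i, ‖c.vec i‖) / c.lower * ‖l‖ := by ring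
  linarith

/-- Integration of differences along a lattice path to the origin. -/
theorem norm_sub_le_normOne_mul {E : Type*} [NormedAddCommGroup E] (f : L → E) (K : ℝ) (l : L)
    (h : ∀ j m, c.Dominated m l → ‖latticeDiff (c.vec j) f m‖ ≤ K) :
    ‖f l - f 0‖ ≤ c.normOne l * K := by
  induction hn : c.normOne l generalizing l with
  | zero =>
    have hl : l = 0 := by
      apply c.equiv.injective
      funext i
      have := (Finset.sum_eq_zero_iff.1 hn) i (Finset.mem_univ i)
      rw [map_zero, Pi.zero_apply]
      omega
    simp [hl]
  | succ n ih =>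
    obtain ⟨j, hj⟩ : ∃ j, c.equiv l j ≠ 0 := by
      by_contra hcon
      push Not at hcon
      have : c.normOne l = 0 := Finset.sum_eq_zero fun i _ => by simp [hcon i]
      omega
    obtain ⟨l', hdom, hone, hstep⟩ : ∃ l', c.Dominated l' l ∧ c.normOne l' = n ∧
        ‖f l - f l'‖ ≤ K := by
      have hred : ∀ l', (∀ i, i ≠ j → c.equiv l' i = c.equiv l i) →
          (c.equiv l' j).natAbs + 1 = (c.equiv l j).natAbs →
          c.Dominated l' l ∧ c.normOne l' = n := by
        intro l' h1 h2
        constructor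
        · intro i
          by_cases hi : i = j
          · subst hi; omega
          · rw [h1 i hi]
        · have e1 := Finset.add_sum_erase Finset.univ (fun i => (c.equiv l i).natAbs)
            (Finset.mem_univ j)
          have e2 := Finset.add_sum_erase Finset.univ (fun i => (c.equiv l' i).natAbs)
            (Finset.mem_univ j)
          have e3 : ∑ i ∈ Finset.univ.erase j, (c.equiv l' i).natAbs =
              ∑ i ∈ Finset.univ.erase j, (c.equiv l i).natAbs :=
            Finset.sum_congr rfl fun i hi => by rw [h1 i (Finset.ne_of_mem_erase hi)]
          unfold normOne at hn ⊢
          omega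
      rcases lt_or_gt_of_ne hj with hneg | hpos
      · obtain ⟨h1, h2⟩ := hred (l + c.vec j) (fun i hi => c.equiv_add_vec_of_ne l hi)
          (by rw [equiv_add_vec_self]; omega)
        refine ⟨_, h1, h2, ?_⟩
        rw [norm_sub_rev]
        exact h j l fun _ => le_rfl
      · have e : l - c.vec j + c.vec j = l := sub_add_cancel _ _
        obtain ⟨h1, h2⟩ := hred (l - c.vec j) (fun i hi => by
            rw [← c.equiv_add_vec_of_ne (l - c.vec j) hi, e])
          (by
            have := c.equiv_add_vec_self (l - c.vec j) j
            rw [e] at this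
            omega)
        refine ⟨_, h1, h2, ?_⟩
        have := h j (l - c.vec j) h1
        rwa [latticeDiff_apply, e] at this
    have h3 := ih l' (fun j m hm => h j m (hm.trans hdom)) hone
    calc ‖f l - f 0‖ = ‖(f l - f l') + (f l' - f 0)‖ := by congr 1; abel
      _ ≤ K + n * K := (norm_add_le _ _).trans (add_le_add hstep h3)
      _ = _ := by push_cast; ring

/-- By induction on the degree: a Newton polynomial of positive degree vanishes at 0, and its
differences are zero or Newton polynomials of one degree less, which are integrated along a lattice
path. -/
theorem abs_newton_le (M : Multiset ι) (l : L) :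
    |c.newton M l| ≤ ((c.normOne l : ℝ) + 1) ^ Multiset.card M := by
  induction hn : Multiset.card M generalizing M l with
  | zero => rw [Multiset.card_eq_zero.1 hn, newton_zero]; simp
  | succ n ih =>
    have hM : M ≠ 0 := by rintro rfl; simp at hn
    have h := c.norm_sub_le_normOne_mul (c.newton M) (((c.normOne l : ℝ) + 1) ^ n) l (by
      intro j m hm
      by_cases hj : j ∈ M
      · obtain ⟨M₁, rfl⟩ := Multiset.exists_cons_of_mem hj
        rw [latticeDiff_newton_cons]
        refine (ih M₁ m (by simpa using hn)).trans ?_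
        have := c.normOne_mono hm
        gcongr
      · rw [c.latticeDiff_newton_of_notMem hj]
        simp only [Pi.zero_apply, norm_zero]
        positivity)
    rw [c.newton_apply_zero hM, sub_zero, Real.norm_eq_abs] at h
    refine h.trans ?_
    rw [pow_succ']
    gcongr
    linarith

section Taylor

variable {E : Type*} [NormedAddCommGroup E] [NormedSpace ℝ E]

/-- The remainder of the discrete Taylor expansion of order `p`. -/
noncomputable def taylorRem (p : ℕ) (F : L → E) (x m : L) : E :=
  F (x + m) - ∑ i ∈ Finset.range p, ∑ M : Sym ι i, c.newton M m • c.multiDiff M F x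

/-- Newton polynomials without the direction j are annihilated, and the others correspond through
`Sym.cons j` to those of one degree less. Since the remainder vanishes at m = 0, integration along a
path then gives the bound of `norm_taylorRem_le` by induction on p. -/
theorem latticeDiff_taylorRem (p : ℕ) (F : L → E) (x : L) (j : ι) (m : L) :
    latticeDiff (c.vec j) (c.taylorRem (p + 1) F x) m =
      c.taylorRem p (latticeDiff (c.vec j) F) x m := by
  have h1 : latticeDiff (c.vec j) (c.taylorRem (p + 1) F x) m =
      latticeDiff (c.vec j) F (x + m) - ∑ i ∈ Finset.range (p + 1), ∑ M : Sym ι i,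
        latticeDiff (c.vec j) (c.newton M) m • c.multiDiff M F x := by
    simp only [latticeDiff_apply, taylorRem, sub_smul, Finset.sum_sub_distrib, ← add_assoc]
    abel
  rw [h1, taylorRem, Finset.sum_range_succ']
  congr 1
  have h2 : ∑ M : Sym ι 0, latticeDiff (c.vec j) (c.newton M) m • c.multiDiff M F x = 0 := by
    refine Finset.sum_eq_zero fun M _ => ?_
    rw [c.latticeDiff_newton_of_notMem (by rw [M.eq_nil_of_card_zero]; exact Multiset.notMem_zero j)]
    simp
  rw [h2, add_zero]
  refine Finset.sum_congr rfl fun i _ => (Fintype.sum_of_injective (Sym.cons j)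
    (fun _ _ h => (Sym.cons_inj_right j _ _).1 h) _ _ (fun M hM => ?_) fun M => ?_).symm
  · rw [c.latticeDiff_newton_of_notMem]
    · simp
    · intro hj
      exact hM ⟨M.erase j hj, Sym.cons_erase hj⟩
  · rw [Sym.coe_cons, latticeDiff_newton_cons, multiDiff_cons]

theorem taylorRem_apply_zero (p : ℕ) (F : L → E) (x : L) : c.taylorRem (p + 1) F x 0 = 0 := by
  rw [taylorRem, Finset.sum_range_succ', add_zero]
  have h1 : ∑ i ∈ Finset.range p, ∑ M : Sym ι (i + 1), c.newton M 0 • c.multiDiff M F x = 0 := by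
    refine Finset.sum_eq_zero fun i _ => Finset.sum_eq_zero fun M _ => ?_
    rw [c.newton_apply_zero, zero_smul]
    intro h
    have := M.2
    rw [show (M.1 : Multiset ι) = 0 from h] at this
    simp at this
  rw [h1, zero_add, Fintype.sum_eq_single (Sym.nil : Sym ι 0)
    (fun M hM => absurd (M.eq_nil_of_card_zero) hM)]
  simp [newton_zero, multiDiff_zero]

theorem norm_taylorRem_le (p : ℕ) (F : L → E) (x m : L) {K : ℝ} (hK : 0 ≤ K)
    (h : ∀ (M : Sym ι p) m', c.Dominated m' m → ‖c.multiDiff M F (x + m')‖ ≤ K) :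
    ‖c.taylorRem p F x m‖ ≤ (c.normOne m : ℝ) ^ p * K := by
  induction p generalizing F m with
  | zero =>
    have := h Sym.nil m fun _ => le_rfl
    simpa [taylorRem, multiDiff_zero] using this
  | succ p ih =>
    have h1 := c.norm_sub_le_normOne_mul (c.taylorRem (p + 1) F x) ((c.normOne m : ℝ) ^ p * K) m (by
      intro j m' hm'
      rw [latticeDiff_taylorRem]
      refine (ih (latticeDiff (c.vec j) F) m' fun M k hk => ?_).trans ?_
      · have := h (Sym.cons j M) k (hk.trans hm')
        rwa [Sym.coe_cons, multiDiff_cons] at this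
      · have := c.normOne_mono hm'
        gcongr)
    rw [taylorRem_apply_zero, sub_zero] at h1
    refine h1.trans (le_of_eq ?_)
    ring

end Taylor

/-- The order-p differences vanish, so the Taylor remainder bound holds with constant zero. -/
theorem IsPoly.eq_sum_newton {c : LatticeCoords ι L} {p : ℕ} {q : L → ℝ} (hq : c.IsPoly p q)
    (m : L) : q m = ∑ i ∈ Finset.range p, ∑ M : Sym ι i, c.newton M m * c.multiDiff M q 0 := by
  have h := c.norm_taylorRem_le p q 0 m le_rfl (by
    intro M m' _
    rw [multiDiff, hq _ (by rw [Multiset.length_toList]; exact M.2)]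
    simp)
  rw [mul_zero, norm_le_zero_iff, taylorRem, zero_add, sub_eq_zero] at h
  simpa only [smul_eq_mul] using h

theorem exists_newton_growth (M : Multiset ι) : ∃ C : ℝ, 0 < C ∧ ∀ l : L,
    |c.newton M l| ≤ C * shiftedNorm l ^ Multiset.card M := by
  obtain ⟨C, hC, h⟩ := c.exists_normOne_le
  refine ⟨(C + 1) ^ Multiset.card M, by positivity, fun l => (c.abs_newton_le M l).trans ?_⟩
  rw [← mul_pow]
  refine pow_le_pow_left₀ (by positivity) ?_ _
  have := h l
  have := norm_nonneg l
  unfold shiftedNorm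
  nlinarith

theorem IsPoly.growth {c : LatticeCoords ι L} {p : ℕ} {q : L → ℝ} (hq : c.IsPoly (p + 1) q) :
    ∃ C : ℝ, 0 < C ∧ ∀ l : L, |q l| ≤ C * shiftedNorm l ^ p := by
  choose C hC h using fun M : Multiset ι => c.exists_newton_growth M
  refine ⟨1 + ∑ i ∈ Finset.range (p + 1), ∑ M : Sym ι i, C M * |c.multiDiff M q 0|, by
    have : 0 ≤ ∑ i ∈ Finset.range (p + 1), ∑ M : Sym ι i, C M * |c.multiDiff M q 0| :=
      Finset.sum_nonneg fun i _ => Finset.sum_nonneg fun M _ =>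
        mul_nonneg (hC M).le (abs_nonneg _)
    positivity, fun l => ?_⟩
  rw [hq.eq_sum_newton l, add_mul, one_mul]
  have hp := pow_pos (shiftedNorm_pos l) p
  refine le_add_of_nonneg_of_le hp.le ?_
  refine (Finset.abs_sum_le_sum_abs _ _).trans ?_
  rw [Finset.sum_mul]
  refine Finset.sum_le_sum fun i hi => ?_
  refine (Finset.abs_sum_le_sum_abs _ _).trans ?_
  rw [Finset.sum_mul]
  refine Finset.sum_le_sum fun M _ => ?_
  rw [abs_mul, mul_right_comm]
  refine mul_le_mul_of_nonneg_right ?_ (abs_nonneg _)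
  refine (h M l).trans (mul_le_mul_of_nonneg_left ?_ (hC M).le)
  refine pow_le_pow_right₀ (by linarith [two_le_shiftedNorm l]) ?_
  rw [show Multiset.card (M : Multiset ι) = i from M.2]
  exact Nat.lt_succ_iff.1 (Finset.mem_range.1 hi)

end LatticeCoords

/-! ### Convolution with a kernel against a density with vanishing moments -/

section SumBound

variable {L : Type*} [NormedAddCommGroup L]

/-- The sums of `h ℓ` over finite sets of points in the region `P ℓ` are bounded by the decay rate
at `ℓ`. -/
def SumBound (P : L → L → Prop) (h : L → L → ℝ) (a : ℤ) (β : ℕ) : Prop :=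
  ∃ C : ℝ, 0 < C ∧ ∀ (l : L) (T : Finset L), (∀ m ∈ T, P l m) →
    ∑ m ∈ T, h l m ≤ C * decayRate a β l

theorem decayRate_mul (a b : ℤ) (β γ : ℕ) (l : L) :
    decayRate a β l * decayRate b γ l = decayRate (a + b) (β + γ) l := by
  unfold decayRate
  rw [zpow_add₀ (shiftedNorm_pos l).ne', pow_add]
  ring

theorem decayRate_mul_pow (a : ℤ) (β n : ℕ) (l : L) :
    decayRate a β l * shiftedNorm l ^ n = decayRate (a + n) β l := by
  have h := decayRate_mul a n β 0 l
  rw [add_zero] at h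
  rw [← h, decayRate, decayRate, pow_zero, mul_one, zpow_natCast]

namespace SumBound

variable {P Q : L → L → Prop} {h k : L → L → ℝ} {a : ℤ} {β : ℕ}

theorem mono {b : ℤ} {γ : ℕ} (hh : SumBound P h a β) (hab : a ≤ b) (hβ : β ≤ γ) :
    SumBound P h b γ := by
  obtain ⟨C, hC, hh⟩ := hh
  have h1 : DecaysLike (fun l : L => decayRate a β l) a β :=
    decaysLike_iff.2 ⟨1, one_pos, fun l => by rw [one_mul]⟩
  obtain ⟨D, hD, h2⟩ := decaysLike_iff.1 (h1.mono hab hβ)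
  refine ⟨C * D, by positivity, fun l T hT => (hh l T hT).trans ?_⟩
  rw [mul_assoc]
  exact mul_le_mul_of_nonneg_left (h2 l) hC.le

theorem of_le (hk : SumBound Q k a β) (hPQ : ∀ l m, P l m → Q l m) {C : ℝ} (hC : 0 < C)
    (hle : ∀ l m, P l m → h l m ≤ C * k l m) : SumBound P h a β := by
  obtain ⟨D, hD, hk⟩ := hk
  refine ⟨C * D, by positivity, fun l T hT => ?_⟩
  refine (Finset.sum_le_sum fun m hm => hle l m (hT m hm)).trans ?_
  rw [← Finset.mul_sum, mul_assoc]
  exact mul_le_mul_of_nonneg_left (hk l T fun m hm => hPQ l m (hT m hm)) hC.le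

theorem union (hP : SumBound P h a β) (hQ : SumBound Q h a β) :
    SumBound (fun l m => P l m ∨ Q l m) h a β := by
  classical
  obtain ⟨C, hC, hP⟩ := hP
  obtain ⟨D, hD, hQ⟩ := hQ
  refine ⟨C + D, by positivity, fun l T hT => ?_⟩
  rw [← Finset.sum_filter_add_sum_filter_not T (P l), add_mul]
  refine add_le_add (hP l _ fun m hm => (Finset.mem_filter.1 hm).2) (hQ l _ fun m hm => ?_)
  rw [Finset.mem_filter] at hm
  exact (hT m hm.1).resolve_left hm.2

theorem add (hh : SumBound P h a β) (hk : SumBound P k a β) :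
    SumBound P (fun l m => h l m + k l m) a β := by
  obtain ⟨C, hC, hh⟩ := hh
  obtain ⟨D, hD, hk⟩ := hk
  refine ⟨C + D, by positivity, fun l T hT => ?_⟩
  rw [Finset.sum_add_distrib, add_mul]
  exact add_le_add (hh l T hT) (hk l T hT)

theorem sum {κ : Type*} {I : Finset κ} {h : κ → L → L → ℝ} (hh : ∀ i ∈ I, SumBound P (h i) a β) :
    SumBound P (fun l m => ∑ i ∈ I, h i l m) a β := by
  classical
  induction I using Finset.induction_on with
  | empty =>
    refine ⟨1, one_pos, fun l T _ => ?_⟩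
    simpa using (decayRate_pos a β l).le
  | insert i I hi ih =>
    simp only [Finset.sum_insert hi]
    exact (hh i (Finset.mem_insert_self i I)).add (ih fun j hj => hh j (Finset.mem_insert_of_mem hj))

theorem mul_decayRate (hh : SumBound P h a β) (b : ℤ) (γ : ℕ) :
    SumBound P (fun l m => decayRate b γ l * h l m) (b + a) (γ + β) := by
  obtain ⟨C, hC, hh⟩ := hh
  refine ⟨C, hC, fun l T hT => ?_⟩
  rw [← Finset.mul_sum, ← decayRate_mul]
  have := mul_le_mul_of_nonneg_left (hh l T hT) (decayRate_pos b γ l).le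
  linarith

end SumBound

variable {ι : Type*} [Fintype ι] [FiniteBalls L] (c : LatticeCoords ι L)

include c

theorem sumBound_ball (α : ℕ) {K : ℝ} (hK : 1 ≤ K) :
    SumBound (fun l m : L => shiftedNorm m ≤ K * shiftedNorm l)
      (fun _ m => decayRate (-(Fintype.card ι : ℤ)) α m) 0 (α + 1) := by
  obtain ⟨C, hC, h⟩ := sum_ball_decayRate_le c α
  have hl2 : 0 < Real.log 2 := Real.log_pos (by norm_num)
  have hlK := Real.log_nonneg hK
  refine ⟨C * (1 + Real.log K / Real.log 2) ^ (α + 1), by positivity, fun l T hT => ?_⟩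
  have h2 := two_le_shiftedNorm l
  refine (h (K * shiftedNorm l) T (by nlinarith) hT).trans ?_
  rw [decayRate, zpow_zero, one_mul, mul_assoc, ← mul_pow]
  have h3 := log_le_of_comparable (show 0 < K * shiftedNorm l by positivity) h2 hK le_rfl
  have h4 : 0 ≤ Real.log (K * shiftedNorm l) := Real.log_nonneg (by nlinarith)
  gcongr

theorem sumBound_ball_one (hd : 1 ≤ Fintype.card ι) {K : ℝ} (hK : 1 ≤ K) :
    SumBound (fun l m : L => shiftedNorm m ≤ K * shiftedNorm l)
      (fun _ m => decayRate (1 - (Fintype.card ι : ℤ)) 0 m) 1 0 := by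
  obtain ⟨C, hC, h⟩ := sum_ball_decayRate_one_sub_le c hd
  refine ⟨C * K, by positivity, fun l T hT => ?_⟩
  have h2 := two_le_shiftedNorm l
  refine (h (K * shiftedNorm l) T (by nlinarith) hT).trans (le_of_eq ?_)
  rw [decayRate, zpow_one, pow_zero]
  ring

theorem sumBound_tail (α : ℕ) {s : ℕ} (hs : 1 ≤ s) {K : ℝ} (hK : 1 ≤ K) :
    SumBound (fun l m : L => shiftedNorm l ≤ K * shiftedNorm m)
      (fun _ m => decayRate (-(Fintype.card ι : ℤ) - s) α m) (-(s : ℤ)) α := by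
  obtain ⟨C, hC, h⟩ := sum_tail_decayRate_le c α s hs
  refine ⟨C * K ^ s, by positivity, fun l T hT => ?_⟩
  have h2 := two_le_shiftedNorm l
  -- The maximum provides the lower bound required by the tail estimate; it loses no points because
  -- every shifted norm is at least 2.
  set r := max 2 (shiftedNorm l / K) with hr
  have hr2 : 2 ≤ r := le_max_left _ _
  have hrX : r ≤ shiftedNorm l := max_le h2 (div_le_self (by linarith) hK)
  have hXr : shiftedNorm l / K ≤ r := le_max_right _ _
  refine (h r T hr2 fun m hm => max_le (two_le_shiftedNorm m) ?_).trans ?_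
  · rw [div_le_iff₀' (by linarith)]; exact hT m hm
  · rw [mul_assoc, decayRate, zpow_neg, zpow_neg, zpow_natCast, zpow_natCast]
    refine mul_le_mul_of_nonneg_left ?_ hC.le
    rw [← mul_assoc]
    have h3 : (r ^ s)⁻¹ ≤ K ^ s * (shiftedNorm l ^ s)⁻¹ := by
      have h4 : (shiftedNorm l / K) ^ s ≤ r ^ s := by gcongr
      have h5 : 0 < shiftedNorm l / K := by positivity
      calc (r ^ s)⁻¹ ≤ ((shiftedNorm l / K) ^ s)⁻¹ := inv_anti₀ (by positivity) h4
        _ = _ := by rw [div_pow, inv_div, div_eq_mul_inv]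
    have h6 : 0 ≤ Real.log r := Real.log_nonneg (by linarith)
    have h7 : Real.log r ≤ Real.log (shiftedNorm l) := Real.log_le_log (by linarith) hrX
    gcongr

end SumBound

namespace LatticeCoords

variable {ι L : Type*} [Fintype ι] [DecidableEq ι] [NormedAddCommGroup L] [FiniteBalls L]
  (c : LatticeCoords ι L) {E : Type*} [NormedAddCommGroup E] [NormedSpace ℝ E]

omit [DecidableEq ι] [FiniteBalls L] [NormedSpace ℝ E] in
theorem decaysLike_multiDiff {F : L → E} {a : ℤ} {p : ℕ}
    (hF : ∀ t : List L, t.length ≤ p → DecaysLike (fun l => ‖listDiff t F l‖) (a - t.length) 0)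
    (M : Multiset ι) (hM : Multiset.card M ≤ p) :
    DecaysLike (fun l => ‖c.multiDiff M F l‖) (a - Multiset.card M) 0 := by
  have h := hF (M.toList.map c.vec) (by simpa using hM)
  simpa [multiDiff] using h

/-- For ‖m‖ small against |l|₀ the remainder is at most |m|₀^p |l|₀^{a-p} up to a constant. Against
the density this leaves the critical sum of |m|₀^{-d} log^α|m|₀, one source of the additional
logarithm. -/
theorem sumBound_near {F : L → E} {g : L → ℝ} {a : ℤ} {p α : ℕ}
    (hF : ∀ t : List L, t.length ≤ p → DecaysLike (fun l => ‖listDiff t F l‖) (a - t.length) 0)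
    (hg : DecaysLike (fun m => |g m|) (-(Fintype.card ι : ℤ) - p) α) :
    ∃ K : ℝ, 1 ≤ K ∧ SumBound (fun l m : L => K * ‖m‖ ≤ shiftedNorm l)
      (fun l m => |g m| * ‖c.taylorRem p F l (-m)‖) (a - p) (α + 1) := by
  obtain ⟨D, hD, hdom⟩ := c.exists_dominated_norm_le
  obtain ⟨C₁, hC₁, hone⟩ := c.exists_normOne_le
  obtain ⟨C₂, hC₂, hg⟩ := decaysLike_iff.1 hg
  have hF' : DecaysLike (fun l => ∑ M : Sym ι p, ‖c.multiDiff M F l‖) (a - p) 0 := by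
    refine DecaysLike.sum fun M _ => ?_
    have h := c.decaysLike_multiDiff hF (M : Multiset ι) (show Multiset.card M.1 ≤ p from M.2.le)
    rwa [show Multiset.card (M : Multiset ι) = p from M.2] at h
  obtain ⟨C₃, hC₃, hF'⟩ := decaysLike_iff.1 hF'
  obtain ⟨C₄, hC₄, hcomp⟩ := decayRate_le_of_comparable (L := L) (a - p) 0 (K := 2) (by norm_num)
  -- With this factor every point dominated by m has norm at most |l|₀/2, so the rates at l and
  -- along the integration path are comparable.
  refine ⟨2 * D, by linarith, ?_⟩
  have h0 := (sumBound_ball c α (K := 2) (by norm_num)).mul_decayRate (a - p) 0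
  rw [add_zero, zero_add] at h0
  refine h0.of_le (fun l m hm => ?_) (C := C₂ * (C₁ ^ p * (C₃ * C₄))) (by positivity)
    fun l m hm => ?_
  · have := two_le_shiftedNorm l
    have := norm_nonneg m
    show ‖m‖ + 2 ≤ _
    nlinarith
  · have hX := two_le_shiftedNorm l
    have h1 : ‖c.taylorRem p F l (-m)‖ ≤
        (c.normOne (-m) : ℝ) ^ p * (C₃ * (C₄ * decayRate (a - p) 0 l)) := by
      refine c.norm_taylorRem_le p F l (-m) (by
        have := (decayRate_pos (a - p) 0 l).le
        positivity) fun M m' hm' => ?_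
      have h2 : ‖m'‖ ≤ shiftedNorm l / 2 := by
        have := hdom m' (-m) hm'
        rw [norm_neg] at this
        linarith
      have h3 := norm_add_le l m'
      have h4 : ‖l‖ ≤ ‖l + m'‖ + ‖m'‖ := by simpa using norm_sub_le (l + m') m'
      refine (Finset.single_le_sum (f := fun M : Sym ι p => ‖c.multiDiff M F (l + m')‖)
        (fun _ _ => norm_nonneg _) (Finset.mem_univ M)).trans ((hF' _).trans ?_)
      refine mul_le_mul_of_nonneg_left (hcomp _ _ ?_ ?_) hC₃.le
      · unfold shiftedNorm at *; linarith
      · unfold shiftedNorm at *; linarith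
    have h5 : (c.normOne (-m) : ℝ) ^ p ≤ C₁ ^ p * shiftedNorm m ^ p := by
      rw [← mul_pow]
      refine pow_le_pow_left₀ (by positivity) ((hone (-m)).trans ?_) p
      rw [norm_neg]
      refine mul_le_mul_of_nonneg_left ?_ hC₁.le
      unfold shiftedNorm; linarith
    have h6 := (decayRate_pos (a - p) 0 l).le
    have h7 := (decayRate_pos (-(Fintype.card ι : ℤ) - p) α m).le
    have h8 := (shiftedNorm_pos m).le
    calc |g m| * ‖c.taylorRem p F l (-m)‖
        ≤ (C₂ * decayRate (-(Fintype.card ι : ℤ) - p) α m) *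
          ((C₁ ^ p * shiftedNorm m ^ p) * (C₃ * (C₄ * decayRate (a - p) 0 l))) := by
          refine mul_le_mul (hg m) (h1.trans ?_) (norm_nonneg _) (by positivity)
          gcongr
      _ = C₂ * (C₁ ^ p * (C₃ * C₄)) * (decayRate (a - p) 0 l *
          (decayRate (-(Fintype.card ι : ℤ) - p) α m * shiftedNorm m ^ p)) := by ring
      _ = _ := by rw [decayRate_mul_pow, sub_add_cancel]

/-- Let i < p be the degree of M. The density times the polynomial has rate -d-(p-i), so its tail
beyond |l|₀ is of order |l|₀^{i-p}, and the difference of F at l supplies |l|₀^{a-i}. -/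
theorem sumBound_far_newton {F : L → E} {g : L → ℝ} {a : ℤ} {p α : ℕ}
    (hF : ∀ t : List L, t.length ≤ p → DecaysLike (fun l => ‖listDiff t F l‖) (a - t.length) 0)
    (hg : DecaysLike (fun m => |g m|) (-(Fintype.card ι : ℤ) - p) α) {K : ℝ} (hK : 1 ≤ K)
    (M : Multiset ι) (hM : Multiset.card M < p) :
    SumBound (fun l m : L => shiftedNorm l ≤ K * shiftedNorm m)
      (fun l m => |g m| * ‖c.newton M (-m) • c.multiDiff M F l‖) (a - p) (α + 1) := by
  obtain ⟨C₁, hC₁, hq⟩ := c.exists_newton_growth M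
  obtain ⟨C₂, hC₂, hg⟩ := decaysLike_iff.1 hg
  obtain ⟨C₃, hC₃, hF⟩ := decaysLike_iff.1 (c.decaysLike_multiDiff hF M hM.le)
  obtain ⟨s, hs⟩ := Nat.exists_eq_add_of_lt hM
  have h0 := (sumBound_tail c α (s := s + 1) (by omega) hK).mul_decayRate (a - Multiset.card M) 0
  have h0' := h0.mono (b := a - p) (γ := α + 1) (by rw [hs]; push_cast; omega) (by omega)
  refine h0'.of_le (fun _ _ => id) (C := C₂ * (C₁ * C₃)) (by positivity) fun l m _ => ?_
  have h6 := (decayRate_pos (a - Multiset.card M) 0 l).le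
  have h7 := (decayRate_pos (-(Fintype.card ι : ℤ) - p) α m).le
  have h8 := (shiftedNorm_pos m).le
  rw [norm_smul, Real.norm_eq_abs]
  have h9 := hq (-m)
  rw [shiftedNorm_neg] at h9
  calc |g m| * (|c.newton M (-m)| * ‖c.multiDiff M F l‖)
      ≤ (C₂ * decayRate (-(Fintype.card ι : ℤ) - p) α m) *
        ((C₁ * shiftedNorm m ^ Multiset.card M) * (C₃ * decayRate (a - Multiset.card M) 0 l)) := by
        have := hg m
        have := hF l
        gcongr
    _ = C₂ * (C₁ * C₃) * (decayRate (a - Multiset.card M) 0 l *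
        (decayRate (-(Fintype.card ι : ℤ) - p) α m * shiftedNorm m ^ Multiset.card M)) := by ring
    _ = _ := by
      rw [decayRate_mul_pow, show -(Fintype.card ι : ℤ) - p + (Multiset.card M : ℕ) =
        -(Fintype.card ι : ℤ) - (s + 1 : ℕ) by rw [hs]; push_cast; ring]

omit [DecidableEq ι] [NormedSpace ℝ E] in
include c in
-- If |l - m|₀ ≤ 4|l|₀, then m and l are comparable: the density is replaced by its rate at l and
-- the kernel is summed over a ball, with a logarithm when e = 0. Otherwise l - m is comparable with
-- m, and the product of both rates has a convergent tail. The case e = 1 is a first difference of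
-- the Green's function, e = 0 a second one.
theorem sumBound_far_kernel {F : L → E} {g : L → ℝ} {e p α : ℕ} (he : e ≤ 1)
    (hd : 2 ≤ Fintype.card ι)
    (hF : DecaysLike (fun l => ‖F l‖) (e - (Fintype.card ι : ℤ)) 0)
    (hg : DecaysLike (fun m => |g m|) (-(Fintype.card ι : ℤ) - p) α) {K : ℝ} (hK : 1 ≤ K) :
    SumBound (fun l m : L => shiftedNorm l ≤ K * shiftedNorm m)
      (fun l m => |g m| * ‖F (l - m)‖) (e - (Fintype.card ι : ℤ) - p) (α + 1) := by
  classical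
  obtain ⟨C₂, hC₂, hg⟩ := decaysLike_iff.1 hg
  obtain ⟨C₃, hC₃, hF⟩ := decaysLike_iff.1 hF
  have hball : SumBound (fun l n : L => shiftedNorm n ≤ 4 * shiftedNorm l)
      (fun _ n => decayRate (e - (Fintype.card ι : ℤ)) 0 n) e 1 := by
    interval_cases e
    · simpa using sumBound_ball c 0 (K := 4) (by norm_num)
    · exact (sumBound_ball_one c (by omega) (K := 4) (by norm_num)).mono (by simp) (by omega)
  have htri : ∀ l m : L, ‖m‖ ≤ ‖l‖ + ‖l - m‖ := fun l m => by
    simpa using norm_sub_le l (l - m)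
  have htri' : ∀ l m : L, ‖l - m‖ ≤ ‖l‖ + ‖m‖ := fun l m => norm_sub_le l m
  have hinner : SumBound (fun l m : L => shiftedNorm l ≤ K * shiftedNorm m ∧
      shiftedNorm (l - m) ≤ 4 * shiftedNorm l)
      (fun l m => |g m| * ‖F (l - m)‖) (e - (Fintype.card ι : ℤ) - p) (α + 1) := by
    obtain ⟨C₄, hC₄, hcomp⟩ := decayRate_le_of_comparable (L := L) (-(Fintype.card ι : ℤ) - p) α
      (K := 5 * K) (by linarith)
    have hrefl : SumBound (fun l m : L => shiftedNorm (l - m) ≤ 4 * shiftedNorm l)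
        (fun l m => decayRate (e - (Fintype.card ι : ℤ)) 0 (l - m)) e 1 := by
      obtain ⟨C, hC, h⟩ := hball
      refine ⟨C, hC, fun l T hT => ?_⟩
      have := h l (T.image fun m => l - m) (by
        intro n hn
        obtain ⟨m, hm, rfl⟩ := Finset.mem_image.1 hn
        exact hT m hm)
      rwa [Finset.sum_image (fun x _ y _ h => sub_right_injective h)] at this
    have h1 := hrefl.mul_decayRate (-(Fintype.card ι : ℤ) - p) α
    rw [show -(Fintype.card ι : ℤ) - p + e = e - (Fintype.card ι : ℤ) - p by ring] at h1
    refine h1.of_le (fun _ _ h => h.2) (C := C₂ * C₄ * C₃) (by positivity) fun l m h => ?_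
    have h2 : |g m| ≤ C₂ * (C₄ * decayRate (-(Fintype.card ι : ℤ) - p) α l) := by
      refine (hg m).trans (mul_le_mul_of_nonneg_left (hcomp m l ?_ ?_) hC₂.le)
      · have := htri l m
        have h3 := h.2
        have := norm_nonneg l
        unfold shiftedNorm at *
        nlinarith
      · have := shiftedNorm_pos m
        nlinarith [h.1]
    have h6 := (decayRate_pos (-(Fintype.card ι : ℤ) - p) α l).le
    calc |g m| * ‖F (l - m)‖ ≤ (C₂ * (C₄ * decayRate (-(Fintype.card ι : ℤ) - p) α l)) *
        (C₃ * decayRate (e - (Fintype.card ι : ℤ)) 0 (l - m)) :=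
          mul_le_mul h2 (hF _) (norm_nonneg _) (by positivity)
      _ = _ := by ring
  have houter : SumBound (fun l m : L => shiftedNorm l ≤ K * shiftedNorm m ∧
      4 * shiftedNorm l ≤ shiftedNorm (l - m))
      (fun l m => |g m| * ‖F (l - m)‖) (e - (Fintype.card ι : ℤ) - p) (α + 1) := by
    obtain ⟨C₄, hC₄, hcomp⟩ := decayRate_le_of_comparable (L := L) (e - (Fintype.card ι : ℤ)) 0
      (K := 2) (by norm_num)
    obtain ⟨s, hs⟩ := Nat.exists_eq_add_of_le (show e + 1 ≤ Fintype.card ι by omega)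
    have h1 := (sumBound_tail c α (s := p + (s + 1)) (by omega) hK).mono
      (b := e - (Fintype.card ι : ℤ) - p) (γ := α + 1) (by rw [hs]; push_cast; omega) (by omega)
    refine h1.of_le (fun _ _ h => h.1) (C := C₂ * (C₃ * C₄)) (by positivity) fun l m h => ?_
    have h2 : ‖F (l - m)‖ ≤ C₃ * (C₄ * decayRate (e - (Fintype.card ι : ℤ)) 0 m) := by
      refine (hF _).trans (mul_le_mul_of_nonneg_left (hcomp _ _ ?_ ?_) hC₃.le)
      · have := htri' l m
        have h3 := h.2
        have := norm_nonneg l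
        have := norm_nonneg m
        unfold shiftedNorm at *
        linarith
      · have := htri l m
        have h3 := h.2
        have := norm_nonneg l
        unfold shiftedNorm at *
        linarith
    have h6 := (decayRate_pos (-(Fintype.card ι : ℤ) - p) α m).le
    calc |g m| * ‖F (l - m)‖ ≤ (C₂ * decayRate (-(Fintype.card ι : ℤ) - p) α m) *
        (C₃ * (C₄ * decayRate (e - (Fintype.card ι : ℤ)) 0 m)) :=
          mul_le_mul (hg m) h2 (norm_nonneg _) (by positivity)
      _ = C₂ * (C₃ * C₄) * (decayRate (-(Fintype.card ι : ℤ) - p) α m *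
        decayRate (e - (Fintype.card ι : ℤ)) 0 m) := by ring
      _ = _ := by
        rw [decayRate_mul, add_zero, show -(Fintype.card ι : ℤ) - p + (e - (Fintype.card ι : ℤ)) =
          -(Fintype.card ι : ℤ) - (p + (s + 1) : ℕ) by rw [hs]; push_cast; ring]
  refine (hinner.union houter).of_le (fun l m h => ?_) one_pos fun l m _ => (one_mul _).ge
  rcases le_total (shiftedNorm (l - m)) (4 * shiftedNorm l) with h' | h'
  · exact Or.inl ⟨h, h'⟩
  · exact Or.inr ⟨h, h'⟩

/-- Taylor cancellation matters only near the origin; for distant m the kernel and each Newton term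
are bounded separately. -/
theorem sumBound_taylorRem {F : L → E} {g : L → ℝ} {e p α : ℕ} (he : e ≤ 1)
    (hd : 2 ≤ Fintype.card ι)
    (hF : ∀ t : List L, t.length ≤ p →
      DecaysLike (fun l => ‖listDiff t F l‖) (e - (Fintype.card ι : ℤ) - t.length) 0)
    (hg : DecaysLike (fun m => |g m|) (-(Fintype.card ι : ℤ) - p) α) :
    SumBound (fun _ _ : L => True) (fun l m => |g m| * ‖c.taylorRem p F l (-m)‖)
      (e - (Fintype.card ι : ℤ) - p) (α + 1) := by
  obtain ⟨K, hK, hnear⟩ := c.sumBound_near hF hg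
  have hfar := (sumBound_far_kernel c he hd (by simpa using hF [] (by simp)) hg hK).add
    (SumBound.sum (I := Finset.range p) fun i hi => SumBound.sum (I := Finset.univ)
      fun (M : Sym ι i) _ => c.sumBound_far_newton hF hg hK M (by
        rw [show Multiset.card (M : Multiset ι) = i from M.2]; exact Finset.mem_range.1 hi))
  have hfar' : SumBound (fun l m : L => shiftedNorm l ≤ K * shiftedNorm m)
      (fun l m => |g m| * ‖c.taylorRem p F l (-m)‖) (e - (Fintype.card ι : ℤ) - p) (α + 1) := by
    refine hfar.of_le (fun _ _ => id) one_pos fun l m _ => ?_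
    simp only [one_mul, ← Finset.mul_sum]
    rw [← mul_add]
    refine mul_le_mul_of_nonneg_left ?_ (abs_nonneg _)
    unfold taylorRem
    rw [← sub_eq_add_neg]
    refine (norm_sub_le _ _).trans (add_le_add le_rfl ?_)
    exact (norm_sum_le _ _).trans (Finset.sum_le_sum fun i _ => norm_sum_le _ _)
  refine (hnear.union hfar').of_le (fun l m _ => ?_) one_pos fun l m _ => (one_mul _).ge
  rcases le_total (K * ‖m‖) (shiftedNorm l) with h | h
  · exact Or.inl h
  · refine Or.inr (h.trans ?_)
    unfold shiftedNorm
    nlinarith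

/-- Convolution of a decaying kernel with a density with vanishing moments gains the order of the
moments. -/
theorem exists_convolution [CompleteSpace E] {F : L → E} {g : L → ℝ} {e p α : ℕ} (he : e ≤ 1)
    (hd : 2 ≤ Fintype.card ι)
    (hF : ∀ t : List L, t.length ≤ p →
      DecaysLike (fun l => ‖listDiff t F l‖) (e - (Fintype.card ι : ℤ) - t.length) 0)
    (hg : DecaysLike (fun m => |g m|) (-(Fintype.card ι : ℤ) - p) α)
    (hmom : ∀ q : L → ℝ, c.IsPoly p q → HasSum (fun m => g m * q (-m)) 0) :
    ∃ W : L → E, (∀ l, HasSum (fun m => g m • F (l - m)) (W l)) ∧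
      DecaysLike (fun l => ‖W l‖) (e - (Fintype.card ι : ℤ) - p) (α + 1) := by
  obtain ⟨C, hC, hb⟩ := c.sumBound_taylorRem he hd hF hg
  have hb' : ∀ (l : L) (T : Finset L), ∑ m ∈ T, ‖g m • c.taylorRem p F l (-m)‖ ≤
      C * decayRate (e - (Fintype.card ι : ℤ) - p) (α + 1) l := fun l T => by
    simpa [norm_smul] using hb l T fun _ _ => trivial
  have hsum : ∀ l, Summable fun m => ‖g m • c.taylorRem p F l (-m)‖ := fun l =>
    summable_of_sum_le (fun _ => norm_nonneg _) (hb' l)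
  -- The convolution is defined with the Taylor remainder in place of the kernel. The subtracted
  -- terms are summable one by one and sum to zero by the moment condition, so it is the full
  -- convolution.
  refine ⟨fun l => ∑' m, g m • c.taylorRem p F l (-m), fun l => ?_,
    decaysLike_iff.2 ⟨C, hC, fun l => ?_⟩⟩
  · have h1 := (hsum l).of_norm.hasSum
    have h2 : HasSum (fun m => ∑ i ∈ Finset.range p, ∑ M : Sym ι i,
        (g m * c.newton M (-m)) • c.multiDiff M F l) 0 := by
      have h3 : HasSum (fun m => ∑ i ∈ Finset.range p, ∑ M : Sym ι i,
          (g m * c.newton M (-m)) • c.multiDiff M F l)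
          (∑ i ∈ Finset.range p, ∑ M : Sym ι i, (0 : ℝ) • c.multiDiff M F l) :=
        hasSum_sum fun i hi => hasSum_sum fun M _ =>
          (hmom _ (IsPoly.newton (by
            rw [show Multiset.card (M : Multiset ι) = i from M.2]
            exact Finset.mem_range.1 hi))).smul_const _
      simpa using h3
    have h4 := h1.add h2
    rw [add_zero] at h4
    convert h4 using 2 with m
    simp only [taylorRem, smul_sub, Finset.smul_sum, smul_smul, ← sub_eq_add_neg, sub_add_cancel]
  · exact (norm_tsum_le_tsum_norm (hsum l)).trans
      (Real.tsum_le_of_sum_le (fun _ => norm_nonneg _) (hb' l))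

end LatticeCoords

/-! ### Summability and moments -/

section Moments

variable {ι L : Type*} [Fintype ι] [NormedAddCommGroup L] [FiniteBalls L]

theorem tendsto_shiftedNorm_cofinite : Tendsto (shiftedNorm : L → ℝ) cofinite atTop := by
  refine tendsto_atTop.2 fun r => ?_
  have h := (FiniteBalls.finite_ball (L := L) r)
  rw [eventually_cofinite]
  refine h.subset fun l hl => ?_
  simp only [Set.mem_ofPred_eq, not_le] at hl ⊢
  unfold shiftedNorm at hl
  linarith

theorem DecaysLike.tendsto_cofinite {E : Type*} [NormedAddCommGroup E] {f : L → E} {a : ℤ} {β : ℕ}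
    (hf : DecaysLike (fun l => ‖f l‖) a β) (ha : a ≤ -1) : Tendsto f cofinite (𝓝 0) := by
  obtain ⟨C, hC, h⟩ := decaysLike_iff.1 (hf.mono ha le_rfl)
  rw [tendsto_zero_iff_norm_tendsto_zero]
  have h1 := (Real.tendsto_pow_log_div_mul_add_atTop 1 0 β one_ne_zero).comp
    (tendsto_shiftedNorm_cofinite (L := L))
  have h2 := h1.const_mul C
  rw [mul_zero] at h2
  refine squeeze_zero (fun _ => norm_nonneg _) (fun l => (h l).trans (le_of_eq ?_)) h2
  simp only [Function.comp_apply, decayRate, zpow_neg_one]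
  rw [one_mul, add_zero, div_eq_inv_mul]

include ι in
theorem DecaysLike.summable (c : LatticeCoords ι L) {f : L → ℝ} {a : ℤ} {β : ℕ}
    (hf : DecaysLike (fun l => |f l|) a β) (ha : a ≤ -(Fintype.card ι : ℤ) - 1) : Summable f := by
  obtain ⟨C, hC, h⟩ := decaysLike_iff.1 (hf.mono ha le_rfl)
  obtain ⟨D, hD, h'⟩ := sum_tail_decayRate_le c β 1 le_rfl
  refine Summable.of_norm (summable_of_sum_le (c := C * (D * (2 ^ (-((1 : ℕ) : ℤ)) * Real.log 2 ^ β)))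
    (fun _ => norm_nonneg _) fun T => ?_)
  refine (Finset.sum_le_sum fun l _ => h l).trans ?_
  rw [← Finset.mul_sum]
  refine mul_le_mul_of_nonneg_left ?_ hC.le
  exact_mod_cast h' 2 T le_rfl fun m _ => two_le_shiftedNorm m

theorem hasSum_int_sub_of_tendsto {φ : ℤ → ℝ} (hφ : Tendsto φ cofinite (𝓝 0))
    (hs : Summable fun k => φ (k + 1) - φ k) : HasSum (fun k => φ (k + 1) - φ k) 0 := by
  have hcast : Function.Injective fun n : ℕ => (n : ℤ) := Nat.cast_injective
  have hinj : Function.Injective fun n : ℕ => -((n : ℤ) + 1) := fun a b h => by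
    simp only [neg_inj, add_left_inj, Nat.cast_inj] at h; exact h
  have h1 : HasSum (fun n : ℕ => φ ((n : ℤ) + 1) - φ n) (0 - φ 0) := by
    refine (hs.comp_injective hcast).hasSum_iff_tendsto_nat.2 ?_
    have h : ∀ n : ℕ, ∑ i ∈ Finset.range n, (φ ((i : ℤ) + 1) - φ i) = φ n - φ 0 := fun n => by
      have := Finset.sum_range_sub (fun i : ℕ => φ (i : ℤ)) n
      simpa using this
    refine Tendsto.congr (fun n => (h n).symm) ((Tendsto.sub_const ?_ _))
    rw [← Nat.cofinite_eq_atTop]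
    exact hφ.comp hcast.tendsto_cofinite
  have h2 : HasSum (fun n : ℕ => φ (-((n : ℤ) + 1) + 1) - φ (-((n : ℤ) + 1))) (φ 0 - 0) := by
    refine (hs.comp_injective hinj).hasSum_iff_tendsto_nat.2 ?_
    have h : ∀ n : ℕ, ∑ i ∈ Finset.range n, (φ (-((i : ℤ) + 1) + 1) - φ (-((i : ℤ) + 1))) =
        φ 0 - φ (-(n : ℤ)) := fun n => by
      have := Finset.sum_range_sub' (fun i : ℕ => φ (-(i : ℤ))) n
      simpa using this
    refine Tendsto.congr (fun n => (h n).symm) (Tendsto.const_sub _ ?_)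
    rw [← Nat.cofinite_eq_atTop]
    exact hφ.comp (Function.Injective.tendsto_cofinite fun a b h => by simpa using h)
  have h3 := HasSum.of_nat_of_neg_add_one (f := fun k : ℤ => φ (k + 1) - φ k) h1 h2
  rwa [zero_sub, sub_zero, neg_add_cancel] at h3

omit [FiniteBalls L] in
-- Since h need not be summable, the sum cannot be split into two. It is instead arranged by cosets
-- of ℤb; along each coset it telescopes, and h tends to zero at both ends. Torsion-freeness makes
-- each coset a copy of ℤ.
theorem hasSum_latticeDiff_of_tendsto [IsAddTorsionFree L] {h : L → ℝ} (b : L)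
    (hh : Tendsto h cofinite (𝓝 0)) (hs : Summable (latticeDiff b h)) :
    HasSum (latticeDiff b h) 0 := by
  by_cases hb : b = 0
  · rw [hb, latticeDiff_zero_left]; exact hasSum_zero
  set H := AddSubgroup.zmultiples b with hH
  let π : L → L ⧸ H := QuotientAddGroup.mk
  have hinj : ∀ x : L, Function.Injective fun k : ℤ => x + k • b := fun x j k h =>
    smul_left_injective ℤ hb (add_left_cancel h)
  have h1 := (Equiv.sigmaFiberEquiv π).hasSum_iff.2 hs.hasSum
  have h2 : HasSum (fun _ : L ⧸ H => (0 : ℝ)) (∑' l, latticeDiff b h l) := by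
    refine h1.sigma fun q => ?_
    obtain ⟨x, rfl⟩ := QuotientAddGroup.mk_surjective q
    have hmem : ∀ k : ℤ, π (x + k • b) = x := fun k => by
      refine QuotientAddGroup.eq.2 ?_
      rw [hH, AddSubgroup.mem_zmultiples_iff]
      exact ⟨-k, by simp⟩
    let e : ℤ ≃ {y // π y = (x : L ⧸ H)} := Equiv.ofBijective (fun k => ⟨x + k • b, hmem k⟩) (by
      refine ⟨fun j k hjk => hinj x (congrArg Subtype.val hjk), fun y => ?_⟩
      obtain ⟨k, hk⟩ := AddSubgroup.mem_zmultiples_iff.1 (QuotientAddGroup.eq.1 y.2.symm)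
      exact ⟨k, Subtype.ext (by simp [hk])⟩)
    refine e.hasSum_iff.1 ?_
    have h3 : HasSum (fun k : ℤ => h (x + (k + 1) • b) - h (x + k • b)) 0 := by
      refine hasSum_int_sub_of_tendsto (φ := fun k => h (x + k • b))
        (hh.comp (hinj x).tendsto_cofinite) ?_
      refine (hs.comp_injective (hinj x)).congr fun k => ?_
      simp [latticeDiff, add_smul, add_assoc]
    convert h3 using 2 with k
    show h (x + k • b + b) - h (x + k • b) = _
    rw [add_smul, one_smul, add_assoc]
  have h4 := hs.hasSum
  rwa [h2.unique hasSum_zero] at h4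

end Moments

namespace LatticeCoords

variable {ι L : Type*} [Fintype ι] [DecidableEq ι] [NormedAddCommGroup L] [FiniteBalls L]
  (c : LatticeCoords ι L)

include c in
omit [DecidableEq ι] [FiniteBalls L] in
theorem isAddTorsionFree : IsAddTorsionFree L :=
  Function.Injective.isAddTorsionFree c.equiv.toAddMonoidHom c.equiv.injective

variable {c}

omit [FiniteBalls L] in
theorem IsPoly.mul_decaysLike {p α : ℕ} {a : ℤ} {q g : L → ℝ} (hq : c.IsPoly (p + 1) q)
    (hg : DecaysLike (fun m => |g m|) a α) :
    DecaysLike (fun m => |g m * q (-m)|) (a + p) α := by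
  obtain ⟨C, hC, h⟩ := hq.growth
  obtain ⟨D, hD, h'⟩ := decaysLike_iff.1 hg
  refine decaysLike_iff.2 ⟨D * C, by positivity, fun m => ?_⟩
  have h1 := h (-m)
  rw [shiftedNorm_neg] at h1
  have h2 := (decayRate_pos a α m).le
  rw [abs_mul, ← decayRate_mul_pow]
  calc |g m| * |q (-m)| ≤ (D * decayRate a α m) * (C * shiftedNorm m ^ p) :=
        mul_le_mul (h' m) h1 (abs_nonneg _) (by positivity)
    _ = _ := by ring

theorem IsPoly.summable_mul {p α : ℕ} {q g : L → ℝ} (hq : c.IsPoly p q)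
    (hg : DecaysLike (fun m => |g m|) (-(Fintype.card ι : ℤ) - p) α) :
    Summable fun m => g m * q (-m) := by
  cases p with
  | zero =>
    have : q = 0 := hq [] rfl
    simp [this, summable_zero]
  | succ p =>
    refine (hq.mul_decaysLike hg).summable c ?_
    push_cast
    linarith

/-- Differencing a density raises the order of its vanishing moments. -/
theorem hasSum_moment_latticeDiff (hd : 1 ≤ Fintype.card ι) {p α : ℕ} {g : L → ℝ} (b : L)
    (hg : DecaysLike (fun m => |g m|) (-(Fintype.card ι : ℤ) - p) α)
    (hDg : DecaysLike (fun m => |latticeDiff b g m|) (-(Fintype.card ι : ℤ) - (p + 1 : ℕ)) α)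
    (hmom : ∀ q : L → ℝ, c.IsPoly p q → HasSum (fun m => g m * q (-m)) 0) (q : L → ℝ)
    (hq : c.IsPoly (p + 1) q) : HasSum (fun m => latticeDiff b g m * q (-m)) 0 := by
  have := c.isAddTorsionFree
  have h1 := hmom _ (hq.latticeDiff b)
  have h2 := hq.summable_mul hDg
  have heq : ∀ m, latticeDiff b (fun m => g m * q (-m + b)) m =
      latticeDiff b g m * q (-m) - g m * latticeDiff b q (-m) := fun m => by
    simp only [latticeDiff_apply, neg_add, neg_add_cancel_right]
    ring
  -- In this product rule the function being differenced is only of order |m|₀^{-d} log^α|m|₀, which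
  -- need not be summable; it does tend to zero, and its difference is summable.
  have h3 : HasSum (latticeDiff b fun m => g m * q (-m + b)) 0 := by
    refine hasSum_latticeDiff_of_tendsto b ?_ ?_
    · refine DecaysLike.tendsto_cofinite (a := -(Fintype.card ι : ℤ)) (β := α) ?_ (by omega)
      simpa using (hq.shift b).mul_decaysLike hg
    · exact (h2.sub h1.summable).congr fun m => (heq m).symm
  have h4 := h3.add h1
  rw [add_zero] at h4
  convert h4 using 2 with m
  rw [heq]; ring

theorem hasSum_moment_listDiff (hd : 1 ≤ Fintype.card ι) {p α : ℕ} {g : L → ℝ} (t : List L)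
    (hg : ∀ s : List L, s.length ≤ t.length →
      DecaysLike (fun m => |listDiff s g m|) (-(Fintype.card ι : ℤ) - (p + s.length : ℕ)) α)
    (hmom : ∀ q : L → ℝ, c.IsPoly p q → HasSum (fun m => g m * q (-m)) 0) (q : L → ℝ)
    (hq : c.IsPoly (p + t.length) q) : HasSum (fun m => listDiff t g m * q (-m)) 0 := by
  induction t generalizing q with
  | nil => exact hmom q hq
  | cons b t ih =>
    exact hasSum_moment_latticeDiff hd b (hg t (by simp)) (hg (b :: t) le_rfl)
      (fun q hq => ih (fun s hs => hg s (hs.trans (by simp))) q hq) q hq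

omit [DecidableEq ι] [FiniteBalls L] in
-- Summation by parts carries the differences from δ to q. No signs appear because q is evaluated at
-- -m.
theorem hasSum_multiDiff_delta (M : Multiset ι) (q : L → ℝ) (δ : L → ℝ) (h0 : δ 0 = 1)
    (hδ : ∀ l, l ≠ 0 → δ l = 0) :
    HasSum (fun m => c.multiDiff M δ m * q (-m)) (c.multiDiff M q 0) := by
  have key : ∀ (t : List L) (q : L → ℝ),
      HasSum (fun m => listDiff t δ m * q (-m)) (listDiff t q 0) := by
    intro t
    induction t with
    | nil =>
      intro q
      have := hasSum_single (f := fun m => listDiff [] δ m * q (-m)) 0 fun m hm => by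
        simp [hδ m hm]
      simpa [h0] using this
    | cons b t ih =>
      intro q
      have h1 := ih fun l => q (l + b)
      have h2 := ih q
      rw [← (Equiv.addRight b).hasSum_iff] at h1
      have h3 := h1.sub h2
      rw [listDiff_shift] at h3
      refine (funext fun m => ?_ : (fun m => listDiff (b :: t) δ m * q (-m)) = _) ▸ h3
      simp only [listDiff_cons, latticeDiff_apply, Function.comp_apply, Equiv.coe_addRight,
        neg_add, neg_add_cancel_right]
      ring
  exact key _ q

end LatticeCoords

/-! ### The multipole expansion -/

section Convolution

variable {L : Type*} [NormedAddCommGroup L]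

theorem listDiff_smul_const {E : Type*} [NormedAddCommGroup E] [NormedSpace ℝ E] (t : List L)
    (g : L → ℝ) (v : E) : listDiff t (fun l => g l • v) = fun l => listDiff t g l • v := by
  induction t with
  | nil => rfl
  | cons b t ih => funext l; simp [ih, latticeDiff, sub_smul]

theorem listDiff_component {N : ℕ} (t : List L) (g : L → EuclideanSpace ℝ (Fin N)) (k : Fin N)
    (l : L) : listDiff t (fun m => g m k) l = listDiff t g l k := by
  induction t generalizing l with
  | nil => rfl
  | cons b t ih => simp [latticeDiff, ih]

theorem decaysLike_listDiff_pointSource [FiniteBalls L] {N : ℕ} (t : List L) (k : Fin N) (a : ℤ)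
    (β : ℕ) : DecaysLike (fun l => ‖listDiff t (pointSource L k) l‖) a β := by
  obtain ⟨r, hr⟩ := listDiff_pointSource_of_large (L := L) t k
  exact DecaysLike.of_large (C := 0) (r := r) fun l hl => by simp [hr l hl]

open Classical in
/-- The scalar point source at the origin. -/
noncomputable def unitSource (L : Type*) [Zero L] : L → ℝ := fun l => if l = 0 then 1 else 0

theorem pointSource_eq_smul {N : ℕ} (k : Fin N) :
    pointSource L k = fun l => unitSource L l • EuclideanSpace.single k (1 : ℝ) := by
  funext l
  by_cases h : l = 0 <;> simp [h, pointSource, unitSource]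

theorem abs_component_le_norm {N : ℕ} (x : EuclideanSpace ℝ (Fin N)) (k : Fin N) : |x k| ≤ ‖x‖ :=
  PiLp.norm_apply_le x k

variable {E : Type*} [NormedAddCommGroup E] [NormedSpace ℝ E]

/-- `W` is the convolution of the density `g` with the kernel `F`. -/
def IsConvolution (g : L → ℝ) (F W : L → E) : Prop :=
  ∀ l, HasSum (fun m => g m • F (l - m)) (W l)

namespace IsConvolution

variable {g : L → ℝ} {F W : L → E}

theorem unique {W' : L → E} (h : IsConvolution g F W) (h' : IsConvolution g F W') : W = W' :=
  funext fun l => (h l).unique (h' l)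

theorem latticeDiff_right (h : IsConvolution g F W) (b : L) :
    IsConvolution g (latticeDiff b F) (latticeDiff b W) := fun l => by
  refine (funext fun m => ?_ : (fun m => g m • latticeDiff b F (l - m)) = _) ▸
    (h (l + b)).sub (h l)
  rw [latticeDiff_apply, smul_sub, sub_add_eq_add_sub]

theorem latticeDiff_left (h : IsConvolution g F W) (b : L) :
    IsConvolution (latticeDiff b g) F (latticeDiff b W) := fun l => by
  have h1 := (Equiv.addRight b).hasSum_iff.2 (h (l + b))
  refine (funext fun m => ?_ : (fun m => latticeDiff b g m • F (l - m)) = _) ▸ h1.sub (h l)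
  simp [latticeDiff, sub_smul]

theorem listDiff_left (h : IsConvolution g F W) (t : List L) :
    IsConvolution (listDiff t g) F (listDiff t W) := by
  induction t with
  | nil => exact h
  | cons b t ih => exact ih.latticeDiff_left b

theorem hamiltonian {N : ℕ} (R : Finset L) (V : (R → EuclideanSpace ℝ (Fin N)) → ℝ)
    {F W : L → EuclideanSpace ℝ (Fin N)} (h : IsConvolution g F W) :
    IsConvolution g (hamiltonian R V F) (hamiltonian R V W) := fun l => by
  have h1 : HasSum (fun m => g m • fun l => F (l - m)) W := Pi.hasSum.2 h
  have h2 := h1.mapL (hamiltonianCLM R V l)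
  refine (funext fun m => ?_ : (fun m => g m • _root_.hamiltonian R V F (l - m)) = _) ▸ h2
  rw [map_smul, hamiltonianCLM_apply, hamiltonian_shift_sub]

end IsConvolution

theorem isConvolution_pointSource {N : ℕ} (g : L → ℝ) (k : Fin N) :
    IsConvolution g (pointSource L k) fun l => g l • EuclideanSpace.single k (1 : ℝ) := fun l => by
  have h := hasSum_single (f := fun m => g m • pointSource L k (l - m)) l fun m hm => by
    rw [pointSource_of_ne (sub_ne_zero.2 hm.symm), smul_zero]
  simpa [pointSource] using h

end Convolution

section Multipole

variable {ι L : Type*} [Fintype ι] [NormedAddCommGroup L] [FiniteBalls L]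
  (c : LatticeCoords ι L) {N : ℕ} {R : Finset L} {V : (R → EuclideanSpace ℝ (Fin N)) → ℝ}
  {G : Fin N → L → EuclideanSpace ℝ (Fin N)}

include c in
/-- A harmonic field vanishing at infinity is zero. -/
theorem eq_zero_of_harmonic_of_tendsto (hd : 1 ≤ Fintype.card ι)
    (hR : AddSubgroup.closure (R : Set L) = ⊤) (hV : ContDiff ℝ 2 V) {c₀ : ℝ}
    (hst : FiniteStable R V c₀) {z : L → EuclideanSpace ℝ (Fin N)}
    (hz : hamiltonian R V z = 0) (hlim : Tendsto z cofinite (𝓝 0)) : z = 0 := by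
  have hfin : {l | ¬ ‖z l‖ < 1}.Finite := by
    have h := hlim.norm.eventually (gt_mem_nhds (show ‖(0 : EuclideanSpace ℝ (Fin N))‖ < 1 by simp))
    exact eventually_cofinite.1 h
  obtain ⟨M, hM⟩ := (hfin.image fun l => ‖z l‖).bddAbove
  have hb : ∀ l, ‖z l‖ ≤ max M 1 := fun l => by
    by_cases h : ‖z l‖ < 1
    · exact h.le.trans (le_max_right _ _)
    · exact (hM ⟨l, h, rfl⟩).trans (le_max_left _ _)
  have h1 : ∀ l, z l = z 0 := fun l => by
    have := latticeDiff_eq_zero_of_bounded c hR hV hst (fun l => congrFun hz l) hb l 0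
    rwa [latticeDiff_apply, zero_add, sub_eq_zero] at this
  have : Nonempty ι := Fintype.card_pos_iff.1 hd
  have : Infinite L := c.equiv.toEquiv.infinite_iff.2 inferInstance
  have h2 : Tendsto (fun _ : L => z 0) cofinite (𝓝 0) := hlim.congr h1
  have h3 := tendsto_nhds_unique h2 tendsto_const_nhds
  funext l
  rw [h1 l, ← h3]; rfl

variable [DecidableEq ι]

/-- The two sides have the same Hamiltonian and both tend to zero, so Liouville's theorem identifies
them. Only a difference of w is represented: the Green's function itself has no assumed decay. -/
theorem exists_convolution_latticeDiff (hd : 2 ≤ Fintype.card ι)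
    (hR : AddSubgroup.closure (R : Set L) = ⊤) (hV : ContDiff ℝ 2 V) {c₀ : ℝ}
    (hst : FiniteStable R V c₀) (hG : ∀ k, hamiltonian R V (G k) = pointSource L k)
    (hdec : ∀ k (t : List L), 1 ≤ t.length →
      DecaysLike (fun l => ‖listDiff t (G k) l‖) (2 - (Fintype.card ι : ℤ) - t.length) 0)
    {p α : ℕ} {w : L → EuclideanSpace ℝ (Fin N)} {ρ : L}
    (hw : Tendsto (latticeDiff ρ w) cofinite (𝓝 0))
    (hg : DecaysLike (fun l => ‖hamiltonian R V w l‖) (-(Fintype.card ι : ℤ) - p) α)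
    (hmom : ∀ (k : Fin N) (q : L → ℝ), c.IsPoly p q →
      HasSum (fun m => hamiltonian R V w m k * q (-m)) 0) :
    ∃ W : Fin N → L → EuclideanSpace ℝ (Fin N),
      (∀ k, IsConvolution (fun m => hamiltonian R V w m k) (latticeDiff ρ (G k)) (W k)) ∧
      (∀ k, DecaysLike (fun l => ‖W k l‖) (1 - (Fintype.card ι : ℤ) - p) (α + 1)) ∧
      latticeDiff ρ w = ∑ k, W k := by
  have hex : ∀ k, ∃ W : L → EuclideanSpace ℝ (Fin N),
      IsConvolution (fun m => hamiltonian R V w m k) (latticeDiff ρ (G k)) W ∧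
      DecaysLike (fun l => ‖W l‖) (1 - (Fintype.card ι : ℤ) - p) (α + 1) := fun k => by
    obtain ⟨W, h1, h2⟩ := c.exists_convolution (e := 1) le_rfl hd (F := latticeDiff ρ (G k))
      (fun t _ => by
        have h := hdec k (ρ :: t) (by simp)
        rw [listDiff_cons, ← listDiff_latticeDiff] at h
        convert h using 1
        simp only [List.length_cons]; push_cast; ring)
      (hg.of_le fun m => abs_component_le_norm _ k) (hmom k)
    exact ⟨W, h1, by simpa using h2⟩
  choose W hW hWdec using hex
  refine ⟨W, hW, hWdec, ?_⟩
  rw [← sub_eq_zero]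
  refine eq_zero_of_harmonic_of_tendsto c (by omega) hR hV hst ?_ ?_
  · have h1 : ∀ k, hamiltonian R V (W k) = latticeDiff ρ fun l =>
        hamiltonian R V w l k • EuclideanSpace.single k (1 : ℝ) := fun k => by
      have h2 := (hW k).hamiltonian R V
      rw [hamiltonian_latticeDiff, hG] at h2
      exact h2.unique ((isConvolution_pointSource _ k).latticeDiff_right ρ)
    rw [hamiltonian_sub, hamiltonian_sum, hamiltonian_latticeDiff, sub_eq_zero,
      Finset.sum_congr rfl fun k _ => h1 k]
    have h3 := listDiff_sum [ρ] Finset.univ fun (k : Fin N) (l : L) =>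
      hamiltonian R V w l k • EuclideanSpace.single k (1 : ℝ)
    simp only [listDiff_cons, listDiff_nil] at h3
    rw [← h3]
    congr 1
    funext l
    ext i
    simp [Finset.sum_apply, Pi.single_apply]
  · have h1 : Tendsto (fun l => ∑ k, W k l) cofinite (𝓝 (∑ k : Fin N, 0)) :=
      tendsto_finsetSum _ fun k _ => (hWdec k).tendsto_cofinite (by omega)
    have h2 := hw.sub h1
    simp only [Finset.sum_const_zero, sub_zero] at h2
    refine h2.congr fun l => ?_
    simp

/-- All j differences cannot be left on the kernel, because where m is close to l the density would
then keep only its rate -d-p. Two differences on the kernel bring it to the critical rate -d; the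
remaining j - 2 act on the density, improving both its decay and its vanishing moments. For j = 1
the truncated j - 2 is zero and the bound on D_ρ w suffices. -/
theorem listDiff_decay_of_moments (hd : 2 ≤ Fintype.card ι)
    (hR : AddSubgroup.closure (R : Set L) = ⊤) (hV : ContDiff ℝ 2 V) {c₀ : ℝ}
    (hst : FiniteStable R V c₀) (hG : ∀ k, hamiltonian R V (G k) = pointSource L k)
    (hdec : ∀ k (t : List L), 1 ≤ t.length →
      DecaysLike (fun l => ‖listDiff t (G k) l‖) (2 - (Fintype.card ι : ℤ) - t.length) 0)
    {p α : ℕ} {w : L → EuclideanSpace ℝ (Fin N)}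
    (hw : ∀ ρ ∈ R, Tendsto (latticeDiff ρ w) cofinite (𝓝 0))
    (hmom : ∀ (k : Fin N) (q : L → ℝ), c.IsPoly p q →
      HasSum (fun m => hamiltonian R V w m k * q (-m)) 0) {j : ℕ} (hj : 1 ≤ j)
    (hg : ∀ t : List L, t.length ≤ j - 2 →
      DecaysLike (fun l => ‖listDiff t (hamiltonian R V w) l‖)
        (-(Fintype.card ι : ℤ) - p - t.length) α) (t : List L) (ht : t.length = j) :
    DecaysLike (fun l => ‖listDiff t w l‖) (2 - (Fintype.card ι : ℤ) - p - j) (α + 1) := by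
  refine DecaysLike.listDiff_of_closure hR (fun t htR ht => ?_) t ht
  match t with
  | [] => simp at ht; omega
  | ρ :: s =>
    obtain ⟨W, hW, hWdec, hsum⟩ := exists_convolution_latticeDiff c hd hR hV hst hG hdec
      (hw ρ (htR ρ (by simp))) (by simpa using hg [] (by simp)) hmom
    rw [listDiff_cons, ← listDiff_latticeDiff, hsum, listDiff_sum]
    have hterm : ∀ k, DecaysLike (fun l => ‖listDiff s (W k) l‖)
        (2 - (Fintype.card ι : ℤ) - p - j) (α + 1) := by
      intro k
      match s with
      | [] =>
        refine (hWdec k).mono ?_ le_rfl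
        simp at ht
        omega
      | σ :: τ =>
        have hτ : τ.length = j - 2 := by simp at ht; omega
        have hcast : (j : ℤ) = τ.length + 2 := by simp at ht; omega
        have hconv := ((hW k).latticeDiff_right σ).listDiff_left τ
        have hcomp : ∀ s : List L, s.length ≤ τ.length →
            DecaysLike (fun m => |listDiff s (fun m => hamiltonian R V w m k) m|)
              (-(Fintype.card ι : ℤ) - (p + s.length : ℕ)) α := fun s hs => by
          have h := (hg s (hs.trans hτ.le)).of_le
            (f := fun m => |listDiff s (fun m => hamiltonian R V w m k) m|) fun m => by
              rw [listDiff_component]; exact abs_component_le_norm _ k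
          convert h using 1
          push_cast; ring
        -- The kernel is now a second difference, so e = 0, and the moment order is p + |τ| with |τ|
        -- = j - 2. This gives the exponent -d-p-(j-2) = 2-d-p-j.
        obtain ⟨W', h1, h2⟩ := c.exists_convolution (e := 0) (p := p + τ.length) (by omega) hd
          (F := latticeDiff σ (latticeDiff ρ (G k))) (fun t _ => by
            have h := hdec k (σ :: ρ :: t) (by simp)
            rw [listDiff_cons, listDiff_cons, ← listDiff_latticeDiff, ← listDiff_latticeDiff] at h
            convert h using 1
            simp only [List.length_cons]; push_cast; ring)
          (hcomp τ le_rfl) (LatticeCoords.hasSum_moment_listDiff (by omega) τ hcomp (hmom k))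
        have h3 := hconv.unique h1
        rw [listDiff_cons, ← listDiff_latticeDiff, h3]
        convert h2 using 1
        rw [hcast]; push_cast; ring
    refine (DecaysLike.sum fun k (_ : k ∈ Finset.univ) => hterm k).of_le fun l => ?_
    rw [Finset.sum_apply]
    exact norm_sum_le _ _

/-- The combination of derivatives of the columns of `G` with coefficients `μ`. -/
noncomputable def multipole (G : Fin N → L → EuclideanSpace ℝ (Fin N)) (p : ℕ)
    (μ : Fin N → Multiset ι → ℝ) : L → EuclideanSpace ℝ (Fin N) :=
  ∑ i ∈ Finset.range p, ∑ k, ∑ M : Sym ι i, μ k M • c.multiDiff M (G k)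

omit [FiniteBalls L] in
theorem hamiltonian_multipole (hG : ∀ k, hamiltonian R V (G k) = pointSource L k) (p : ℕ)
    (μ : Fin N → Multiset ι → ℝ) :
    hamiltonian R V (multipole c G p μ) = multipole c (fun k => pointSource L k) p μ := by
  simp only [multipole, hamiltonian_sum, hamiltonian_smul, LatticeCoords.multiDiff,
    hamiltonian_listDiff, hG]

omit [FiniteBalls L] in
theorem listDiff_multipole (s : List L) (p : ℕ) (μ : Fin N → Multiset ι → ℝ) :
    listDiff s (multipole c G p μ) = ∑ i ∈ Finset.range p, ∑ k, ∑ M : Sym ι i,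
      μ k M • listDiff (s ++ M.1.toList.map c.vec) (G k) := by
  simp only [multipole, listDiff_sum, listDiff_smul, LatticeCoords.multiDiff, listDiff_append]
  rfl

omit [FiniteBalls L] in
theorem decaysLike_listDiff_multipole (s : List L) (p : ℕ) (μ : Fin N → Multiset ι → ℝ) {a : ℤ}
    {β : ℕ} (hdec : ∀ k (t : List L), DecaysLike (fun l => ‖listDiff (s ++ t) (G k) l‖) a β) :
    DecaysLike (fun l => ‖listDiff s (multipole c G p μ) l‖) a β := by
  have h := DecaysLike.sum (I := Finset.range p) fun i _ => DecaysLike.sum (I := Finset.univ)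
    fun (k : Fin N) _ => DecaysLike.sum (I := Finset.univ) fun (M : Sym ι i) _ =>
      (hdec k (M.1.toList.map c.vec)).const_mul (abs_nonneg (μ k M))
  refine h.of_le fun l => ?_
  rw [listDiff_multipole]
  simp only [Finset.sum_apply, Pi.smul_apply]
  refine (norm_sum_le _ _).trans (Finset.sum_le_sum fun i _ => ?_)
  refine (norm_sum_le _ _).trans (Finset.sum_le_sum fun k _ => ?_)
  refine (norm_sum_le _ _).trans (Finset.sum_le_sum fun M _ => ?_)
  rw [norm_smul, Real.norm_eq_abs]

omit [FiniteBalls L] in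
theorem multipole_pointSource_component (p : ℕ) (μ : Fin N → Multiset ι → ℝ) (l : L) (j : Fin N) :
    multipole c (fun k => pointSource L k) p μ l j = ∑ i ∈ Finset.range p, ∑ M : Sym ι i,
      μ j M * c.multiDiff M (unitSource L) l := by
  simp only [multipole, pointSource_eq_smul, LatticeCoords.multiDiff, listDiff_smul_const,
    Finset.sum_apply, Pi.smul_apply, WithLp.ofLp_sum, PiLp.smul_apply]
  refine Finset.sum_congr rfl fun i _ => ?_
  rw [Finset.sum_eq_single j]
  · simp
  · intro k _ hk
    simp [hk.symm]
  · simp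

/-- The moments of a density are matched by a combination of derivatives of point sources. -/
theorem hasSum_moment_sub_multipole {p α : ℕ} {f : L → EuclideanSpace ℝ (Fin N)}
    (hf : DecaysLike (fun l => ‖f l‖) (-(Fintype.card ι : ℤ) - p) α) (k : Fin N) {q : L → ℝ}
    (hq : c.IsPoly p q) :
    HasSum (fun m => (f - multipole c (fun k => pointSource L k) p
      fun k M => ∑' m, f m k * c.newton M (-m)) m k * q (-m)) 0 := by
  have h1 : HasSum (fun m => f m k * q (-m)) (∑ i ∈ Finset.range p, ∑ M : Sym ι i,
      (∑' m, f m k * c.newton M (-m)) * c.multiDiff M q 0) := by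
    have h2 : HasSum (fun m => ∑ i ∈ Finset.range p, ∑ M : Sym ι i,
        f m k * c.newton M (-m) * c.multiDiff M q 0) (∑ i ∈ Finset.range p, ∑ M : Sym ι i,
        (∑' m, f m k * c.newton M (-m)) * c.multiDiff M q 0) :=
      hasSum_sum fun i hi => hasSum_sum fun M _ => HasSum.mul_right _ (Summable.hasSum
        (LatticeCoords.IsPoly.summable_mul (LatticeCoords.IsPoly.newton (by
          rw [show Multiset.card (M : Multiset ι) = i from M.2]
          exact Finset.mem_range.1 hi)) (hf.of_le fun m => abs_component_le_norm _ k)))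
    convert h2 using 2 with m
    rw [hq.eq_sum_newton, Finset.mul_sum]
    simp only [Finset.mul_sum, mul_assoc]
  have h3 : HasSum (fun m => ∑ i ∈ Finset.range p, ∑ M : Sym ι i,
      (∑' m, f m k * c.newton M (-m)) *
        (c.multiDiff M (unitSource L) m * q (-m)))
      (∑ i ∈ Finset.range p, ∑ M : Sym ι i,
        (∑' m, f m k * c.newton M (-m)) * c.multiDiff M q 0) :=
    hasSum_sum fun i hi => hasSum_sum fun M _ => HasSum.mul_left _
      (LatticeCoords.hasSum_multiDiff_delta _ q _ (by simp [unitSource]) fun l hl => by simp [unitSource, hl])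
  have h4 := h1.sub h3
  rw [sub_self] at h4
  refine (funext fun m => ?_ : (fun m => (f - multipole c (fun k => pointSource L k) p
      fun k M => ∑' m, f m k * c.newton M (-m)) m k * q (-m)) = _) ▸ h4
  rw [Pi.sub_apply, PiLp.sub_apply, multipole_pointSource_component, sub_mul, Finset.sum_mul]
  simp only [Finset.sum_mul, mul_assoc]

/-- The multipole expansion of a field with decaying residual. -/
theorem exists_multipole_expansion (hd : 2 ≤ Fintype.card ι)
    (hR : AddSubgroup.closure (R : Set L) = ⊤) (hV : ContDiff ℝ 2 V) {c₀ : ℝ}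
    (hst : FiniteStable R V c₀) (hG : ∀ k, hamiltonian R V (G k) = pointSource L k)
    (hdec : ∀ k (t : List L), 1 ≤ t.length →
      DecaysLike (fun l => ‖listDiff t (G k) l‖) (2 - (Fintype.card ι : ℤ) - t.length) 0)
    {p α : ℕ} {u : L → EuclideanSpace ℝ (Fin N)}
    (hu : ∀ ρ ∈ R, Tendsto (latticeDiff ρ u) cofinite (𝓝 0))
    (hf : DecaysLike (fun l => ‖hamiltonian R V u l‖) (-(Fintype.card ι : ℤ) - p) α) :
    ∃ μ : Fin N → Multiset ι → ℝ, ∀ j : ℕ, 1 ≤ j →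
      (∀ t : List L, t.length ≤ j - 2 → DecaysLike (fun l => ‖listDiff t (hamiltonian R V u) l‖)
        (-(Fintype.card ι : ℤ) - p - t.length) α) →
      ∀ t : List L, t.length = j →
        DecaysLike (fun l => ‖listDiff t (u - multipole c G p μ) l‖)
          (2 - (Fintype.card ι : ℤ) - p - j) (α + 1) := by
  -- These are the moments of the residual against Newton polynomials at -m. A polynomial q has D^M
  -- q(0) as its Newton coefficients, and a differenced point source has moment D^M q(0), so this
  -- choice cancels every moment of degree below p.
  set μ : Fin N → Multiset ι → ℝ := fun k M => ∑' m, hamiltonian R V u m k * c.newton M (-m) with hμ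
  have hH : hamiltonian R V (u - multipole c G p μ) =
      hamiltonian R V u - multipole c (fun k => pointSource L k) p μ := by
    rw [hamiltonian_sub, hamiltonian_multipole c hG]
  refine ⟨μ, fun j hj hDf => listDiff_decay_of_moments c hd hR hV hst hG hdec (fun ρ hρ => ?_)
    (fun k q hq => ?_) hj fun t ht => ?_⟩
  · have h1 : DecaysLike (fun l => ‖listDiff [ρ] (multipole c G p μ) l‖) (-1) 0 :=
      decaysLike_listDiff_multipole c [ρ] p μ fun k t => (hdec k ([ρ] ++ t) (by simp)).mono
        (by simp only [List.length_append, List.length_cons]; push_cast; omega) le_rfl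
    have h2 := (hu ρ hρ).sub (h1.tendsto_cofinite le_rfl)
    rw [sub_zero] at h2
    exact h2.congr fun l => (congrFun (listDiff_sub [ρ] u _) l).symm
  · rw [hH]
    exact hasSum_moment_sub_multipole c hf k hq
  · rw [hH, listDiff_sub]
    -- The Hamiltonian of the multipole part has finite support, so subtracting it preserves every
    -- decay rate.
    exact ((hDf t ht).add (decaysLike_listDiff_multipole c t p μ fun k s =>
      decaysLike_listDiff_pointSource (t ++ s) k _ _)).of_le fun l => norm_sub_le _ _

end Multipole

/-! ### Symmetric tensors and coordinates on Bravais lattices -/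

section SymmetricTensor

variable {ι : Type*} [Fintype ι] [DecidableEq ι] {i : ℕ}

/-- The unordered tuple underlying a tuple. -/
def symOfFn (σ : Fin i → ι) : Sym ι i := ⟨(List.ofFn σ : Multiset ι), by simp⟩

omit [Fintype ι] [DecidableEq ι] in
theorem symOfFn_comp_perm (σ : Fin i → ι) (π : Equiv.Perm (Fin i)) :
    symOfFn (σ ∘ π) = symOfFn σ :=
  Subtype.ext (Multiset.coe_eq_coe.2 (Equiv.Perm.ofFn_comp_perm π σ))

omit [Fintype ι] [DecidableEq ι] in
theorem symOfFn_surjective : Function.Surjective (symOfFn : (Fin i → ι) → Sym ι i) := by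
  rintro ⟨M, hM⟩
  subst hM
  refine ⟨fun m => M.toList.get (m.cast (by simp)), Subtype.ext ?_⟩
  show ((List.ofFn fun m => M.toList.get (m.cast _) : List ι) : Multiset ι) = M
  rw [← List.ofFn_congr (by simp), List.ofFn_get, Multiset.coe_toList]

/-- The symmetric tensor that distributes each coefficient evenly. -/
noncomputable def symmTensor (μ : Sym ι i → ℝ) (σ : Fin i → ι) : ℝ :=
  μ (symOfFn σ) / (Finset.univ.filter fun τ : Fin i → ι => symOfFn τ = symOfFn σ).card

theorem isSymmTensor_symmTensor (μ : Sym ι i → ℝ) : IsSymmTensor (symmTensor μ) := fun π σ => by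
  simp only [symmTensor, symOfFn_comp_perm]

theorem sum_symmTensor_smul {E : Type*} [AddCommGroup E] [Module ℝ E] (μ : Sym ι i → ℝ)
    (F : Sym ι i → E) : ∑ σ, symmTensor μ σ • F (symOfFn σ) = ∑ M, μ M • F M := by
  rw [← Finset.sum_fiberwise Finset.univ (symOfFn : (Fin i → ι) → Sym ι i)]
  refine Finset.sum_congr rfl fun M _ => ?_
  have h1 : ∀ σ ∈ Finset.univ.filter fun τ : Fin i → ι => symOfFn τ = M,
      symmTensor μ σ • F (symOfFn σ) =
        (μ M / (Finset.univ.filter fun τ : Fin i → ι => symOfFn τ = M).card) • F M := by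
    intro σ hσ
    rw [symmTensor, (Finset.mem_filter.1 hσ).2]
  rw [Finset.sum_congr rfl h1, Finset.sum_const, ← Nat.cast_smul_eq_nsmul ℝ, smul_smul,
    mul_div_cancel₀]
  obtain ⟨σ, hσ⟩ := symOfFn_surjective M
  have h2 : 0 < (Finset.univ.filter fun τ : Fin i → ι => symOfFn τ = M).card :=
    Finset.card_pos.2 ⟨σ, by simp [hσ]⟩
  exact_mod_cast h2.ne'

theorem contractDiff_symmTensor {L E : Type*} [NormedAddCommGroup L] [AddCommGroup E] [Module ℝ E]
    {S : Finset L} [DecidableEq S] (c : LatticeCoords S L) (hc : ∀ s : S, c.vec s = s) (μ : Sym S i → ℝ)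
    (u : L → E) (l : L) : contractDiff S i (symmTensor μ) u l =
      (∑ M : Sym S i, μ M • c.multiDiff M u) l := by
  have h := congrFun (sum_symmTensor_smul μ fun M : Sym S i => c.multiDiff M u) l
  rw [← h, contractDiff, Finset.sum_apply]
  refine Finset.sum_congr rfl fun σ _ => ?_
  rw [Pi.smul_apply, iterDiff_eq_listDiff]
  have h1 : c.multiDiff (symOfFn σ : Multiset S) u = listDiff ((List.ofFn σ).map c.vec) u :=
    c.multiDiff_coe _ u
  rw [h1, List.map_ofFn]
  congr 3
  funext m
  exact (hc (σ m)).symm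

end SymmetricTensor

section Coordinates

variable {X : Type*} [NormedAddCommGroup X] [NormedSpace ℝ X] {Λ : AddSubgroup X} {ι : Type*}

theorem linearIndependent_int_of_real {v : ι → Λ}
    (hli : LinearIndependent ℝ fun i => (v i : X)) : LinearIndependent ℤ v := by
  have h1 : LinearIndependent ℤ fun i => (v i : X) :=
    hli.restrict_scalars (R := ℤ) fun a b h => by simpa using h
  exact LinearIndependent.of_comp Λ.subtype.toIntLinearMap h1

/-- A generating family that is linearly independent over `ℝ` is a `ℤ`-basis. -/
theorem exists_latticeBasis {v : ι → Λ} (hli : LinearIndependent ℝ fun i => (v i : X))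
    (hsp : AddSubgroup.closure (Set.range v) = ⊤) : ∃ B : Module.Basis ι ℤ Λ, ∀ i, B i = v i := by
  refine ⟨Module.Basis.mk (linearIndependent_int_of_real hli) ?_, fun i => Module.Basis.mk_apply _ _ i⟩
  intro x _
  have hx : x ∈ AddSubgroup.closure (Set.range v) := hsp ▸ AddSubgroup.mem_top x
  rw [← Submodule.span_int_eq_addSubgroupClosure] at hx
  exact hx

/-- Linear independence over ℝ makes the synthesis map antilipschitz, which is the comparison of
coordinates with the norm; generation over ℤ makes the coordinates integral. -/
theorem exists_latticeCoords [Fintype ι] {v : ι → Λ}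
    (hli : LinearIndependent ℝ fun i => (v i : X))
    (hsp : AddSubgroup.closure (Set.range v) = ⊤) :
    ∃ c : LatticeCoords ι Λ, ∀ i, c.vec i = v i := by
  classical
  have hker : (Fintype.linearCombination ℝ fun i => (v i : X)).ker = ⊥ :=
    LinearMap.ker_eq_bot.2 (linearIndependent_iff_injective_fintypeLinearCombination.1 hli)
  obtain ⟨K, hK, hanti⟩ := LinearMap.exists_antilipschitzWith _ hker
  obtain ⟨B, hB⟩ := exists_latticeBasis hli hsp
  refine ⟨⟨B.equivFun.toAddEquiv, (K : ℝ)⁻¹, by positivity, fun l i => ?_⟩, fun i => ?_⟩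
  · have h1 : Fintype.linearCombination ℝ (fun i => (v i : X)) (fun i => (B.equivFun l i : ℝ)) =
        (l : X) := by
      rw [Fintype.linearCombination_apply]
      conv_rhs => rw [← B.sum_equivFun l]
      simp [hB, Int.cast_smul_eq_zsmul]
    have h2 := hanti.le_mul_dist (fun i => (B.equivFun l i : ℝ)) 0
    rw [map_zero, dist_zero_right, dist_zero_right, h1] at h2
    have h3 := (norm_le_pi_norm (fun i => (B.equivFun l i : ℝ)) i).trans h2
    rw [inv_mul_le_iff₀ (by positivity)]
    simpa using h3
  · rw [← hB, LatticeCoords.vec]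
    refine (AddEquiv.symm_apply_eq _).2 ?_
    show _ = B.equivFun (B i)
    funext j
    simp [Pi.single_apply, eq_comm]

end Coordinates

section Bravais

variable {d : ℕ} (A : Matrix (Fin d) (Fin d) ℝ)

/-- The columns of the generating matrix, as lattice vectors. -/
def bravaisColumn (j : Fin d) : bravaisLattice A :=
  ⟨WithLp.toLp 2 (A.mulVec fun i => ((Pi.single j 1 : Fin d → ℤ) i : ℝ)), _, rfl⟩

theorem coe_bravaisColumn (j : Fin d) :
    (bravaisColumn A j : EuclideanSpace ℝ (Fin d)) = WithLp.toLp 2 (A.col j) := by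
  ext i
  simp [bravaisColumn, Matrix.mulVec, dotProduct, Pi.single_apply]

theorem linearIndependent_bravaisColumn (hA : A.det ≠ 0) :
    LinearIndependent ℝ fun j => (bravaisColumn A j : EuclideanSpace ℝ (Fin d)) := by
  have h := Matrix.linearIndependent_cols_of_det_ne_zero hA
  have h2 := h.map' (WithLp.linearEquiv 2 ℝ (Fin d → ℝ)).symm.toLinearMap (by simp)
  rwa [show (fun j => (bravaisColumn A j : EuclideanSpace ℝ (Fin d))) = _ from
    funext (coe_bravaisColumn A)]

theorem closure_bravaisColumn : AddSubgroup.closure (Set.range (bravaisColumn A)) = ⊤ := by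
  rw [eq_top_iff]
  rintro ⟨x, n, rfl⟩ _
  have h : (⟨WithLp.toLp 2 (A.mulVec fun i => (n i : ℝ)), n, rfl⟩ : bravaisLattice A) =
      ∑ j, n j • bravaisColumn A j := by
    refine Subtype.ext ?_
    rw [AddSubgroup.val_finsetSum]
    ext i
    simp [coe_bravaisColumn, Matrix.mulVec, dotProduct, mul_comm]
  rw [h]
  exact sum_mem fun j _ => zsmul_mem (AddSubgroup.subset_closure (Set.mem_range_self j)) _

/-- Coordinates with respect to two families generating the same lattice have equal rank. -/
theorem card_eq_of_latticeCoords {ι κ L : Type*} [Fintype ι] [Fintype κ] [NormedAddCommGroup L]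
    (c : LatticeCoords ι L) (c' : LatticeCoords κ L) : Fintype.card ι = Fintype.card κ := by
  have e := (c.equiv.symm.trans c'.equiv).toIntLinearEquiv.finrank_eq
  simpa using e

/-- This decay is the only consequence of finite energy that the expansion uses. -/
theorem InEnergySpace.tendsto_latticeDiff {L E : Type*} [AddCommGroup L] [NormedAddCommGroup E]
    {R : Finset L} {u : L → E} (hu : InEnergySpace R u) {ρ : L} (hρ : ρ ∈ R) :
    Tendsto (latticeDiff ρ u) cofinite (𝓝 0) := by
  rw [tendsto_zero_iff_norm_tendsto_zero]
  have h1 : Tendsto (fun l => Real.sqrt (∑ ρ : R, ‖stencil R u l ρ‖ ^ 2)) cofinite (𝓝 0) := by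
    have h := Tendsto.sqrt (Summable.tendsto_cofinite_zero hu)
    rwa [Real.sqrt_zero] at h
  refine squeeze_zero (fun _ => norm_nonneg _) (fun l => Real.le_sqrt_of_sq_le ?_) h1
  exact Finset.single_le_sum (f := fun ρ : R => ‖stencil R u l ρ‖ ^ 2) (fun _ _ => sq_nonneg _)
    (Finset.mem_univ ⟨ρ, hρ⟩)

end Bravais

/-! ### Assembly of existence and expansion. -/

theorem mainTheorem5 {d N : ℕ} (hd : 2 ≤ d)
    (A : Matrix (Fin d) (Fin d) ℝ) (hA : A.det ≠ 0)
    (R : Finset (bravaisLattice A)) (hR0 : (0 : bravaisLattice A) ∉ R)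
    (hRneg : ∀ ρ ∈ R, -ρ ∈ R)
    (hRspan : AddSubgroup.closure (R : Set (bravaisLattice A)) = ⊤)
    (V : (R → EuclideanSpace ℝ (Fin N)) → ℝ) (hV : ContDiff ℝ 2 V)
    (hVsymm : ∀ a : R → EuclideanSpace ℝ (Fin N),
      V a = V (fun ρ => -a ⟨-(ρ : bravaisLattice A), hRneg ρ ρ.2⟩))
    (hstable : LatticeStable R V) :
    (∃ G : bravaisLattice A → Matrix (Fin N) (Fin N) ℝ, IsLatticeGreensFunction d R V G) ∧
    ∀ G : bravaisLattice A → Matrix (Fin N) (Fin N) ℝ, IsLatticeGreensFunction d R V G →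
      ∀ (p α : ℕ) (u : bravaisLattice A → EuclideanSpace ℝ (Fin N)),
        InEnergySpace R u →
        DecaysLike (fun l => ‖hamiltonian R V u l‖) (-(d : ℤ) - p) α →
        ∀ S : Finset (bravaisLattice A),
          LinearIndependent ℝ (fun s : S => ((s : bravaisLattice A) : EuclideanSpace ℝ (Fin d))) →
          AddSubgroup.closure (S : Set (bravaisLattice A)) = ⊤ →
          ∃ (b : (i : ℕ) → Fin N → (Fin i → S) → ℝ)
            (w : bravaisLattice A → EuclideanSpace ℝ (Fin N)),
            (∀ i < p, ∀ k, IsSymmTensor (b i k)) ∧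
            (∀ l, u l = (∑ i ∈ Finset.range p, ∑ k : Fin N,
              contractDiff S i (b i k) (matrixColumn G k) l) + w l) ∧
            (∀ j : ℕ, j = 1 ∨ j = 2 →
              DecaysLike (normIterStencil R j w) (2 - (d : ℤ) - p - j) (α + 1)) ∧
            (∀ j : ℕ, 3 ≤ j →
              (∀ m : ℕ, 1 ≤ m → m ≤ j - 2 →
                DecaysLike (normIterStencil R m (hamiltonian R V u)) (-(d : ℤ) - p - m) α) →
              DecaysLike (normIterStencil R j w) (2 - (d : ℤ) - p - j) (α + 1)) := by
  have hccol := exists_latticeCoords (linearIndependent_bravaisColumn A hA)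
    (closure_bravaisColumn A)
  obtain ⟨cA, -⟩ := hccol
  have hballs : FiniteBalls (bravaisLattice A) := cA.finiteBalls
  obtain ⟨c₀, hst⟩ := hstable.exists_finiteStable R V
  refine ⟨?_, fun G hG p α u hu hf S hSli hSspan => ?_⟩
  · have h := exists_latticeGreensFunction cA (by simpa using hd) hRspan hV hst
    rwa [Fintype.card_fin] at h
  classical
  -- The coordinates are taken along 𝒮, so that Newton polynomials and multipole differences refer
  -- to the directions in 𝒮.
  obtain ⟨c, hc⟩ := exists_latticeCoords (v := fun s : S => (s : bravaisLattice A)) hSli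
    (by simpa using hSspan)
  have hcard : Fintype.card S = d := by
    simpa using card_eq_of_latticeCoords c cA
  have hG1 : ∀ k, hamiltonian R V (matrixColumn G k) = pointSource (bravaisLattice A) k :=
    fun k => funext fun l => hG.equation k l
  have hG2 : ∀ (k : Fin N) (t : List (bravaisLattice A)), 1 ≤ t.length →
      DecaysLike (fun l => ‖listDiff t (matrixColumn G k) l‖)
        (2 - (Fintype.card S : ℤ) - t.length) 0 := fun k t ht => by
    rw [hcard]
    exact DecaysLike.listDiff_of_normIterStencil hRspan (hG.decay t.length ht k) t rfl
  obtain ⟨μ, hμ⟩ := exists_multipole_expansion c (by omega) hRspan hV hst hG1 hG2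
    (fun ρ hρ => hu.tendsto_latticeDiff hρ) (by rwa [hcard])
  rw [hcard] at hμ
  -- The expansion has one coefficient for each multiset of directions; `symmTensor` divides it
  -- evenly among the orderings to give a symmetric tensor.
  refine ⟨fun i k => symmTensor fun M : Sym S i => μ k M,
    u - multipole c (matrixColumn G) p μ, fun i _ k => isSymmTensor_symmTensor _, fun l => ?_,
    fun j hj => DecaysLike.normIterStencil (hμ j (by omega) fun t ht => ?_),
    fun j hj hDf => DecaysLike.normIterStencil (hμ j (by omega) fun t ht => ?_)⟩
  · simp only [contractDiff_symmTensor c hc, Pi.sub_apply, multipole, Finset.sum_apply]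
    abel
  -- For j = 1 and j = 2 the truncated difference j - 2 is zero, so only the undifferenced residual
  -- is needed.
  · obtain rfl : t = [] := List.length_eq_zero_iff.1 (by omega)
    simpa using hf
  · rcases Nat.eq_zero_or_pos t.length with h0 | h0
    · obtain rfl : t = [] := List.length_eq_zero_iff.1 h0
      simpa using hf
    · exact DecaysLike.listDiff_of_normIterStencil hRspan (hDf t.length h0 ht) t rfl
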